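/- Let $\Bbbk$ be a commutative ring and let $R$ be an associative $\Bbbk$-algebra. Modules are left modules; $R^\circ$ is the opposite ring, so $R^\circ$-modules are right $R$-modules. **J-completion.** A *connected family* is a family $T=\{T_i\}_{i\in\mathbb Z}$ of covariant functors from $R$-modules to $\Bbbk$-modules together with, for every short exact sequence $0\to N'\to N\to N''\to 0$ of $R$-modules, connecting homomorphisms $\delta_i\colon T_{i+1}(N'')\to T_i(N')$ that are natural in the sequence. Morphisms of connected families are families of natural transformations that commute with the connecting homomorphisms. Call a connected family $U$ *injectively acyclic* if for all $i$ one has $U_i(J)=0$ for every injective $R$-module $J$, and $\delta_i\colon U_{i+1}(N'')\to U_i(N')$ is an isomorphism whenever the middle module $N$ of the sequence is injective (the second condition follows from the first if the long sequences of $U$ are exact). A *J-completion* of $T$ is an injectively acyclic connected family $\check T$ with a morphism $\tau\colon\check T\to T$ such that every morphism $\upsilon\colon U\to T$ from an injectively acyclic connected family $U$ factors as $\upsilon=\tau\sigma$ for a unique morphism $\sigma\colon U\to\check T$. **Complete homology.** Let $M$ be an $R^\circ$-module with projective resolution $P\to M$. The functors $\operatorname{Tor}_i(M,-)=H_i(P\otimes_R-)$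 (zero for $i<0$) with the usual connecting homomorphisms form a connected family; its J-completion is denoted $\check{\operatorname{Tor}}(M,-)=\{\check{\operatorname{Tor}}_i(M,-)\}_{i\in\mathbb Z}$. **Stable homology.** For an $R$-module $N$ with injective resolution $N\to I$ let $P\,\bar\otimes_R I$ be the complex with components $(P\,\bar\otimes_R I)_n=\prod_{q}P_{q+n}\otimes_R I^q$ and differential extending $p\otimes x\mapsto\partial(p)\otimes x+(-1)^{|p|}p\otimes\partial(x)$. The complex $P\otimes_R I$ with components $\coprod_q P_{q+n}\otimes_R I^q$ is a subcomplex; set $P\,\tilde\otimes_R I=(P\,\bar\otimes_R I)/(P\otimes_R I)$ and $\tilde{\operatorname{Tor}}_i(M,N)=H_{i+1}(P\,\tilde\otimes_R I)$ for $i\in\mathbb Z$. **Theorem.** Assume that $M$ has a projective resolution consisting of finitely generated modules, and let $E$ be an injective $\Bbbk$-module. For $\check{\operatorname{Tor}}$ and $\tilde{\operatorname{Tor}}$ computed from any projective resolution $P$ of $M$, the J-completion $\check{\operatorname{Tor}}(M,-)$ exists, and for every $i\in\mathbb Z$ there is an isomorphism $$\check{\operatorname{Tor}}_i(M,\operatorname{Hom}_{\Bbbk}(-,E))\;\cong\;\tilde{\operatorname{Tor}}_i(M,\operatorname{Hom}_{\Bbbk}(-,E))$$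 of contravariant functors from $R^\circ$-modules to $\Bbbk$-modules, where $R$ acts on $\operatorname{Hom}_{\Bbbk}(N,E)$ by $(rf)(n)=f(nr)$. -/

import Mathlib

open CategoryTheory TensorProduct

universe u

noncomputable section

namespace CompleteHomology

/-! ### Modules over a `k`-algebra as `k`-modules -/

/-- A module over a `k`-algebra `A` is a `k`-module by restriction of scalars. -/
instance (priority := low) moduleOfAlgebra (k : Type u) [CommRing k] (A : Type u) [Ring A]
    [Algebra k A] (M : ModuleCat.{u} A) : Module k M :=
  Module.restrictScalars k A M

instance (priority := low) scalarTowerOfAlgebra (k : Type u) [CommRing k] (A : Type u) [Ring A]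
    [Algebra k A] (M : ModuleCat.{u} A) : IsScalarTower k A M :=
  IsScalarTower.restrictScalars k A M

/-! ### The tensor product of a right module and a left module over a `k`-algebra

Right modules over `A` are modules over the opposite ring `Aᵐᵒᵖ`. -/

section Tensor

variable (k : Type u) [CommRing k] {A : Type u} [Ring A] [Algebra k A]

/-- The `k`-submodule of `M ⊗[k] N` generated by the elements `(m · a) ⊗ n - m ⊗ (a · n)`. -/
def balancedRel (M : ModuleCat.{u} Aᵐᵒᵖ) (N : ModuleCat.{u} A) : Submodule k (M ⊗[k] N) :=
  Submodule.span k
    {x | ∃ (m : M) (a : A) (n : N), x = (MulOpposite.op a • m) ⊗ₜ[k] n - m ⊗ₜ[k] (a • n)}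

/-- The tensor product `M ⊗_A N`, a `k`-module. -/
def BalTensor (M : ModuleCat.{u} Aᵐᵒᵖ) (N : ModuleCat.{u} A) : Type u :=
  (M ⊗[k] N) ⧸ balancedRel k M N

instance (M : ModuleCat.{u} Aᵐᵒᵖ) (N : ModuleCat.{u} A) : AddCommGroup (BalTensor k M N) :=
  inferInstanceAs (AddCommGroup ((M ⊗[k] N) ⧸ balancedRel k M N))

instance (M : ModuleCat.{u} Aᵐᵒᵖ) (N : ModuleCat.{u} A) : Module k (BalTensor k M N) :=
  inferInstanceAs (Module k ((M ⊗[k] N) ⧸ balancedRel k M N))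

/-- The canonical surjection `M ⊗[k] N → M ⊗_A N`. -/
def bmk (M : ModuleCat.{u} Aᵐᵒᵖ) (N : ModuleCat.{u} A) : M ⊗[k] N →ₗ[k] BalTensor k M N :=
  (balancedRel k M N).mkQ

/-- The elementary tensor `m ⊗ n` in `M ⊗_A N`. -/
def btmul {M : ModuleCat.{u} Aᵐᵒᵖ} {N : ModuleCat.{u} A} (m : M) (n : N) : BalTensor k M N :=
  bmk k M N (m ⊗ₜ[k] n)

lemma bmk_surjective (M : ModuleCat.{u} Aᵐᵒᵖ) (N : ModuleCat.{u} A) :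
    Function.Surjective (bmk k M N) :=
  Submodule.mkQ_surjective _

lemma smul_btmul {M : ModuleCat.{u} Aᵐᵒᵖ} {N : ModuleCat.{u} A} (a : A) (m : M) (n : N) :
    btmul k (MulOpposite.op a • m) n = btmul k m (a • n) :=
  (Submodule.Quotient.eq (balancedRel k M N)).2 (Submodule.subset_span ⟨m, a, n, rfl⟩)

variable {k} in
/-- The `k`-linear map on `M ⊗_A N` induced by a balanced map. -/
def bdesc {M : ModuleCat.{u} Aᵐᵒᵖ} {N : ModuleCat.{u} A} {X : Type u} [AddCommGroup X] [Module k X]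
    (f : M ⊗[k] N →ₗ[k] X)
    (hf : ∀ (m : M) (a : A) (n : N), f ((MulOpposite.op a • m) ⊗ₜ n) = f (m ⊗ₜ (a • n))) :
    BalTensor k M N →ₗ[k] X :=
  (balancedRel k M N).liftQ f (by
    rw [balancedRel, Submodule.span_le]
    rintro _ ⟨m, a, n, rfl⟩
    simp [hf])

variable {k} in
@[simp] lemma bdesc_btmul {M : ModuleCat.{u} Aᵐᵒᵖ} {N : ModuleCat.{u} A} {X : Type u}
    [AddCommGroup X] [Module k X] (f : M ⊗[k] N →ₗ[k] X)
    (hf : ∀ (m : M) (a : A) (n : N), f ((MulOpposite.op a • m) ⊗ₜ n) = f (m ⊗ₜ (a • n)))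
    (m : M) (n : N) : bdesc f hf (btmul k m n) = f (m ⊗ₜ n) := rfl

/-- The `k`-linear map `f ⊗ g : M ⊗_A N → M' ⊗_A N'`. -/
def bmap {M M' : ModuleCat.{u} Aᵐᵒᵖ} {N N' : ModuleCat.{u} A} (f : M ⟶ M') (g : N ⟶ N') :
    BalTensor k M N →ₗ[k] BalTensor k M' N' :=
  bdesc (bmk k M' N' ∘ₗ TensorProduct.map (f.hom.restrictScalars k) (g.hom.restrictScalars k))
    (by
      intro m a n
      simpa [btmul] using smul_btmul k a (f.hom m) (g.hom n))

@[simp] lemma bmap_btmul {M M' : ModuleCat.{u} Aᵐᵒᵖ} {N N' : ModuleCat.{u} A} (f : M ⟶ M')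
    (g : N ⟶ N') (m : M) (n : N) : bmap k f g (btmul k m n) = btmul k (f.hom m) (g.hom n) :=
  rfl

variable {k} in
@[ext high] lemma bal_hom_ext {M : ModuleCat.{u} Aᵐᵒᵖ} {N : ModuleCat.{u} A} {X : Type u}
    [AddCommGroup X] [Module k X] {f g : BalTensor k M N →ₗ[k] X}
    (h : ∀ m n, f (btmul k m n) = g (btmul k m n)) : f = g := by
  have h' : f ∘ₗ bmk k M N = g ∘ₗ bmk k M N := TensorProduct.ext' h
  ext x
  obtain ⟨x, rfl⟩ := bmk_surjective k M N x
  exact LinearMap.congr_fun h' x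

lemma btmul_add {M : ModuleCat.{u} Aᵐᵒᵖ} {N : ModuleCat.{u} A} (m : M) (n n' : N) :
    btmul k m (n + n') = btmul k m n + btmul k m n' := by
  simp [btmul, TensorProduct.tmul_add]

lemma add_btmul {M : ModuleCat.{u} Aᵐᵒᵖ} {N : ModuleCat.{u} A} (m m' : M) (n : N) :
    btmul k (m + m') n = btmul k m n + btmul k m' n := by
  simp [btmul, TensorProduct.add_tmul]

lemma zero_btmul {M : ModuleCat.{u} Aᵐᵒᵖ} {N : ModuleCat.{u} A} (n : N) :
    btmul k (0 : M) n = 0 := by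
  simp [btmul]

lemma btmul_zero {M : ModuleCat.{u} Aᵐᵒᵖ} {N : ModuleCat.{u} A} (m : M) :
    btmul k m (0 : N) = 0 := by
  simp [btmul]

lemma bmap_id (M : ModuleCat.{u} Aᵐᵒᵖ) (N : ModuleCat.{u} A) :
    bmap k (𝟙 M) (𝟙 N) = LinearMap.id := by
  ext; simp

lemma bmap_comp {M M' M'' : ModuleCat.{u} Aᵐᵒᵖ} {N N' N'' : ModuleCat.{u} A} (f : M ⟶ M')
    (f' : M' ⟶ M'') (g : N ⟶ N') (g' : N' ⟶ N'') :
    bmap k (f ≫ f') (g ≫ g') = bmap k f' g' ∘ₗ bmap k f g := by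
  ext; simp

lemma bmap_bmap {M M' M'' : ModuleCat.{u} Aᵐᵒᵖ} {N N' N'' : ModuleCat.{u} A} (f : M ⟶ M')
    (f' : M' ⟶ M'') (g : N ⟶ N') (g' : N' ⟶ N'') (x : BalTensor k M N) :
    bmap k f' g' (bmap k f g x) = bmap k (f ≫ f') (g ≫ g') x := by
  rw [bmap_comp]; rfl

lemma bmap_add_left {M M' : ModuleCat.{u} Aᵐᵒᵖ} {N N' : ModuleCat.{u} A} (f f' : M ⟶ M')
    (g : N ⟶ N') : bmap k (f + f') g = bmap k f g + bmap k f' g := by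
  ext; simp [add_btmul]

lemma bmap_add_right {M M' : ModuleCat.{u} Aᵐᵒᵖ} {N N' : ModuleCat.{u} A} (f : M ⟶ M')
    (g g' : N ⟶ N') : bmap k f (g + g') = bmap k f g + bmap k f g' := by
  ext; simp [btmul_add]

@[simp] lemma bmap_zero_left {M M' : ModuleCat.{u} Aᵐᵒᵖ} {N N' : ModuleCat.{u} A} (g : N ⟶ N') :
    bmap k (0 : M ⟶ M') g = 0 := by
  ext; simp [zero_btmul]

@[simp] lemma bmap_zero_right {M M' : ModuleCat.{u} Aᵐᵒᵖ} {N N' : ModuleCat.{u} A} (f : M ⟶ M') :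
    bmap k f (0 : N ⟶ N') = 0 := by
  ext; simp [btmul_zero]

/-- The functor `- ⊗_A N` from right `A`-modules to `k`-modules. -/
@[simps] def tensorWith (N : ModuleCat.{u} A) : ModuleCat.{u} Aᵐᵒᵖ ⥤ ModuleCat.{u} k where
  obj M := ModuleCat.of k (BalTensor k M N)
  map f := ModuleCat.ofHom (bmap k f (𝟙 N))
  map_id M := by rw [bmap_id]; rfl
  map_comp f g := by rw [← ModuleCat.ofHom_comp, ← bmap_comp, Category.comp_id]

instance (N : ModuleCat.{u} A) : (tensorWith k N).Additive where
  map_add {_ _ f g} := by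
    simp only [tensorWith_map, bmap_add_left]; rfl

/-- The natural transformation `- ⊗_A N ⟶ - ⊗_A N'` induced by `g : N ⟶ N'`. -/
@[simps] def tensorWithMap {N N' : ModuleCat.{u} A} (g : N ⟶ N') :
    tensorWith k N ⟶ tensorWith k N' where
  app M := ModuleCat.ofHom (bmap k (𝟙 M) g)
  naturality M M' f := congrArg ModuleCat.ofHom
    (show bmap k (𝟙 M') g ∘ₗ bmap k f (𝟙 N) = bmap k f (𝟙 N') ∘ₗ bmap k (𝟙 M) g by
      rw [← bmap_comp, ← bmap_comp]; simp)

/-- For a complex `P` of right `A`-modules, the functor `N ↦ P ⊗_A N` to complexes of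
`k`-modules. -/
@[simps] def complexTensor (P : ChainComplex (ModuleCat.{u} Aᵐᵒᵖ) ℕ) :
    ModuleCat.{u} A ⥤ ChainComplex (ModuleCat.{u} k) ℕ where
  obj N := ((tensorWith k N).mapHomologicalComplex _).obj P
  map g := (NatTrans.mapHomologicalComplex (tensorWithMap k g) _).app P
  map_id N := by
    ext n : 1
    simp only [NatTrans.mapHomologicalComplex_app_f, tensorWithMap_app, bmap_id]
    rfl
  map_comp g g' := by
    ext n : 1
    exact congrArg ModuleCat.ofHom
      (show bmap k (𝟙 (P.X n)) (g ≫ g') = bmap k (𝟙 (P.X n)) g' ∘ₗ bmap k (𝟙 (P.X n)) g by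
        rw [← bmap_comp, Category.comp_id])

instance (P : ChainComplex (ModuleCat.{u} Aᵐᵒᵖ) ℕ) :
    (complexTensor k P).PreservesZeroMorphisms where
  map_zero N N' := by
    ext n : 1
    simp only [complexTensor_map, NatTrans.mapHomologicalComplex_app_f, tensorWithMap_app,
      bmap_zero_right]
    rfl

/-! #### Projective right modules are flat -/

section Flat

variable (M : ModuleCat.{u} Aᵐᵒᵖ) (s : M →ₗ[Aᵐᵒᵖ] (M →₀ Aᵐᵒᵖ))

/-- For a section `s` of the canonical map from the free module on `M`, the map
`M ⊗_A N → ⨁_M N` sending `m ⊗ n` to `(q ↦ s(m)_q · n)`. -/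
def flatSection (N : ModuleCat.{u} A) : BalTensor k M N →ₗ[k] (M →₀ N) :=
  bdesc (TensorProduct.lift (LinearMap.mk₂ k
    (fun m n => (s m).mapRange (fun r => r.unop • n) (by simp))
    (fun m m' n => by ext q; simp [add_smul])
    (fun c m n => by
      ext q
      have h : s (c • m) = c • s m := (s.restrictScalars k).map_smul c m
      simp [h])
    (fun m n n' => by ext q; simp)
    (fun c m n => by
      ext q
      simp only [Finsupp.mapRange_apply, Finsupp.smul_apply]
      rw [← algebraMap_smul A c n, ← algebraMap_smul A c ((s m q).unop • n), smul_smul, smul_smul,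
        Algebra.commutes]))) (by
    intro m a n
    simp only [TensorProduct.lift.tmul, LinearMap.mk₂_apply]
    ext q
    simp [mul_smul])

lemma flatSection_btmul (N : ModuleCat.{u} A) (m : M) (n : N) :
    flatSection k M s N (btmul k m n) = (s m).mapRange (fun r => r.unop • n) (by simp) := by
  simp [flatSection]

/-- The map `⨁_M N → M ⊗_A N` sending `n` in the summand with index `q` to `q ⊗ n`. -/
def flatRetraction (N : ModuleCat.{u} A) : (M →₀ N) →ₗ[k] BalTensor k M N :=
  Finsupp.lsum k fun q : M =>
    bmk k M N ∘ₗ TensorProduct.mk k M N q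

lemma flatRetraction_single (N : ModuleCat.{u} A) (q : M) (n : N) :
    flatRetraction k M N (Finsupp.single q n) = btmul k q n := by
  simp [flatRetraction, btmul]

variable {M s} in
lemma flatRetraction_flatSection (hs : ∀ m, Finsupp.linearCombination Aᵐᵒᵖ id (s m) = m)
    (N : ModuleCat.{u} A) (x : BalTensor k M N) :
    flatRetraction k M N (flatSection k M s N x) = x := by
  have key : ∀ (n : N) (z : M →₀ Aᵐᵒᵖ),
      flatRetraction k M N (z.mapRange (fun r => r.unop • n) (by simp)) =
        btmul k (Finsupp.linearCombination Aᵐᵒᵖ id z) n := by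
    intro n z
    induction z using Finsupp.induction_linear with
    | zero => simp [zero_btmul]
    | add x y hx hy =>
      rw [Finsupp.mapRange_add (by intros; simp [add_smul]), map_add, map_add, hx, hy, add_btmul]
    | single q r =>
      rw [Finsupp.mapRange_single, flatRetraction_single, Finsupp.linearCombination_single, id,
        ← smul_btmul, MulOpposite.op_unop]
  suffices flatRetraction k M N ∘ₗ flatSection k M s N = LinearMap.id from
    LinearMap.congr_fun this x
  ext m n
  simp [flatSection_btmul, key, hs]

lemma flatSection_natural {N N' : ModuleCat.{u} A} (g : N ⟶ N') (x : BalTensor k M N) :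
    flatSection k M s N' (bmap k (𝟙 M) g x) =
      Finsupp.mapRange.linearMap (g.hom.restrictScalars k) (flatSection k M s N x) := by
  suffices flatSection k M s N' ∘ₗ bmap k (𝟙 M) g =
      Finsupp.mapRange.linearMap (g.hom.restrictScalars k) ∘ₗ flatSection k M s N from
    LinearMap.congr_fun this x
  ext m n
  simp [flatSection_btmul]

lemma flatRetraction_natural {N N' : ModuleCat.{u} A} (g : N ⟶ N') (y : M →₀ N) :
    bmap k (𝟙 M) g (flatRetraction k M N y) =
      flatRetraction k M N' (Finsupp.mapRange.linearMap (g.hom.restrictScalars k) y) := by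
  induction y using Finsupp.induction_linear with
  | zero => simp
  | add x y hx hy => rw [map_add, map_add, map_add, map_add, hx, hy]
  | single q n => simp [flatRetraction_single]

end Flat

lemma shortExact_tensor (M : ModuleCat.{u} Aᵐᵒᵖ) [Projective M]
    (S : ShortComplex (ModuleCat.{u} A)) (hS : S.ShortExact) :
    (ShortComplex.mk (ModuleCat.ofHom (bmap k (𝟙 M) S.f)) (ModuleCat.ofHom (bmap k (𝟙 M) S.g))
      (by rw [← ModuleCat.ofHom_comp, ← bmap_comp, S.zero, bmap_zero_right]; rfl)).ShortExact := by
  have hM : Module.Projective Aᵐᵒᵖ M := (IsProjective.iff_projective M).2 inferInstance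
  obtain ⟨s, hs⟩ := hM.out
  have hinj : Function.Injective S.f.hom := (ModuleCat.mono_iff_injective _).1 hS.mono_f
  have hsurj : Function.Surjective S.g.hom := (ModuleCat.epi_iff_surjective _).1 hS.epi_g
  have hex : ∀ x, S.g.hom x = 0 → ∃ y, S.f.hom y = x :=
    (ShortComplex.moduleCat_exact_iff S).1 hS.exact
  refine ModuleCat.shortComplex_shortExact _ ?_ ?_ ?_
  · intro x
    constructor
    · intro hx
      have h0 := flatSection_natural k M s S.g x
      have hx' : bmap k (𝟙 M) S.g x = 0 := hx
      rw [hx', map_zero] at h0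
      have : ∃ y : M →₀ S.X₁, Finsupp.mapRange.linearMap (S.f.hom.restrictScalars k) y =
          flatSection k M s S.X₂ x := by
        classical
        choose! t ht using hex
        refine ⟨(flatSection k M s S.X₂ x).mapRange (fun n => if n = 0 then 0 else t n)
          (by simp), ?_⟩
        ext q
        have hq := DFunLike.congr_fun h0.symm q
        by_cases h : flatSection k M s S.X₂ x q = 0
        · simp [h]
        · simpa [h] using ht _ hq
      obtain ⟨y, hy⟩ := this
      refine ⟨flatRetraction k M _ y, ?_⟩
      change bmap k (𝟙 M) S.f (flatRetraction k M _ y) = x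
      rw [flatRetraction_natural, hy, flatRetraction_flatSection k hs]
    · rintro ⟨y, rfl⟩
      change bmap k (𝟙 M) S.g (bmap k (𝟙 M) S.f y) = 0
      rw [bmap_bmap, S.zero, bmap_zero_right]; rfl
  · intro x y hxy
    have hxy' : bmap k (𝟙 M) S.f x = bmap k (𝟙 M) S.f y := hxy
    have h := congrArg (flatSection k M s S.X₂) hxy'
    rw [flatSection_natural, flatSection_natural] at h
    have h' := Finsupp.mapRange_injective (S.f.hom.restrictScalars k) (map_zero _) hinj h
    rw [← flatRetraction_flatSection k hs _ x, h', flatRetraction_flatSection k hs]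
  · intro x
    change ∃ y, bmap k (𝟙 M) S.g y = x
    obtain ⟨x, rfl⟩ := bmk_surjective k M _ x
    induction x using TensorProduct.induction_on with
    | zero => exact ⟨0, by simp⟩
    | add x y hx hy =>
      obtain ⟨a, ha⟩ := hx
      obtain ⟨b, hb⟩ := hy
      exact ⟨a + b, by rw [map_add, map_add, ha, hb]⟩
    | tmul m n =>
      obtain ⟨n, rfl⟩ := hsurj n
      exact ⟨btmul k m n, by rw [bmap_btmul]; rfl⟩

lemma shortExact_complexTensor (P : ChainComplex (ModuleCat.{u} Aᵐᵒᵖ) ℕ)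
    (hP : ∀ n, Projective (P.X n)) (S : ShortComplex (ModuleCat.{u} A)) (hS : S.ShortExact) :
    (S.map (complexTensor k P)).ShortExact := by
  apply HomologicalComplex.shortExact_of_degreewise_shortExact
  intro n
  exact shortExact_tensor k (P.X n) S hS

end Tensor

/-! ### Families of functors with connecting homomorphisms and J-completions -/

section JCompletion

variable (k : Type u) [CommRing k] (A : Type u) [Ring A]

/-- A `ℤ`-indexed family of functors from `A`-modules to `k`-modules with natural connecting
homomorphisms `δ : F (i + 1) (X₃) ⟶ F i (X₁)` for all short exact sequences
`0 ⟶ X₁ ⟶ X₂ ⟶ X₃ ⟶ 0`. -/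
structure ConnectedFamily where
  F : ℤ → ModuleCat.{u} A ⥤ ModuleCat.{u} k
  δ (i : ℤ) (S : ShortComplex (ModuleCat.{u} A)) (hS : S.ShortExact) :
    (F (i + 1)).obj S.X₃ ⟶ (F i).obj S.X₁
  δ_naturality (i : ℤ) {S S' : ShortComplex (ModuleCat.{u} A)} (hS : S.ShortExact)
    (hS' : S'.ShortExact) (φ : S ⟶ S') :
    (F (i + 1)).map φ.τ₃ ≫ δ i S' hS' = δ i S hS ≫ (F i).map φ.τ₁

variable {k A}

namespace ConnectedFamily

/-- A morphism of families: natural transformations that commute with the connecting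
homomorphisms. -/
@[ext] structure Hom (U T : ConnectedFamily k A) where
  app (i : ℤ) : U.F i ⟶ T.F i
  comm (i : ℤ) (S : ShortComplex (ModuleCat.{u} A)) (hS : S.ShortExact) :
    U.δ i S hS ≫ (app i).app S.X₁ = (app (i + 1)).app S.X₃ ≫ T.δ i S hS

/-- Composition of morphisms of families. -/
def Hom.comp {U V T : ConnectedFamily k A} (σ : Hom U V) (τ : Hom V T) : Hom U T where
  app i := σ.app i ≫ τ.app i
  comm i S hS := by
    rw [NatTrans.comp_app, NatTrans.comp_app, ← Category.assoc, σ.comm, Category.assoc, τ.comm,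
      Category.assoc]

/-- The family vanishes on injective modules, and it allows dimension shifting: the connecting
homomorphism of a short exact sequence with injective middle term is an isomorphism. The second
property follows from the first one if the long sequences of the family are exact. In general it is
needed, as the family `lim_k T_{i+k}(Ω^k N)` need not have exact long sequences. -/
structure IsInjectiveAcyclic (U : ConnectedFamily k A) : Prop where
  isZero (i : ℤ) (J : ModuleCat.{u} A) : Injective J → Limits.IsZero ((U.F i).obj J)
  isIso_δ (i : ℤ) (S : ShortComplex (ModuleCat.{u} A)) (hS : S.ShortExact) :
    Injective S.X₂ → IsIso (U.δ i S hS)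

/-- The morphism `τ : C ⟶ T` is a J-completion of `T`: the universal morphism to `T` from a family
that vanishes on injective modules and allows dimension shifting. -/
structure Hom.IsJCompletion {C T : ConnectedFamily k A} (τ : Hom C T) : Prop where
  acyclic : C.IsInjectiveAcyclic
  existsUnique_lift (U : ConnectedFamily k A) (hU : U.IsInjectiveAcyclic) (υ : Hom U T) :
    ∃! σ : Hom U C, σ.comp τ = υ

end ConnectedFamily

end JCompletion

/-! ### The homological functor Tor -/

section Tor

variable (k : Type u) [CommRing k] {A : Type u} [Ring A] [Algebra k A]
  {M : ModuleCat.{u} Aᵐᵒᵖ} (P : ProjectiveResolution M)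

/-- The functor `Tor_i(M, -) = H_i(P ⊗_A -)`, zero for `i < 0`. -/
def torFunctor : ℤ → ModuleCat.{u} A ⥤ ModuleCat.{u} k
  | .ofNat n => complexTensor k P.complex ⋙ HomologicalComplex.homologyFunctor _ _ n
  | .negSucc _ => (Functor.const _).obj (ModuleCat.of k PUnit)

/-- The connecting homomorphism `Tor_{i+1}(M, X₃) ⟶ Tor_i(M, X₁)` of a short exact sequence
`0 ⟶ X₁ ⟶ X₂ ⟶ X₃ ⟶ 0`, which comes from the short exact sequence of complexes
`0 ⟶ P ⊗ X₁ ⟶ P ⊗ X₂ ⟶ P ⊗ X₃ ⟶ 0`. -/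
def torδ : (i : ℤ) → (S : ShortComplex (ModuleCat.{u} A)) → S.ShortExact →
    ((torFunctor k P (i + 1)).obj S.X₃ ⟶ (torFunctor k P i).obj S.X₁)
  | .ofNat n, S, hS =>
    (shortExact_complexTensor k P.complex P.projective S hS).δ (n + 1) n rfl
  | .negSucc _, _, _ => 0

/-- The family `Tor(M, -)` with its connecting homomorphisms. -/
def torFamily : ConnectedFamily k A where
  F := torFunctor k P
  δ := torδ k P
  δ_naturality i S S' hS hS' φ := by
    cases i with
    | ofNat n =>
      exact (HomologicalComplex.HomologySequence.δ_naturality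
        ((complexTensor k P.complex).mapShortComplex.map φ)
        (shortExact_complexTensor k P.complex P.projective S hS)
        (shortExact_complexTensor k P.complex P.projective S' hS') (n + 1) n rfl).symm
    | negSucc n =>
      simp only [torδ, Limits.comp_zero, Limits.zero_comp]

end Tor

/-! ### Stable homology -/

section Stable

variable (k : Type u) [CommRing k] {A : Type u} [Ring A] [Algebra k A]
  (P : ChainComplex (ModuleCat.{u} Aᵐᵒᵖ) ℕ)

/-- Families of elements `z p q ∈ P_p ⊗ I^q`. -/
abbrev Bigraded (I : CochainComplex (ModuleCat.{u} A) ℕ) : Type u :=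
  ∀ p q : ℕ, BalTensor k (P.X p) (I.X q)

/-- The differential `p ⊗ i ↦ ∂ p ⊗ i + (-1)^{|p|} p ⊗ ∂ i`, extended to arbitrary families. For
`q = 0` the second summand is zero, as `I.d (0 - 1) 0 = I.d 0 0 = 0`. -/
def totalD (I : CochainComplex (ModuleCat.{u} A) ℕ) : Bigraded k P I →ₗ[k] Bigraded k P I where
  toFun z p q := bmap k (P.d (p + 1) p) (𝟙 _) (z (p + 1) q) +
    (-1 : k) ^ p • bmap k (𝟙 _) (I.d (q - 1) q) (z p (q - 1))
  map_add' z z' := by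
    ext p q : 2
    simp only [Pi.add_apply, map_add, smul_add]
    abel
  map_smul' c z := by
    ext p q : 2
    simp only [Pi.smul_apply, map_smul, smul_add, RingHom.id_apply, smul_comm c]

variable {k P} in
lemma totalD_apply {I : CochainComplex (ModuleCat.{u} A) ℕ} (z : Bigraded k P I) (p q : ℕ) :
    totalD k P I z p q = bmap k (P.d (p + 1) p) (𝟙 _) (z (p + 1) q) +
      (-1 : k) ^ p • bmap k (𝟙 _) (I.d (q - 1) q) (z p (q - 1)) := rfl

lemma totalD_totalD (I : CochainComplex (ModuleCat.{u} A) ℕ) (z : Bigraded k P I) :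
    totalD k P I (totalD k P I z) = 0 := by
  ext p q : 2
  simp only [totalD_apply, map_add, map_smul, bmap_bmap, Category.comp_id, Category.id_comp,
    HomologicalComplex.d_comp_d, bmap_zero_left, bmap_zero_right, LinearMap.zero_apply, smul_zero,
    add_zero, zero_add, Pi.zero_apply, ← add_smul, pow_succ]
  simp

/-- The degree `n` component `∏_i P_{i+n} ⊗ I^i` of the complex `P \bar⊗ I`: the families
supported on the pairs `(p, q)` with `p - q = n`. -/
def barComponent (I : CochainComplex (ModuleCat.{u} A) ℕ) (n : ℤ) :
    Submodule k (Bigraded k P I) where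
  carrier := {z | ∀ p q : ℕ, (p : ℤ) - q ≠ n → z p q = 0}
  add_mem' ha hb p q h := by rw [Pi.add_apply, Pi.add_apply, ha p q h, hb p q h, add_zero]
  zero_mem' _ _ _ := rfl
  smul_mem' c z hz p q h := by rw [Pi.smul_apply, Pi.smul_apply, hz p q h, smul_zero]

/-- The families with finite support. -/
def finiteFamilies (I : CochainComplex (ModuleCat.{u} A) ℕ) : Submodule k (Bigraded k P I) where
  carrier := {z | {x : ℕ × ℕ | z x.1 x.2 ≠ 0}.Finite}
  add_mem' {z z'} ha hb := (ha.union hb).subset fun x hx => by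
    by_contra h
    simp only [Set.mem_union, Set.mem_ofPred_eq, not_or, not_not] at h
    exact hx (by rw [Pi.add_apply, Pi.add_apply, h.1, h.2, add_zero])
  zero_mem' := by simp
  smul_mem' c z hz := hz.subset fun x hx h => hx (by
    rw [Pi.smul_apply, Pi.smul_apply, h, smul_zero])

/-- The degree `n` component of `P ⊗ I`, namely `∐_i P_{i+n} ⊗ I^i`, as a submodule of the degree
`n` component of `P \bar⊗ I`. -/
def tensorComponent (I : CochainComplex (ModuleCat.{u} A) ℕ) (n : ℤ) :
    Submodule k (barComponent k P I n) :=
  (finiteFamilies k P I).comap (barComponent k P I n).subtype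

lemma totalD_mem_bar (I : CochainComplex (ModuleCat.{u} A) ℕ) {m n : ℤ} (h : n + 1 = m)
    (z : Bigraded k P I) (hz : z ∈ barComponent k P I m) :
    totalD k P I z ∈ barComponent k P I n := by
  intro p q hpq
  rw [totalD_apply, hz (p + 1) q (by push_cast; omega), map_zero, zero_add]
  cases q with
  | zero => simp
  | succ q => rw [hz p (q + 1 - 1) (by push_cast at hpq ⊢; omega), map_zero, smul_zero]

lemma totalD_mem_finite (I : CochainComplex (ModuleCat.{u} A) ℕ) (z : Bigraded k P I)
    (hz : z ∈ finiteFamilies k P I) : totalD k P I z ∈ finiteFamilies k P I := by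
  have hz' : {x : ℕ × ℕ | z x.1 x.2 ≠ 0}.Finite := hz
  refine ((hz'.image (fun x => (x.1 - 1, x.2))).union
    (hz'.image (fun x => (x.1, x.2 + 1)))).subset ?_
  rintro ⟨p, q⟩ hx
  by_contra h
  simp only [Set.mem_union, Set.mem_image, Set.mem_ofPred_eq, not_or, not_exists, not_and,
    Prod.forall, Prod.mk.injEq] at h
  have h1 : z (p + 1) q = 0 := by
    by_contra h0
    exact h.1 (p + 1) q h0 (by omega) rfl
  apply hx
  rw [totalD_apply, h1, map_zero, zero_add]
  cases q with
  | zero => simp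
  | succ q =>
    have h2 : z p (q + 1 - 1) = 0 := by
      by_contra h0
      exact h.2 p q h0 rfl rfl
    rw [h2, map_zero, smul_zero]

/-- The differential on the components of the quotient complex. -/
def stableD (I : CochainComplex (ModuleCat.{u} A) ℕ) {m n : ℤ} (h : n + 1 = m) :
    (barComponent k P I m ⧸ tensorComponent k P I m) →ₗ[k]
      (barComponent k P I n ⧸ tensorComponent k P I n) :=
  Submodule.mapQ _ _ ((totalD k P I).restrict (totalD_mem_bar k P I h))
    fun z hz => totalD_mem_finite k P I z.1 hz

open Classical in
/-- The complex `P \tilde⊗ I = (P \bar⊗ I) / (P ⊗ I)`. -/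
def stableTensor (I : CochainComplex (ModuleCat.{u} A) ℕ) : ChainComplex (ModuleCat.{u} k) ℤ where
  X n := ModuleCat.of k (barComponent k P I n ⧸ tensorComponent k P I n)
  d m n := if h : n + 1 = m then ModuleCat.ofHom (stableD k P I h) else 0
  shape m n h := dif_neg h
  d_comp_d' l m n hl hm := by
    have hl' : m + 1 = l := hl
    have hm' : n + 1 = m := hm
    rw [dif_pos hl', dif_pos hm', ← ModuleCat.ofHom_comp]
    suffices stableD k P I hm' ∘ₗ stableD k P I hl' = 0 by rw [this]; rfl
    apply Submodule.linearMap_qext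
    ext z : 1
    have : (totalD k P I).restrict (totalD_mem_bar k P I hm')
        ((totalD k P I).restrict (totalD_mem_bar k P I hl') z) = 0 :=
      Subtype.ext (totalD_totalD k P I z.1)
    exact congrArg (Submodule.mkQ _) this

lemma stableTensor_d (I : CochainComplex (ModuleCat.{u} A) ℕ) {m n : ℤ} (h : n + 1 = m) :
    (stableTensor k P I).d m n = ModuleCat.ofHom (stableD k P I h) :=
  dif_pos h

section Functoriality

variable {I J K : CochainComplex (ModuleCat.{u} A) ℕ}

/-- The map on families induced by maps `I^q ⟶ J^q`. -/
def totalMap (f : ∀ q, I.X q ⟶ J.X q) : Bigraded k P I →ₗ[k] Bigraded k P J where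
  toFun z p q := bmap k (𝟙 _) (f q) (z p q)
  map_add' z z' := by ext p q : 2; exact map_add (bmap k (𝟙 _) (f q)) (z p q) (z' p q)
  map_smul' c z := by ext p q : 2; exact map_smul (bmap k (𝟙 _) (f q)) c (z p q)

lemma totalMap_mem_bar (f : ∀ q, I.X q ⟶ J.X q) (n : ℤ) (z : Bigraded k P I)
    (hz : z ∈ barComponent k P I n) : totalMap k P f z ∈ barComponent k P J n := by
  intro p q h
  change bmap k (𝟙 _) (f q) (z p q) = 0
  rw [hz p q h, map_zero]

lemma totalMap_mem_finite (f : ∀ q, I.X q ⟶ J.X q) (z : Bigraded k P I)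
    (hz : z ∈ finiteFamilies k P I) : totalMap k P f z ∈ finiteFamilies k P J := by
  have hz' : {x : ℕ × ℕ | z x.1 x.2 ≠ 0}.Finite := hz
  refine hz'.subset fun x hx h0 => hx ?_
  change bmap k (𝟙 _) (f x.2) (z x.1 x.2) = 0
  rw [h0, map_zero]

/-- The map on components of the quotient complexes induced by maps `I^q ⟶ J^q`. -/
def stableMapF (f : ∀ q, I.X q ⟶ J.X q) (n : ℤ) :
    (barComponent k P I n ⧸ tensorComponent k P I n) →ₗ[k]
      (barComponent k P J n ⧸ tensorComponent k P J n) :=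
  Submodule.mapQ _ _ ((totalMap k P f).restrict (totalMap_mem_bar k P f n))
    fun z hz => totalMap_mem_finite k P f z.1 hz

/-- The chain map `P \tilde⊗ I ⟶ P \tilde⊗ J` induced by a cochain map `f : I ⟶ J`. -/
def stableTensorMap (f : I ⟶ J) : stableTensor k P I ⟶ stableTensor k P J where
  f n := ModuleCat.ofHom (stableMapF k P f.f n)
  comm' m n h := by
    have h' : n + 1 = m := h
    simp only [stableTensor, dif_pos h', ← ModuleCat.ofHom_comp]
    congr 1
    apply Submodule.linearMap_qext
    ext z : 1
    apply congrArg (Submodule.mkQ _)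
    apply Subtype.ext
    ext p q : 2
    change totalD k P J (totalMap k P f.f z.1) p q = totalMap k P f.f (totalD k P I z.1) p q
    simp only [totalMap, totalD_apply, LinearMap.coe_mk, AddHom.coe_mk, map_add, map_smul,
      bmap_bmap, Category.comp_id, Category.id_comp, HomologicalComplex.Hom.comm]

variable (I) in
lemma stableTensorMap_id : stableTensorMap k P (𝟙 I) = 𝟙 _ := by
  ext n : 1
  refine congrArg ModuleCat.ofHom (?_ : _ = LinearMap.id)
  apply Submodule.linearMap_qext
  ext z : 1
  apply congrArg (Submodule.mkQ _)
  apply Subtype.ext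
  ext p q : 2
  change bmap k (𝟙 _) (𝟙 _) (z.1 p q) = z.1 p q
  rw [bmap_id]; rfl

lemma stableTensorMap_comp (f : I ⟶ J) (g : J ⟶ K) :
    stableTensorMap k P (f ≫ g) = stableTensorMap k P f ≫ stableTensorMap k P g := by
  ext n : 1
  refine congrArg ModuleCat.ofHom (?_ : _ = stableMapF k P g.f n ∘ₗ stableMapF k P f.f n)
  apply Submodule.linearMap_qext
  ext z : 1
  apply congrArg (Submodule.mkQ _)
  apply Subtype.ext
  ext p q : 2
  change bmap k (𝟙 _) (f.f q ≫ g.f q) (z.1 p q) =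
    bmap k (𝟙 _) (g.f q) (bmap k (𝟙 _) (f.f q) (z.1 p q))
  rw [bmap_bmap, Category.comp_id]

/-- The map of degree `1` on families induced by maps `I^{q+1} ⟶ J^q`. -/
def totalHomotopy (h : ∀ q, I.X (q + 1) ⟶ J.X q) : Bigraded k P I →ₗ[k] Bigraded k P J where
  toFun z p q := (-1 : k) ^ p • bmap k (𝟙 _) (h q) (z p (q + 1))
  map_add' z z' := by
    ext p q : 2
    simp only [Pi.add_apply, map_add, smul_add]
  map_smul' c z := by
    ext p q : 2
    simp only [Pi.smul_apply, map_smul, RingHom.id_apply, smul_comm c]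

lemma totalHomotopy_mem_bar (h : ∀ q, I.X (q + 1) ⟶ J.X q) {m n : ℤ} (hmn : m + 1 = n)
    (z : Bigraded k P I) (hz : z ∈ barComponent k P I m) :
    totalHomotopy k P h z ∈ barComponent k P J n := by
  intro p q hpq
  change (-1 : k) ^ p • bmap k (𝟙 _) (h q) (z p (q + 1)) = 0
  rw [hz p (q + 1) (by push_cast; omega), map_zero, smul_zero]

lemma totalHomotopy_mem_finite (h : ∀ q, I.X (q + 1) ⟶ J.X q) (z : Bigraded k P I)
    (hz : z ∈ finiteFamilies k P I) : totalHomotopy k P h z ∈ finiteFamilies k P J := by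
  have hz' : {x : ℕ × ℕ | z x.1 x.2 ≠ 0}.Finite := hz
  refine (hz'.image (fun x => (x.1, x.2 - 1))).subset fun x hx => ?_
  refine ⟨(x.1, x.2 + 1), fun h0 => hx ?_, rfl⟩
  change (-1 : k) ^ x.1 • bmap k (𝟙 _) (h x.2) (z x.1 (x.2 + 1)) = 0
  rw [h0, map_zero, smul_zero]

/-- The map of degree `1` on components of the quotient complexes. -/
def stableHomotopyF (h : ∀ q, I.X (q + 1) ⟶ J.X q) {m n : ℤ} (hmn : m + 1 = n) :
    (barComponent k P I m ⧸ tensorComponent k P I m) →ₗ[k]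
      (barComponent k P J n ⧸ tensorComponent k P J n) :=
  Submodule.mapQ _ _ ((totalHomotopy k P h).restrict (totalHomotopy_mem_bar k P h hmn))
    fun z hz => totalHomotopy_mem_finite k P h z.1 hz

lemma totalHomotopy_comm {f g : I ⟶ J} (h : Homotopy f g) (z : Bigraded k P I) :
    totalMap k P f.f z = totalHomotopy k P (fun q => h.hom (q + 1) q) (totalD k P I z) +
      totalD k P J (totalHomotopy k P (fun q => h.hom (q + 1) q) z) + totalMap k P g.f z := by
  ext p q : 2
  have hsq : (-1 : k) ^ p * (-1 : k) ^ p = 1 := by rw [← mul_pow]; simp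
  change bmap k (𝟙 _) (f.f q) (z p q) =
    (-1 : k) ^ p • bmap k (𝟙 _) (h.hom (q + 1) q) (bmap k (P.d (p + 1) p) (𝟙 _) (z (p + 1) (q + 1)) +
      (-1 : k) ^ p • bmap k (𝟙 _) (I.d q (q + 1)) (z p q)) +
    (bmap k (P.d (p + 1) p) (𝟙 _)
        ((-1 : k) ^ (p + 1) • bmap k (𝟙 _) (h.hom (q + 1) q) (z (p + 1) (q + 1))) +
      (-1 : k) ^ p • bmap k (𝟙 _) (J.d (q - 1) q)
        ((-1 : k) ^ p • bmap k (𝟙 _) (h.hom (q - 1 + 1) (q - 1)) (z p (q - 1 + 1)))) +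
    bmap k (𝟙 _) (g.f q) (z p q)
  have hc := h.comm q
  have e1 : bmap k (P.d (p + 1) p) (𝟙 _)
      ((-1 : k) ^ (p + 1) • bmap k (𝟙 _) (h.hom (q + 1) q) (z (p + 1) (q + 1))) =
      -((-1 : k) ^ p • bmap k (P.d (p + 1) p) (h.hom (q + 1) q) (z (p + 1) (q + 1))) := by
    rw [map_smul, bmap_bmap, Category.comp_id, Category.id_comp, pow_succ, mul_neg, mul_one,
      neg_smul]
  have e2 : (-1 : k) ^ p • bmap k (𝟙 _) (J.d (q - 1) q)
        ((-1 : k) ^ p • bmap k (𝟙 _) (h.hom (q - 1 + 1) (q - 1)) (z p (q - 1 + 1))) =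
      bmap k (𝟙 _) (prevD q h.hom) (z p q) := by
    rw [map_smul, smul_smul, hsq, one_smul, bmap_bmap, Category.comp_id]
    cases q with
    | zero => simp
    | succ q => rw [Homotopy.prevD_succ_cochainComplex]; rfl
  rw [e1, e2, hc, Homotopy.dNext_cochainComplex]
  simp only [map_add, map_smul, bmap_bmap, smul_add, smul_smul, hsq, one_smul, Category.comp_id,
    Category.id_comp, bmap_add_right, LinearMap.add_apply]
  abel

open Classical in
/-- The components of the homotopy induced by maps `I^{q+1} ⟶ J^q`. -/
def stableHomotopyHom (h : ∀ q, I.X (q + 1) ⟶ J.X q) (m n : ℤ) :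
    (stableTensor k P I).X m ⟶ (stableTensor k P J).X n :=
  if hmn : m + 1 = n then ModuleCat.ofHom (stableHomotopyF k P h hmn) else 0

lemma stableHomotopyHom_eq (h : ∀ q, I.X (q + 1) ⟶ J.X q) {m n : ℤ} (hmn : m + 1 = n) :
    stableHomotopyHom k P h m n = ModuleCat.ofHom (stableHomotopyF k P h hmn) :=
  dif_pos hmn

/-- Homotopic cochain maps induce homotopic chain maps. -/
def stableTensorHomotopy {f g : I ⟶ J} (h : Homotopy f g) :
    Homotopy (stableTensorMap k P f) (stableTensorMap k P g) where
  hom := stableHomotopyHom k P (fun q => h.hom (q + 1) q)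
  zero _ _ hmn := dif_neg hmn
  comm n := by
    have h1 : (n - 1) + 1 = n := by omega
    rw [dNext_eq _ (show (ComplexShape.down ℤ).Rel n (n - 1) from h1),
      prevD_eq _ (show (ComplexShape.down ℤ).Rel (n + 1) n from rfl),
      stableHomotopyHom_eq k P _ h1, stableHomotopyHom_eq k P _ rfl,
      stableTensor_d k P I h1, stableTensor_d k P J rfl]
    refine congrArg ModuleCat.ofHom (?_ : stableMapF k P f.f n =
      stableHomotopyF k P (fun q => h.hom (q + 1) q) h1 ∘ₗ stableD k P I h1 +
      stableD k P J rfl ∘ₗ stableHomotopyF k P (fun q => h.hom (q + 1) q) rfl +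
      stableMapF k P g.f n)
    apply Submodule.linearMap_qext
    ext z : 1
    exact congrArg (Submodule.mkQ (tensorComponent k P J n))
      (Subtype.ext (totalHomotopy_comm k P h z.1))

end Functoriality

/-- Stable homology `N ↦ H_{i+1}(P \tilde⊗ I)`, where `I` is an injective resolution of `N`. A
homomorphism `f` acts through a cochain map of injective resolutions that lifts `f`. -/
def stableTor {M : ModuleCat.{u} Aᵐᵒᵖ} (P : ProjectiveResolution M) (i : ℤ) :
    ModuleCat.{u} A ⥤ ModuleCat.{u} k where
  obj N := (stableTensor k P.complex (injectiveResolution N).cocomplex).homology (i + 1)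
  map f := HomologicalComplex.homologyMap
    (stableTensorMap k P.complex (InjectiveResolution.desc f _ _)) (i + 1)
  map_id N := by
    rw [(stableTensorHomotopy k P.complex
      (InjectiveResolution.descIdHomotopy N _)).homologyMap_eq, stableTensorMap_id,
      HomologicalComplex.homologyMap_id]
  map_comp f g := by
    rw [(stableTensorHomotopy k P.complex
      (InjectiveResolution.descCompHomotopy f g _ _ _)).homologyMap_eq, stableTensorMap_comp,
      HomologicalComplex.homologyMap_comp]

end Stable

/-! ### The duality functor -/

section Dual

variable {k : Type u} [CommRing k] (A : Type u) [Ring A] [Algebra k A]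

/-- The abelian group `Hom_k(N, E)` for a right `A`-module `N`. -/
def HomDual (N : ModuleCat.{u} Aᵐᵒᵖ) (E : ModuleCat.{u} k) : Type u := N →ₗ[k] E

instance (N : ModuleCat.{u} Aᵐᵒᵖ) (E : ModuleCat.{u} k) : AddCommGroup (HomDual A N E) :=
  inferInstanceAs (AddCommGroup (N →ₗ[k] E))

variable {A} in
/-- The underlying `k`-linear map of an element of `Hom_k(N, E)`. -/
def HomDual.lin {N : ModuleCat.{u} Aᵐᵒᵖ} {E : ModuleCat.{u} k} (f : HomDual A N E) : N →ₗ[k] E := f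

variable (k) in
/-- Right multiplication by `a`, as a `k`-linear map. -/
def rightMul (N : ModuleCat.{u} Aᵐᵒᵖ) (a : A) : N →ₗ[k] N where
  toFun n := MulOpposite.op a • n
  map_add' := smul_add _
  map_smul' c n := smul_algebra_smul_comm c (MulOpposite.op a) n

/-- The left `A`-module structure on `Hom_k(N, E)`, given by `(a · f)(n) = f(n · a)`. -/
instance (N : ModuleCat.{u} Aᵐᵒᵖ) (E : ModuleCat.{u} k) : Module A (HomDual A N E) where
  smul a f := f.lin ∘ₗ rightMul k A N a
  one_smul f := LinearMap.ext fun n => congrArg f.lin (one_smul Aᵐᵒᵖ n)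
  mul_smul a b f := LinearMap.ext fun n =>
    congrArg f.lin (mul_smul (MulOpposite.op b) (MulOpposite.op a) n)
  smul_zero _ := rfl
  smul_add _ _ _ := rfl
  add_smul a b f := LinearMap.ext fun n =>
    (congrArg f.lin (add_smul (MulOpposite.op a) (MulOpposite.op b) n)).trans
      (f.lin.map_add _ _)
  zero_smul f := LinearMap.ext fun n =>
    (congrArg f.lin (zero_smul Aᵐᵒᵖ n)).trans f.lin.map_zero

lemma HomDual.smul_lin (N : ModuleCat.{u} Aᵐᵒᵖ) (E : ModuleCat.{u} k) (a : A)
    (f : HomDual A N E) (n : N) : (a • f).lin n = f.lin (MulOpposite.op a • n) := rfl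

/-- The contravariant functor `Hom_k(-, E)` from right `A`-modules to left `A`-modules. -/
def homDual (E : ModuleCat.{u} k) : (ModuleCat.{u} Aᵐᵒᵖ)ᵒᵖ ⥤ ModuleCat.{u} A where
  obj N := ModuleCat.of A (HomDual A N.unop E)
  map {_ N'} g := ModuleCat.ofHom
    { toFun f := (f.lin ∘ₗ g.unop.hom.restrictScalars k : N'.unop →ₗ[k] E)
      map_add' _ _ := rfl
      map_smul' a f := LinearMap.ext fun n =>
        congrArg f.lin (g.unop.hom.map_smul (MulOpposite.op a) n).symm }
  map_id _ := rfl
  map_comp _ _ := rfl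

end Dual

end CompleteHomology

end

/-! Let Σ denote the cokernel of a functorial embedding `N ⟶ J N` into an injective module. For a
family T that is half exact in the sense of `IsHalfExact`, the J-completion is the limit of the
modules T_{i+n}(Σⁿ N) along the connecting homomorphisms. Maps of short exact sequences into
sequences with injective middle term are determined by their first component only up to maps through
injective modules. This does no harm here: each entry of a compatible sequence is the image of a
connecting homomorphism, and a map through an injective module kills such an image
(`IsHalfExact.map_δ_eq`, `IsHalfExact.map_tower_eq`). Hence the limit has natural connecting
homomorphisms, allows dimension shifting and vanishes on injective modules. An acyclic family is its
own limit, which gives the universal property (`completionπ_isJCompletion`).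

Let I be the injective resolution with Iⁿ = J(Σⁿ N). A class of stable homology is represented by
members z_n in P_p ⊗ Iⁿ with p - n = i + 1 that satisfy the cycle condition for large n. After a
change of signs this condition says that the differential of z_{n+1} is the image of z_n. So the
images of the z_n in P_p ⊗ Σⁿ⁺¹N are eventually cycles, and their classes in Tor_p(M, Σⁿ⁺¹N)
correspond under the connecting homomorphisms. This gives a Milnor type sequence: stable homology
always maps onto the limit (`exists_tower`, `exists_stable`, `eq_zero_of_stable_zero`), and the
kernel is controlled by a lim¹ term, which is zero if 1 - δ is surjective (`eq_zero_of_tower_zero`).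

The hypotheses on M and E enter only through that surjectivity for N = Hom(B, E). The dual of a
projective module is injective, so the duals of the syzygies C_n of B form a sequence of cosyzygies
of N. For a finitely generated projective module P_p, the module P_p ⊗ Hom(C, E) is the E-dual of
Hom(P_p, C) (`tensorEval_bijective`), so that Tor_p(M, Hom(C_n, E)) is the E-dual of Ext^p(M, C_n).
Thus 1 - δ is dual to 1 minus the connecting map Ext^p(M, C_n) → Ext^{p+1}(M, C_{n+1}) on a direct
sum. The latter is injective because the lowest component of an element is not changed, and the dual
of an injective map is surjective as E is injective (`exists_compatible_functionals`,
`oneSubδSurjective_dual`). Neither the choice of cosyzygies nor that of the resolution of M matters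
for this property (`oneSubδSurjective_homDual`). -/

noncomputable section

namespace CompleteHomology

/-! ### Elements of complexes of modules and their homology classes -/

section Classes

variable {k : Type u} [CommRing k] {ι : Type} {c : ComplexShape ι}

/-- The element `x` of `K` is a cycle with homology class `h`. -/
def IsClass (K : HomologicalComplex (ModuleCat.{u} k) c) (n : ι) (x : K.X n)
    (h : K.homology n) : Prop :=
  ∃ w : K.cycles n, (K.iCycles n).hom w = x ∧ (K.homologyπ n).hom w = h

namespace IsClass

variable {K L : HomologicalComplex (ModuleCat.{u} k) c} {n : ι}

lemma exists_rep (h : K.homology n) : ∃ x, IsClass K n x h := by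
  obtain ⟨w, hw⟩ := (ModuleCat.epi_iff_surjective (K.homologyπ n)).1 inferInstance h
  exact ⟨_, w, rfl, hw⟩

lemma unique {x : K.X n} {h h' : K.homology n} (H : IsClass K n x h) (H' : IsClass K n x h') :
    h = h' := by
  obtain ⟨w, hw, rfl⟩ := H
  obtain ⟨w', hw', rfl⟩ := H'
  rw [(ModuleCat.mono_iff_injective (K.iCycles n)).1 inferInstance (hw.trans hw'.symm)]

lemma add {x x' : K.X n} {h h' : K.homology n} (H : IsClass K n x h) (H' : IsClass K n x' h') :
    IsClass K n (x + x') (h + h') := by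
  obtain ⟨w, rfl, rfl⟩ := H
  obtain ⟨w', rfl, rfl⟩ := H'
  exact ⟨w + w', map_add _ _ _, map_add _ _ _⟩

lemma smul (a : k) {x : K.X n} {h : K.homology n} (H : IsClass K n x h) :
    IsClass K n (a • x) (a • h) := by
  obtain ⟨w, rfl, rfl⟩ := H
  exact ⟨a • w, map_smul _ _ _, map_smul _ _ _⟩

lemma neg {x : K.X n} {h : K.homology n} (H : IsClass K n x h) : IsClass K n (-x) (-h) := by
  obtain ⟨w, rfl, rfl⟩ := H
  exact ⟨-w, map_neg _ _, map_neg _ _⟩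

lemma sub {x x' : K.X n} {h h' : K.homology n} (H : IsClass K n x h) (H' : IsClass K n x' h') :
    IsClass K n (x - x') (h - h') := by
  simpa only [sub_eq_add_neg] using H.add H'.neg

lemma zero : IsClass K n 0 0 := ⟨0, map_zero _, map_zero _⟩

lemma map (f : K ⟶ L) {x : K.X n} {h : K.homology n} (H : IsClass K n x h) :
    IsClass L n ((f.f n).hom x) ((HomologicalComplex.homologyMap f n).hom h) := by
  obtain ⟨w, rfl, rfl⟩ := H
  refine ⟨(HomologicalComplex.cyclesMap f n).hom w, ?_, ?_⟩
  · exact ConcreteCategory.congr_hom (HomologicalComplex.cyclesMap_i f n) w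
  · exact ConcreteCategory.congr_hom (HomologicalComplex.homologyπ_naturality f n).symm w

lemma d_eq_zero {x : K.X n} {h : K.homology n} (H : IsClass K n x h) (m : ι) :
    (K.d n m).hom x = 0 := by
  obtain ⟨w, rfl, -⟩ := H
  exact ConcreteCategory.congr_hom (K.iCycles_d n m) w

lemma exists_of_d_eq_zero {m : ι} (hm : c.next n = m) {x : K.X n} (hx : (K.d n m).hom x = 0) :
    ∃ h, IsClass K n x h := by
  have hex : (ShortComplex.mk (K.iCycles n) (K.d n m) (K.iCycles_d n m)).Exact :=
    ShortComplex.exact_of_f_is_kernel _ (K.cyclesIsKernel n m hm)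
  obtain ⟨w, hw⟩ := (ShortComplex.moduleCat_exact_iff _).1 hex x hx
  exact ⟨_, w, hw, rfl⟩

lemma of_d {m : ι} (y : K.X m) : IsClass K n ((K.d m n).hom y) 0 :=
  ⟨(K.toCycles m n).hom y, ConcreteCategory.congr_hom (K.toCycles_i m n) y,
    ConcreteCategory.congr_hom (K.toCycles_comp_homologyπ m n) y⟩

lemma exists_of_zero {m : ι} (hm : c.prev n = m) {x : K.X n} (H : IsClass K n x 0) :
    ∃ y : K.X m, (K.d m n).hom y = x := by
  obtain ⟨w, rfl, hw⟩ := H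
  have hex : (ShortComplex.mk (K.toCycles m n) (K.homologyπ n)
      (K.toCycles_comp_homologyπ m n)).Exact :=
    ShortComplex.exact_of_g_is_cokernel _ (K.homologyIsCokernel m n hm)
  obtain ⟨y, rfl⟩ := (ShortComplex.moduleCat_exact_iff _).1 hex w hw
  exact ⟨y, (ConcreteCategory.congr_hom (K.toCycles_i m n) y).symm⟩

/-- The connecting homomorphism in terms of representatives. -/
lemma δ {S : ShortComplex (HomologicalComplex (ModuleCat.{u} k) c)} (hS : S.ShortExact)
    {i j : ι} (hij : c.Rel i j) {x₃ : S.X₃.X i} {h : S.X₃.homology i}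
    (H : IsClass S.X₃ i x₃ h) {x₂ : S.X₂.X i} (h₂ : (S.g.f i).hom x₂ = x₃) {x₁ : S.X₁.X j}
    (h₁ : (S.f.f j).hom x₁ = (S.X₂.d i j).hom x₂) :
    IsClass S.X₁ j x₁ ((hS.δ i j hij).hom h) := by
  obtain ⟨w, hw, rfl⟩ := H
  have hx₁ : (S.X₁.d j (c.next j)).hom x₁ = 0 := by
    have := hS.mono_f
    apply (ModuleCat.mono_iff_injective (S.f.f (c.next j))).1 inferInstance
    have e1 := ConcreteCategory.congr_hom (S.f.comm j (c.next j)) x₁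
    have e2 := ConcreteCategory.congr_hom (S.X₂.d_comp_d i j (c.next j)) x₂
    rw [map_zero]
    refine e1.symm.trans (Eq.trans ?_ e2)
    exact congrArg _ h₁
  obtain ⟨h', w', hw', rfl⟩ := exists_of_d_eq_zero rfl hx₁
  refine ⟨w', hw', ?_⟩
  refine (ShortComplex.ShortExact.δ_apply' hS i j hij ((S.X₃.homologyπ i).hom w)
    ((S.X₂.pOpcycles i).hom x₂) w' ?_ ?_).symm
  · have e1 := ConcreteCategory.congr_hom (HomologicalComplex.p_opcyclesMap S.g i) x₂
    have e2 := ConcreteCategory.congr_hom (S.X₃.homology_π_ι i) w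
    refine e1.trans (Eq.trans ?_ e2.symm)
    exact congrArg (S.X₃.pOpcycles i).hom (h₂.trans hw.symm)
  · apply (ModuleCat.mono_iff_injective (S.X₂.iCycles j)).1 inferInstance
    have e1 := ConcreteCategory.congr_hom (HomologicalComplex.cyclesMap_i S.f j) w'
    have e2 : (S.X₂.iCycles j).hom ((S.X₂.opcyclesToCycles i j).hom
        ((S.X₂.pOpcycles i).hom x₂)) = (S.X₂.d i j).hom x₂ := by
      have := ConcreteCategory.congr_hom (S.X₂.pOpcycles_opcyclesToCycles_assoc i j
        (S.X₂.iCycles j)) x₂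
      have e3 := ConcreteCategory.congr_hom (S.X₂.toCycles_i i j) x₂
      exact this.trans e3
    refine e1.trans (Eq.trans ?_ e2.symm)
    refine Eq.trans ?_ h₁
    exact congrArg (S.f.f j).hom hw'

end IsClass

end Classes

/-! ### Chains of short exact sequences of complexes -/

section Chains

variable {k : Type u} [CommRing k]

lemma hom_d_apply {ι : Type} {c : ComplexShape ι} {K L : HomologicalComplex (ModuleCat.{u} k) c}
    (f : K ⟶ L) (i j : ι) (x : K.X i) :
    (f.f j).hom ((K.d i j).hom x) = (L.d i j).hom ((f.f i).hom x) :=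
  (ConcreteCategory.congr_hom (f.comm i j) x).symm

lemma d_d_apply {ι : Type} {c : ComplexShape ι} (K : HomologicalComplex (ModuleCat.{u} k) c)
    (i j l : ι) (x : K.X i) : (K.d j l).hom ((K.d i j).hom x) = 0 :=
  ConcreteCategory.congr_hom (K.d_comp_d i j l) x

section ShortExact

variable {ι : Type} {c : ComplexShape ι}
  {S : ShortComplex (HomologicalComplex (ModuleCat.{u} k) c)} (hS : S.ShortExact)
include hS

lemma f_injective (i : ι) : Function.Injective (S.f.f i).hom := by
  have := hS.mono_f
  exact (ModuleCat.mono_iff_injective (S.f.f i)).1 inferInstance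

lemma g_surjective (i : ι) : Function.Surjective (S.g.f i).hom := by
  have := hS.epi_g
  exact (ModuleCat.epi_iff_surjective (S.g.f i)).1 inferInstance

omit hS in
lemma g_f_apply (i : ι) (x : S.X₁.X i) : (S.g.f i).hom ((S.f.f i).hom x) = 0 :=
  ConcreteCategory.congr_hom (HomologicalComplex.congr_hom S.zero i) x

lemma exists_f_eq (i : ι) {x : S.X₂.X i} (hx : (S.g.f i).hom x = 0) :
    ∃ y, (S.f.f i).hom y = x :=
  (ShortComplex.moduleCat_exact_iff _).1
    (hS.exact.map (HomologicalComplex.eval (ModuleCat.{u} k) c i)) x hx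

end ShortExact

variable {K L : ℕ → ChainComplex (ModuleCat.{u} k) ℕ} {f : ∀ n, K n ⟶ L n}
  {g : ∀ n, L n ⟶ K (n + 1)} (w : ∀ n, f n ≫ g n = 0)
  (hS : ∀ n, (ShortComplex.mk (f n) (g n) (w n)).ShortExact) (a : ℕ)

include hS in
/-- Compatible homology classes in a chain of short exact sequences come from a compatible
sequence of elements of the middle terms. -/
lemma exists_compatible_elements (c : ∀ r, (K (r + 1)).homology (a + r))
    (hc : ∀ r, ((hS (r + 1)).δ (a + r + 1) (a + r) rfl).hom (c (r + 1)) = c r) :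
    ∃ z : ∀ r, (L r).X (a + r), ∀ r,
      IsClass (K (r + 1)) (a + r) (((g r).f (a + r)).hom (z r)) (c r) ∧
      ((L (r + 1)).d (a + r + 1) (a + r)).hom (z (r + 1)) =
        ((f (r + 1)).f (a + r)).hom (((g r).f (a + r)).hom (z r)) := by
  choose y hy using fun r => IsClass.exists_rep (c r)
  choose z₀ hz₀ using fun r => g_surjective (hS r) (a + r) (y r)
  have key : ∀ r, ∃ u : (K (r + 1)).X (a + r + 1),
      ((L (r + 1)).d (a + r + 1) (a + r)).hom (z₀ (r + 1) + ((f (r + 1)).f (a + r + 1)).hom u) =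
        ((f (r + 1)).f (a + r)).hom (y r) := by
    intro r
    obtain ⟨x, hx⟩ := exists_f_eq (hS (r + 1)) (a + r)
      (x := ((L (r + 1)).d (a + r + 1) (a + r)).hom (z₀ (r + 1))) (by
        refine (hom_d_apply (g (r + 1)) _ _ _).trans ?_
        refine Eq.trans (congrArg _ (hz₀ (r + 1))) ?_
        exact (hy (r + 1)).d_eq_zero (a + r))
    -- Both `y r` and `x` represent `c r`, so they differ by a boundary. The correction of `z₀ (r +
    -- 1)` lies in the image of `f`, so it is not seen by `g`, and the corrections for different `r`
    -- do not interfere.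
    have hcl := IsClass.δ (hS (r + 1)) (i := a + r + 1) (j := a + r) rfl (hy (r + 1))
      (hz₀ (r + 1)) hx
    rw [hc] at hcl
    have h0 := (hy r).sub hcl
    rw [sub_self] at h0
    obtain ⟨u, hu⟩ := h0.exists_of_zero (ChainComplex.prev ℕ (a + r))
    refine ⟨u, ?_⟩
    rw [map_add, ← hom_d_apply, hu, map_sub]
    erw [← hx]
    exact add_sub_cancel _ _
  choose u hu using key
  refine ⟨fun r => match r with
    | 0 => z₀ 0
    | r + 1 => z₀ (r + 1) + ((f (r + 1)).f (a + r + 1)).hom (u r), ?_⟩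
  have hg : ∀ r, ((g r).f (a + r)).hom (match r with
    | 0 => z₀ 0
    | r + 1 => z₀ (r + 1) + ((f (r + 1)).f (a + r + 1)).hom (u r)) = y r := by
    intro r
    cases r with
    | zero => exact hz₀ 0
    | succ r =>
      refine (map_add _ _ _).trans ?_
      refine Eq.trans (congrArg₂ _ (hz₀ (r + 1)) (g_f_apply (S := ShortComplex.mk _ _ (w (r + 1)))
        (a + r + 1) (u r))) (add_zero _)
  intro r
  refine ⟨?_, ?_⟩
  · rw [hg]; exact hy r
  · rw [hg]; exact hu r

include hS in
/-- A compatible sequence of elements of the middle terms that induces zero classes is a boundary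
if `1 - δ` is surjective on sequences of classes one degree above. -/
lemma exists_primitive (z : ∀ r, (L r).X (a + r))
    (hz : ∀ r, ((L (r + 1)).d (a + r + 1) (a + r)).hom (z (r + 1)) =
        ((f (r + 1)).f (a + r)).hom (((g r).f (a + r)).hom (z r)))
    (hz₀ : ∀ r, IsClass (K (r + 1)) (a + r) (((g r).f (a + r)).hom (z r)) 0)
    (hlim : ∀ e : ∀ r, (K (r + 1)).homology (a + r + 1),
      ∃ e' : ∀ r, (K (r + 1)).homology (a + r + 1),
      ∀ r, e' r - ((hS (r + 1)).δ (a + r + 1 + 1) (a + r + 1) rfl).hom (e' (r + 1)) = e r) :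
    ∃ v : ∀ r, (L r).X (a + r + 1), ∀ r, z (r + 1) =
      ((L (r + 1)).d (a + r + 1 + 1) (a + r + 1)).hom (v (r + 1)) +
        ((f (r + 1)).f (a + r + 1)).hom (((g r).f (a + r + 1)).hom (v r)) := by
  choose u hu using fun r => (hz₀ r).exists_of_zero (ChainComplex.prev ℕ (a + r))
  choose v₀ hv₀ using fun r => g_surjective (hS r) (a + r + 1) (u r)
  replace hv₀ : ∀ r, ((g r).f (a + r + 1)).hom (v₀ r) = u r := hv₀
  -- The lifts `v₀` of primitives `u` solve the required equation up to elements of the image of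
  -- `f`. The defects `e r` are cycles, and their classes `c r` are the obstruction that remains.
  have h1 : ∀ r, ∃ e : (K (r + 1)).X (a + r + 1), ((f (r + 1)).f (a + r + 1)).hom e =
      z (r + 1) - ((f (r + 1)).f (a + r + 1)).hom (u r) -
        ((L (r + 1)).d (a + r + 1 + 1) (a + r + 1)).hom (v₀ (r + 1)) := by
    intro r
    apply exists_f_eq (hS (r + 1))
    change ((g (r + 1)).f (a + r + 1)).hom _ = 0
    rw [map_sub, map_sub, hom_d_apply]
    have e1 := g_f_apply (S := ShortComplex.mk _ _ (w (r + 1))) (a + r + 1) (u r)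
    have e2 := hu (r + 1)
    have e3 := hv₀ (r + 1)
    refine (congrArg₂ (fun x y => ((g (r + 1)).f (a + r + 1)).hom (z (r + 1)) - x - y) e1
      ((congrArg _ e3).trans e2)).trans ?_
    rw [sub_zero]
    exact sub_self _
  choose e he using h1
  have h2 : ∀ r, ((K (r + 1)).d (a + r + 1) (a + r)).hom (e r) = 0 := by
    intro r
    apply f_injective (hS (r + 1)) (a + r)
    refine (hom_d_apply (f (r + 1)) _ _ _).trans ?_
    rw [he, map_sub, map_sub, hz, ← hom_d_apply, hu, d_d_apply, sub_self, sub_zero]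
    exact (map_zero _).symm
  choose c hc using fun r => IsClass.exists_of_d_eq_zero (ChainComplex.next_nat_succ (a + r)) (h2 r)
  -- Adding lifts of cycles `q r` to `v₀` removes the defect if the class of `q r` plus δ of the
  -- class of `q (r + 1)` is `c r`. The alternating signs turn this operator 1 + δ into 1 - δ.
  obtain ⟨c', hc'⟩ := hlim (fun r => (-1 : k) ^ r • c r)
  choose q hq using fun r => IsClass.exists_rep ((-1 : k) ^ r • c' r)
  choose v₁ hv₁ using fun r => g_surjective (hS r) (a + r + 1) (q r)
  have h3 : ∀ r, ∃ p : (K (r + 1)).X (a + r + 1 + 1), z (r + 1) =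
      ((L (r + 1)).d (a + r + 1 + 1) (a + r + 1)).hom
        (v₀ (r + 1) + v₁ (r + 1) + ((f (r + 1)).f (a + r + 1 + 1)).hom p) +
      ((f (r + 1)).f (a + r + 1)).hom (u r + q r) := by
    intro r
    obtain ⟨x, hx⟩ := exists_f_eq (hS (r + 1)) (a + r + 1)
      (x := ((L (r + 1)).d (a + r + 1 + 1) (a + r + 1)).hom (v₁ (r + 1))) (by
        refine (hom_d_apply (g (r + 1)) _ _ _).trans ?_
        refine Eq.trans (congrArg _ (hv₁ (r + 1))) ?_
        exact (hq (r + 1)).d_eq_zero (a + r + 1))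
    have hcl := IsClass.δ (hS (r + 1)) (i := a + r + 1 + 1) (j := a + r + 1) rfl (hq (r + 1))
      (hv₁ (r + 1)) hx
    have h0 := ((hc r).sub (hq r)).sub hcl
    have hs : (-1 : k) ^ r * (-1 : k) ^ r = 1 := by rw [← mul_pow]; simp
    have hzero : c r - (-1 : k) ^ r • c' r - ((hS (r + 1)).δ (a + r + 1 + 1) (a + r + 1) rfl).hom
        ((-1 : k) ^ (r + 1) • c' (r + 1)) = 0 := by
      have e1 : c r = (-1 : k) ^ r • ((-1 : k) ^ r • c r) := by rw [smul_smul, hs, one_smul]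
      have e2 := hc' r
      simp only at e2
      rw [e1, ← e2, map_smul, pow_succ, smul_sub, mul_neg, mul_one, neg_smul]
      simp
    rw [hzero] at h0
    obtain ⟨p, hp⟩ := h0.exists_of_zero (ChainComplex.prev ℕ (a + r + 1))
    refine ⟨p, ?_⟩
    have e3 := he r
    have e4 : ((f (r + 1)).f (a + r + 1)).hom x = _ := hx
    rw [map_add, map_add, ← hom_d_apply, hp, map_sub, map_sub, e4, e3, map_add]
    abel
  choose p hp using h3
  refine ⟨fun r => match r with
    | 0 => v₀ 0 + v₁ 0
    | r + 1 => v₀ (r + 1) + v₁ (r + 1) + ((f (r + 1)).f (a + r + 1 + 1)).hom (p r), ?_⟩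
  have hg : ∀ r, ((g r).f (a + r + 1)).hom (match r with
    | 0 => v₀ 0 + v₁ 0
    | r + 1 => v₀ (r + 1) + v₁ (r + 1) + ((f (r + 1)).f (a + r + 1 + 1)).hom (p r)) =
      u r + q r := by
    intro r
    cases r with
    | zero => exact (map_add _ _ _).trans (congrArg₂ _ (hv₀ 0) (hv₁ 0))
    | succ r =>
      refine (map_add _ _ _).trans ?_
      refine Eq.trans (congrArg₂ _ ((map_add _ _ _).trans (congrArg₂ _ (hv₀ (r + 1)) (hv₁ (r + 1))))
        (g_f_apply (S := ShortComplex.mk _ _ (w (r + 1))) (a + r + 1 + 1) (p r))) (add_zero _)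
  intro r
  rw [hg]
  exact hp r

end Chains

/-! ### Functorial cosyzygies -/

section Cosyzygies

open scoped ZeroObject

variable (A : Type u) [Ring A]

/-- A functorial factorization of morphisms into monomorphisms and morphisms with the right lifting
property. -/
def monoFactorization : MorphismProperty.FunctorialFactorizationData
    (MorphismProperty.monomorphisms (ModuleCat.{u} A))
    (MorphismProperty.monomorphisms (ModuleCat.{u} A)).rlp :=
  MorphismProperty.functorialFactorizationData _ _

/-- The functor that sends `N` to the arrow `N ⟶ 0`. -/
def toZeroArrow : ModuleCat.{u} A ⥤ Arrow (ModuleCat.{u} A) where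
  obj N := Arrow.mk (0 : N ⟶ 0)
  map f := Arrow.homMk f 0

/-- A functor with injective values that contains the identity functor. -/
def injHull : ModuleCat.{u} A ⥤ ModuleCat.{u} A := toZeroArrow A ⋙ (monoFactorization A).Z

variable {A}

/-- The natural embedding of `N` into an injective module. -/
def injHullι (N : ModuleCat.{u} A) : N ⟶ (injHull A).obj N :=
  (monoFactorization A).i.app ((toZeroArrow A).obj N)

lemma injHullι_naturality {N N' : ModuleCat.{u} A} (f : N ⟶ N') :
    injHullι N ≫ (injHull A).map f = f ≫ injHullι N' :=
  ((monoFactorization A).i.naturality ((toZeroArrow A).map f)).symm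

instance (N : ModuleCat.{u} A) : Mono (injHullι N) :=
  (monoFactorization A).hi ((toZeroArrow A).obj N)

/-- A module is injective if its map to zero has the right lifting property against monomorphisms,
and the second factor of the factorization of `N ⟶ 0` is such a map. -/
instance (N : ModuleCat.{u} A) : Injective ((injHull A).obj N) := by
  rw [injective_iff_rlp_monomorphisms_zero]
  have h := (monoFactorization A).hp ((toZeroArrow A).obj N)
  have e : (monoFactorization A).p.app ((toZeroArrow A).obj N) = 0 :=
    (Limits.isZero_zero (ModuleCat.{u} A)).eq_of_tgt _ _
  rw [e] at h
  exact h

/-- The quotient of the functorial injective hull of `N` by `N`. -/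
def cosyzygy (A : Type u) [Ring A] : ModuleCat.{u} A ⥤ ModuleCat.{u} A where
  obj N := Limits.cokernel (injHullι N)
  map f := Limits.cokernel.map _ _ f ((injHull A).map f) (injHullι_naturality f)
  map_id N := by
    rw [← cancel_epi (Limits.cokernel.π _)]
    simp
  map_comp f g := by
    rw [← cancel_epi (Limits.cokernel.π _)]
    simp

/-- The projection of the injective hull to the cosyzygy module. -/
def cosyzygyπ (N : ModuleCat.{u} A) : (injHull A).obj N ⟶ (cosyzygy A).obj N :=
  Limits.cokernel.π (injHullι N)

lemma cosyzygyπ_naturality {N N' : ModuleCat.{u} A} (f : N ⟶ N') :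
    cosyzygyπ N ≫ (cosyzygy A).map f = (injHull A).map f ≫ cosyzygyπ N' :=
  Limits.cokernel.π_desc _ _ _

lemma injHullι_cosyzygyπ (N : ModuleCat.{u} A) : injHullι N ≫ cosyzygyπ N = 0 :=
  Limits.cokernel.condition _

/-- The functorial short exact sequence `0 ⟶ N ⟶ J N ⟶ Σ N ⟶ 0`. -/
def hullSeq (N : ModuleCat.{u} A) : ShortComplex (ModuleCat.{u} A) :=
  ShortComplex.mk (injHullι N) (cosyzygyπ N) (injHullι_cosyzygyπ N)

instance (N : ModuleCat.{u} A) : Epi (cosyzygyπ N) :=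
  inferInstanceAs (Epi (Limits.cokernel.π _))

lemma hullSeq_shortExact (N : ModuleCat.{u} A) : (hullSeq N).ShortExact where
  exact := ShortComplex.exact_cokernel (injHullι N)
  mono_f := inferInstanceAs (Mono (injHullι N))
  epi_g := inferInstanceAs (Epi (cosyzygyπ N))

/-- The map of functorial short exact sequences induced by `f`. -/
def hullSeqMap {N N' : ModuleCat.{u} A} (f : N ⟶ N') : hullSeq N ⟶ hullSeq N' where
  τ₁ := f
  τ₂ := (injHull A).map f
  τ₃ := (cosyzygy A).map f
  comm₁₂ := (injHullι_naturality f).symm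
  comm₂₃ := (cosyzygyπ_naturality f).symm

/-- The iterated cosyzygy functors. -/
def cosyzygyIter (A : Type u) [Ring A] : ℕ → ModuleCat.{u} A ⥤ ModuleCat.{u} A
  | 0 => 𝟭 _
  | n + 1 => cosyzygyIter A n ⋙ cosyzygy A

/-! ### Maps that differ by a map through an injective module -/

/-- The difference of `g` and `g'` factors through an injective module. -/
def InjEquiv {X Y : ModuleCat.{u} A} (g g' : X ⟶ Y) : Prop :=
  ∃ (W : ModuleCat.{u} A) (_ : Injective W) (a : X ⟶ W) (b : W ⟶ Y), g = g' + a ≫ b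

namespace InjEquiv

variable {X Y : ModuleCat.{u} A}

lemma of_eq {g g' : X ⟶ Y} (h : g = g') : InjEquiv g g' :=
  ⟨(injHull A).obj X, inferInstance, 0, 0, by simp [h]⟩

lemma to_zero (hX : Injective X) (g g' : X ⟶ Y) : InjEquiv g g' :=
  ⟨X, hX, 𝟙 X, g - g', by simp⟩

/-- Maps of short exact sequences to a sequence with injective middle term that agree up to maps
through injective modules on the first terms also do so on the third terms. -/
lemma third {S S' : ShortComplex (ModuleCat.{u} A)} (hS : S.ShortExact)
    (hS' : Injective S'.X₂) (φ ψ : S ⟶ S') (h : InjEquiv φ.τ₁ ψ.τ₁) : InjEquiv φ.τ₃ ψ.τ₃ := by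
  obtain ⟨W, hW, a, b, hab⟩ := h
  have := hS.mono_f
  have := hS.epi_g
  -- Extend `a` along the monomorphism `S.f`. The middle components then differ on `S.X₁` exactly by
  -- this extension followed by `b ≫ S'.f`. What is left descends to a map from `S.X₃` to the
  -- injective module `S'.X₂`, and `S'.g` kills the correction term.
  have hk : S.f ≫ (φ.τ₂ - ψ.τ₂ - Injective.factorThru a S.f ≫ b ≫ S'.f) = 0 := by
    simp only [Preadditive.comp_sub, ← φ.comm₁₂, ← ψ.comm₁₂, hab, Injective.comp_factorThru_assoc]
    simp
  refine ⟨S'.X₂, hS', hS.exact.desc _ hk, S'.g, ?_⟩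
  rw [← cancel_epi S.g, Preadditive.comp_add, hS.exact.g_desc_assoc, Preadditive.sub_comp,
    Preadditive.sub_comp, φ.comm₂₃, ψ.comm₂₃, Category.assoc, Category.assoc, S'.zero]
  simp

lemma cosyzygy {g g' : X ⟶ Y} (h : InjEquiv g g') :
    InjEquiv ((cosyzygy A).map g) ((CompleteHomology.cosyzygy A).map g') :=
  third (hullSeq_shortExact X) (inferInstanceAs (Injective ((injHull A).obj Y))) (hullSeqMap g)
    (hullSeqMap g') h

end InjEquiv

/-- Maps of modules extend to maps from a short exact sequence to a sequence with injective middle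
term. -/
lemma exists_map_of_injective {S S' : ShortComplex (ModuleCat.{u} A)} (hS : S.ShortExact)
    (hS' : Injective S'.X₂) (f : S.X₁ ⟶ S'.X₁) : ∃ φ : S ⟶ S', φ.τ₁ = f := by
  have := hS.mono_f
  have := hS.epi_g
  refine ⟨{ τ₁ := f, τ₂ := Injective.factorThru (f ≫ S'.f) S.f,
            τ₃ := hS.exact.desc (Injective.factorThru (f ≫ S'.f) S.f ≫ S'.g) ?_,
            comm₁₂ := by simp, comm₂₃ := by simp }, rfl⟩
  rw [Injective.comp_factorThru_assoc, Category.assoc, S'.zero, Limits.comp_zero]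

/-- A map from a short exact sequence to the functorial sequence of its first term that is the
identity on the first terms. -/
lemma exists_toHullSeq (S : ShortComplex (ModuleCat.{u} A)) (hS : S.ShortExact) :
    ∃ φ : S ⟶ hullSeq S.X₁, φ.τ₁ = 𝟙 S.X₁ :=
  exists_map_of_injective hS (inferInstanceAs (Injective ((injHull A).obj S.X₁))) _

/-- The map from the last term of a short exact sequence to the cosyzygy module of its first
term. -/
def classifyingMap (S : ShortComplex (ModuleCat.{u} A)) (hS : S.ShortExact) :
    S.X₃ ⟶ (cosyzygy A).obj S.X₁ :=
  (exists_toHullSeq S hS).choose.τ₃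

/-- The maps `Σⁿ X ⟶ Σⁿ⁺¹ Y` induced by `b : X ⟶ Σ Y`. -/
def raise {X Y : ModuleCat.{u} A} (b : X ⟶ (cosyzygy A).obj Y) :
    ∀ n, (cosyzygyIter A n).obj X ⟶ (cosyzygyIter A (n + 1)).obj Y
  | 0 => b
  | n + 1 => (cosyzygy A).map (raise b n)

/-- The maps `Σⁿ⁺¹ Y ⟶ Σⁿ X` induced by `b : Σ Y ⟶ X`. -/
def lower {X Y : ModuleCat.{u} A} (b : (cosyzygy A).obj Y ⟶ X) :
    ∀ n, (cosyzygyIter A (n + 1)).obj Y ⟶ (cosyzygyIter A n).obj X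
  | 0 => b
  | n + 1 => (cosyzygy A).map (lower b n)

section

variable {X X' Y Y' : ModuleCat.{u} A}

lemma raise_congr {b b' : X ⟶ (cosyzygy A).obj Y} (h : InjEquiv b b') (n : ℕ) :
    InjEquiv (raise b n) (raise b' n) := by
  induction n with
  | zero => exact h
  | succ n ih => exact ih.cosyzygy

lemma raise_comp (f : X ⟶ X') (b : X' ⟶ (cosyzygy A).obj Y) (n : ℕ) :
    raise (f ≫ b) n = (cosyzygyIter A n).map f ≫ raise b n := by
  induction n with
  | zero => rfl
  | succ n ih => exact (congrArg (cosyzygy A).map ih).trans ((cosyzygy A).map_comp _ _)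

lemma raise_comp_map (b : X ⟶ (cosyzygy A).obj Y) (f : Y ⟶ Y') (n : ℕ) :
    raise (b ≫ (cosyzygy A).map f) n = raise b n ≫ (cosyzygyIter A (n + 1)).map f := by
  induction n with
  | zero => rfl
  | succ n ih => exact (congrArg (cosyzygy A).map ih).trans ((cosyzygy A).map_comp _ _)

lemma raise_lower (b : X ⟶ (cosyzygy A).obj Y) (b' : (cosyzygy A).obj Y ⟶ X)
    (h : InjEquiv (b ≫ b') (𝟙 X)) (n : ℕ) : InjEquiv (raise b n ≫ lower b' n) (𝟙 _) := by
  induction n with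
  | zero => exact h
  | succ n ih =>
    have := ih.cosyzygy
    rw [CategoryTheory.Functor.map_comp, CategoryTheory.Functor.map_id] at this
    exact this

lemma lower_raise (b : X ⟶ (cosyzygy A).obj Y) (b' : (cosyzygy A).obj Y ⟶ X)
    (h : InjEquiv (b' ≫ b) (𝟙 _)) (n : ℕ) : InjEquiv (lower b' n ≫ raise b n) (𝟙 _) := by
  induction n with
  | zero => exact h
  | succ n ih =>
    have := ih.cosyzygy
    rw [CategoryTheory.Functor.map_comp, CategoryTheory.Functor.map_id] at this
    exact this

end

end Cosyzygies

/-! ### Products indexed by the proofs of a proposition -/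

/-- This structure serves `ConnectedFamily.PreTower`, whose entries depend on a proof of `i + n =
j`. -/
instance addCommGroupPiProp {p : Prop} {X : p → Type u} [∀ h, AddCommGroup (X h)] :
    AddCommGroup (∀ h, X h) where
  add x y h := x h + y h
  zero _ := 0
  neg x h := -x h
  sub x y h := x h - y h
  nsmul n x h := n • x h
  zsmul n x h := n • x h
  add_assoc _ _ _ := funext fun _ => add_assoc _ _ _
  zero_add _ := funext fun _ => zero_add _
  add_zero _ := funext fun _ => add_zero _
  add_comm _ _ := funext fun _ => add_comm _ _
  neg_add_cancel _ := funext fun _ => neg_add_cancel _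
  sub_eq_add_neg _ _ := funext fun _ => sub_eq_add_neg _ _
  nsmul_zero _ := funext fun _ => zero_nsmul _
  nsmul_succ _ _ := funext fun _ => succ_nsmul _ _
  zsmul_zero' _ := funext fun _ => zero_zsmul _
  zsmul_succ' n x := funext fun h => SubNegMonoid.zsmul_succ' n (x h)
  zsmul_neg' n x := funext fun h => SubNegMonoid.zsmul_neg' n (x h)

instance modulePiProp {k : Type u} [CommRing k] {p : Prop} {X : p → Type u}
    [∀ h, AddCommGroup (X h)] [∀ h, Module k (X h)] : Module k (∀ h, X h) where
  smul c x h := c • x h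
  one_smul _ := funext fun _ => one_smul _ _
  mul_smul _ _ _ := funext fun _ => mul_smul _ _ _
  smul_zero _ := funext fun _ => smul_zero _
  smul_add _ _ _ := funext fun _ => smul_add _ _ _
  add_smul _ _ _ := funext fun _ => add_smul _ _ _
  zero_smul _ := funext fun _ => zero_smul _ _

/-! ### The limit construction of the J-completion -/

section Completion

variable {k : Type u} [CommRing k] {A : Type u} [Ring A]

namespace ConnectedFamily

variable (T : ConnectedFamily k A)

lemma δ_naturality_apply (i : ℤ) {S S' : ShortComplex (ModuleCat.{u} A)} (hS : S.ShortExact)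
    (hS' : S'.ShortExact) (φ : S ⟶ S') (x : (T.F (i + 1)).obj S.X₃) :
    (T.δ i S' hS').hom (((T.F (i + 1)).map φ.τ₃).hom x) =
      ((T.F i).map φ.τ₁).hom ((T.δ i S hS).hom x) :=
  ConcreteCategory.congr_hom (T.δ_naturality i hS hS' φ) x

lemma map_map_apply (i : ℤ) {X Y Z : ModuleCat.{u} A} (f : X ⟶ Y) (g : Y ⟶ Z)
    (x : (T.F i).obj X) :
    ((T.F i).map g).hom (((T.F i).map f).hom x) = ((T.F i).map (f ≫ g)).hom x :=
  (ConcreteCategory.congr_hom ((T.F i).map_comp f g) x).symm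

lemma map_id_apply (i : ℤ) (X : ModuleCat.{u} A) (x : (T.F i).obj X) :
    ((T.F i).map (𝟙 X)).hom x = x :=
  ConcreteCategory.congr_hom ((T.F i).map_id X) x

/-- The connecting homomorphism of the functorial short exact sequence, as a linear map. -/
def hullδ (i : ℤ) (N : ModuleCat.{u} A) :
    (T.F (i + 1)).obj ((cosyzygy A).obj N) →ₗ[k] (T.F i).obj N :=
  (T.δ i (hullSeq N) (hullSeq_shortExact N)).hom

lemma hullδ_naturality (i : ℤ) {N N' : ModuleCat.{u} A} (f : N ⟶ N')
    (x : (T.F (i + 1)).obj ((cosyzygy A).obj N)) :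
    T.hullδ i N' (((T.F (i + 1)).map ((cosyzygy A).map f)).hom x) =
      ((T.F i).map f).hom (T.hullδ i N x) :=
  T.δ_naturality_apply i (hullSeq_shortExact N) (hullSeq_shortExact N') (hullSeqMap f) x

/-- The map of sequences behind `classifyingMap` is the identity on first terms, so this is
naturality. It reduces all connecting homomorphisms to those of the functorial sequences. -/
lemma hullδ_classifyingMap (i : ℤ) (S : ShortComplex (ModuleCat.{u} A)) (hS : S.ShortExact)
    (x : (T.F (i + 1)).obj S.X₃) :
    T.hullδ i S.X₁ (((T.F (i + 1)).map (classifyingMap S hS)).hom x) = (T.δ i S hS).hom x := by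
  have h := (exists_toHullSeq S hS).choose_spec
  refine (T.δ_naturality_apply i hS (hullSeq_shortExact S.X₁)
    (exists_toHullSeq S hS).choose x).trans ?_
  rw [h]
  exact T.map_id_apply i S.X₁ _

/-- Families of elements of the modules `T_{i+n}(Σⁿ N)`. -/
abbrev PreTower (i : ℤ) (N : ModuleCat.{u} A) : Type u :=
  ∀ (n : ℕ) (j : ℤ), i + n = j → (T.F j).obj ((cosyzygyIter A n).obj N)

/-- The limit of the modules `T_{i+n}(Σⁿ N)` along the connecting homomorphisms. -/
def Tower (i : ℤ) (N : ModuleCat.{u} A) : Submodule k (T.PreTower i N) where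
  -- The degree `j` is a variable with a proof of `i + n = j`. In this way no element has to be
  -- transported between `i + (n + 1)` and `(i + n) + 1`.
  carrier := {x | ∀ (n : ℕ) (j : ℤ) (h : i + n = j) (h' : i + (n + 1 : ℕ) = j + 1),
    T.hullδ j _ (x (n + 1) (j + 1) h') = x n j h}
  add_mem' hx hy n j h h' :=
    (map_add (T.hullδ j _) _ _).trans (congrArg₂ _ (hx n j h h') (hy n j h h'))
  zero_mem' _ j _ _ := map_zero (T.hullδ j _)
  smul_mem' _ _ hx n j h h' :=
    (map_smul (T.hullδ j _) _ _).trans (congrArg _ (hx n j h h'))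

variable {T}

lemma Tower.compat {i : ℤ} {N : ModuleCat.{u} A} (x : T.Tower i N) (n : ℕ) (j : ℤ) (h : i + n = j)
    (h' : i + (n + 1 : ℕ) = j + 1) : T.hullδ j _ (x.1 (n + 1) (j + 1) h') = x.1 n j h :=
  x.2 n j h h'

/-- Each entry is the image of the next one, so large entries determine all others. -/
lemma Tower.ext_of_le {i : ℤ} {N : ModuleCat.{u} A} {x y : T.Tower i N} (m : ℕ)
    (hxy : ∀ n, m ≤ n → ∀ j h, x.1 n j h = y.1 n j h) : x = y := by
  induction m with
  | zero => exact Subtype.ext (funext₃ fun n j h => hxy n (Nat.zero_le n) j h)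
  | succ m ih =>
    refine ih fun n hn j h => ?_
    rcases hn.eq_or_lt with rfl | hn
    · rw [← Tower.compat x m j h (by push_cast; omega),
        ← Tower.compat y m j h (by push_cast; omega),
        hxy (m + 1) le_rfl]
    · exact hxy n hn j h

/-- A compatible family of elements of `T_{i+n}(Σⁿ N)` for large `n` extends to a tower. -/
lemma Tower.exists_of_eventually {i : ℤ} {N : ModuleCat.{u} A} (m : ℕ) (x : T.PreTower i N)
    (hx : ∀ n, m ≤ n → ∀ (j : ℤ) (h : i + n = j) (h' : i + (n + 1 : ℕ) = j + 1),
      T.hullδ j _ (x (n + 1) (j + 1) h') = x n j h) :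
    ∃ y : T.Tower i N, ∀ n, m ≤ n → ∀ j h, y.1 n j h = x n j h := by
  induction m generalizing x with
  | zero => exact ⟨⟨x, fun n => hx n (Nat.zero_le n)⟩, fun _ _ _ _ => rfl⟩
  | succ m ih =>
    -- The entry with index `m` is replaced by the image of its successor. The smaller entries are
    -- replaced too, but they are irrelevant for the induction hypothesis.
    let x' : T.PreTower i N := fun n j h =>
      if n < m + 1 then T.hullδ j _ (x (n + 1) (j + 1) (by push_cast; omega)) else x n j h
    have hx' : ∀ n, m + 1 ≤ n → ∀ j h, x' n j h = x n j h := fun n hn j h =>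
      if_neg (by omega)
    obtain ⟨y, hy⟩ := ih x' (by
      intro n hn j h h'
      rw [hx' (n + 1) (by omega)]
      rcases hn.eq_or_lt with rfl | hn
      · exact (if_pos (Nat.lt_succ_self m)).symm
      · rw [hx' n hn]
        exact hx n hn j h h')
    exact ⟨y, fun n hn j h => (hy n (by omega) j h).trans (hx' n hn j h)⟩

/-- The first component of a tower. -/
def Tower.fst (T : ConnectedFamily k A) (i : ℤ) (N : ModuleCat.{u} A) :
    T.Tower i N →ₗ[k] (T.F i).obj N where
  toFun x := x.1 0 i (by simp)
  map_add' _ _ := rfl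
  map_smul' _ _ := rfl

/-- The map of towers induced by a map of modules. -/
def Tower.map (T : ConnectedFamily k A) (i : ℤ) {N N' : ModuleCat.{u} A} (f : N ⟶ N') :
    T.Tower i N →ₗ[k] T.Tower i N' where
  toFun x := ⟨fun n j h => ((T.F j).map ((cosyzygyIter A n).map f)).hom (x.1 n j h), by
    intro n j h h'
    exact (T.hullδ_naturality j ((cosyzygyIter A n).map f) _).trans
      (congrArg ((T.F j).map ((cosyzygyIter A n).map f)).hom (Tower.compat x n j h h'))⟩
  map_add' _ _ := Subtype.ext (funext₃ fun _ _ _ => map_add _ _ _)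
  map_smul' _ _ := Subtype.ext (funext₃ fun _ _ _ => map_smul _ _ _)

/-- The map of towers that raises the index, for a map `b : X ⟶ Σ Y`. -/
def Tower.shift (T : ConnectedFamily k A) (i : ℤ) {X Y : ModuleCat.{u} A}
    (b : X ⟶ (cosyzygy A).obj Y) : T.Tower (i + 1) X →ₗ[k] T.Tower i Y where
  toFun x := ⟨fun n => match n with
    -- As (i + 1) + n = i + (n + 1), the old entry `n` yields the new entry `n + 1`. The new entry
    -- `0` is then forced by compatibility.
    | 0 => fun j h => T.hullδ j Y (((T.F (j + 1)).map b).hom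
        (x.1 0 (j + 1) (by simp at h; simp [h])))
    | n + 1 => fun j h => ((T.F j).map (raise b n)).hom
        (x.1 n j (by push_cast at h; omega)), by
    intro n j h h'
    cases n with
    | zero => rfl
    | succ n =>
      exact (T.hullδ_naturality j (raise b n) _).trans (congrArg ((T.F j).map (raise b n)).hom
        (Tower.compat x n j (by push_cast at h; omega) (by push_cast at h ⊢; omega)))⟩
  map_add' _ _ := Subtype.ext (funext₃ fun n j _ => by
    cases n with
    | zero => exact (congrArg (T.hullδ j Y) (map_add _ _ _)).trans (map_add _ _ _)
    | succ n => exact map_add _ _ _)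
  map_smul' _ _ := Subtype.ext (funext₃ fun n j _ => by
    cases n with
    | zero => exact (congrArg (T.hullδ j Y) (map_smul _ _ _)).trans (map_smul _ _ _)
    | succ n => exact map_smul _ _ _)

/-- Entry `0` follows from entry `1`. This removes the special case in the definition of
`Tower.shift`. -/
lemma Tower.ext_succ {i : ℤ} {N : ModuleCat.{u} A} {x y : T.Tower i N}
    (hxy : ∀ n j h, x.1 (n + 1) j h = y.1 (n + 1) j h) : x = y :=
  Tower.ext_of_le 1 fun n hn j h => by
    obtain ⟨n, rfl⟩ := Nat.exists_eq_add_of_le' hn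
    exact hxy n j h

/-- The map of towers induced by a map of families. -/
def Tower.mapHom {U T : ConnectedFamily k A} (υ : U.Hom T) (i : ℤ) (N : ModuleCat.{u} A) :
    U.Tower i N →ₗ[k] T.Tower i N where
  toFun x := ⟨fun n j h => ((υ.app j).app _).hom (x.1 n j h), by
    intro n j h h'
    exact (ConcreteCategory.congr_hom (υ.comm j _ (hullSeq_shortExact _)) _).symm.trans
      (congrArg ((υ.app j).app _).hom (Tower.compat x n j h h'))⟩
  map_add' _ _ := Subtype.ext (funext₃ fun _ _ _ => map_add _ _ _)
  map_smul' _ _ := Subtype.ext (funext₃ fun _ _ _ => map_smul _ _ _)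

lemma Tower.mapHom_shift {U T : ConnectedFamily k A} (υ : U.Hom T) (i : ℤ) {X Y : ModuleCat.{u} A}
    (b : X ⟶ (cosyzygy A).obj Y) (x : U.Tower (i + 1) X) :
    Tower.mapHom υ i Y (Tower.shift U i b x) = Tower.shift T i b (Tower.mapHom υ (i + 1) X x) :=
  Tower.ext_succ fun n j _ =>
    ConcreteCategory.congr_hom ((υ.app j).naturality (raise b n)) _

/-! ### Acyclic families agree with their own limits -/

section Acyclic

variable {U : ConnectedFamily k A} (hU : U.IsInjectiveAcyclic)
include hU

lemma IsInjectiveAcyclic.hullδ_bijective (i : ℤ) (N : ModuleCat.{u} A) :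
    Function.Bijective (U.hullδ i N) := by
  have := hU.isIso_δ i (hullSeq N) (hullSeq_shortExact N)
    (inferInstanceAs (Injective ((injHull A).obj N)))
  exact (ConcreteCategory.isIso_iff_bijective (U.δ i (hullSeq N) (hullSeq_shortExact N))).1 this

/-- All transition maps of the limit are bijective by dimension shifting, so a tower can be
recovered from its first entry by taking successive preimages. -/
lemma IsInjectiveAcyclic.fst_bijective (i : ℤ) (N : ModuleCat.{u} A) :
    Function.Bijective (Tower.fst U i N) := by
  constructor
  · intro x y hxy
    refine Subtype.ext (funext fun n => ?_)
    induction n with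
    | zero =>
      funext j h
      obtain rfl : i = j := by simpa using h
      exact hxy
    | succ n ih =>
      funext j h
      obtain ⟨j, rfl⟩ : ∃ l, j = l + 1 := ⟨j - 1, by omega⟩
      apply (hU.hullδ_bijective j _).1
      have h' : i + n = j := by push_cast at h; omega
      exact (Tower.compat x n j h' h).trans
        (Eq.trans (congrFun₂ ih j h') (Tower.compat y n j h' h).symm)
  · intro x
    choose inv hinv using fun i N => (hU.hullδ_bijective i N).2
    let t : U.PreTower i N := fun n => Nat.rec
      (motive := fun n => ∀ j : ℤ, i + n = j → (U.F j).obj ((cosyzygyIter A n).obj N))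
      (fun j h => (show i = j by simpa using h) ▸ x)
      (fun n t j h => (show i + n + 1 = j by push_cast at h; omega) ▸ inv (i + n) _ (t (i + n) rfl))
      n
    refine ⟨⟨t, fun n j h h' => ?_⟩, rfl⟩
    subst h
    exact hinv (i + n) _ (t n (i + n) rfl)

/-- The inverse of the first component map for an acyclic family. -/
def liftTower (i : ℤ) (N : ModuleCat.{u} A) : (U.F i).obj N ≃ₗ[k] U.Tower i N :=
  (LinearEquiv.ofBijective (Tower.fst U i N) (hU.fst_bijective i N)).symm

lemma fst_liftTower (i : ℤ) (N : ModuleCat.{u} A) (x : (U.F i).obj N) :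
    Tower.fst U i N (liftTower hU i N x) = x :=
  (LinearEquiv.ofBijective (Tower.fst U i N) (hU.fst_bijective i N)).apply_symm_apply x

lemma liftTower_eq {i : ℤ} {N : ModuleCat.{u} A} {x : (U.F i).obj N} {t : U.Tower i N}
    (h : Tower.fst U i N t = x) : liftTower hU i N x = t :=
  (hU.fst_bijective i N).1 ((fst_liftTower hU i N x).trans h.symm)

lemma liftTower_map (i : ℤ) {N N' : ModuleCat.{u} A} (f : N ⟶ N') (x : (U.F i).obj N) :
    liftTower hU i N' (((U.F i).map f).hom x) = Tower.map U i f (liftTower hU i N x) :=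
  liftTower_eq hU (congrArg ((U.F i).map f).hom (fst_liftTower hU i N x))

lemma liftTower_δ (i : ℤ) (S : ShortComplex (ModuleCat.{u} A)) (hS : S.ShortExact)
    (x : (U.F (i + 1)).obj S.X₃) :
    liftTower hU i S.X₁ ((U.δ i S hS).hom x) =
      Tower.shift U i (classifyingMap S hS) (liftTower hU (i + 1) S.X₃ x) := by
  refine liftTower_eq hU (Eq.trans ?_ (U.hullδ_classifyingMap i S hS x))
  exact congrArg (fun y => U.hullδ i S.X₁ (((U.F (i + 1)).map (classifyingMap S hS)).hom y))
    (fst_liftTower hU (i + 1) S.X₃ x)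

end Acyclic

/-- The functors of the family are additive, and the maps `T_{i+1}(X₃) ⟶ T_i(X₁) ⟶ T_i(X₂)`
compose to zero. -/
structure IsHalfExact (T : ConnectedFamily k A) : Prop where
  map_add (i : ℤ) {X Y : ModuleCat.{u} A} (f g : X ⟶ Y) :
    (T.F i).map (f + g) = (T.F i).map f + (T.F i).map g
  δ_map (i : ℤ) (S : ShortComplex (ModuleCat.{u} A)) (hS : S.ShortExact) :
    T.δ i S hS ≫ (T.F i).map S.f = 0

/-! ### Half exact families: acyclicity and universality of the limit -/

section HalfExact

variable (hT : T.IsHalfExact)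
include hT

/-- The image of a connecting homomorphism of a short exact sequence with arbitrary middle term is
killed by maps through injective modules. -/
lemma IsHalfExact.map_δ_eq {S : ShortComplex (ModuleCat.{u} A)} (hS : S.ShortExact)
    {Y : ModuleCat.{u} A} {g g' : S.X₁ ⟶ Y} (h : InjEquiv g g') (i : ℤ)
    (x : (T.F (i + 1)).obj S.X₃) :
    ((T.F i).map g).hom ((T.δ i S hS).hom x) = ((T.F i).map g').hom ((T.δ i S hS).hom x) := by
  obtain ⟨W, hW, a, b, rfl⟩ := h
  have := hS.mono_f
  -- The map `a` into the injective module `W` extends over `S.X₂`, hence factors through `S.f`, and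
  -- the composite of δ with the map induced by `S.f` is zero.
  have h0 : T.δ i S hS ≫ (T.F i).map (a ≫ b) = 0 := by
    rw [← Injective.comp_factorThru a S.f, Category.assoc, (T.F i).map_comp,
      reassoc_of% (hT.δ_map i S hS), Limits.zero_comp]
  have h1 : ((T.F i).map (a ≫ b)).hom ((T.δ i S hS).hom x) = 0 :=
    ConcreteCategory.congr_hom h0 x
  rw [hT.map_add, ModuleCat.hom_add, LinearMap.add_apply, h1, add_zero]

/-- Every entry of a tower lies in the image of a connecting homomorphism, where
`IsHalfExact.map_δ_eq` applies. This is why constructions that are canonical only up to maps through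
injective modules become canonical on the limit. -/
lemma IsHalfExact.map_tower_eq {i : ℤ} {N : ModuleCat.{u} A} (x : T.Tower i N) {n : ℕ}
    {Y : ModuleCat.{u} A} {g g' : (cosyzygyIter A n).obj N ⟶ Y} (h : InjEquiv g g') (j : ℤ)
    (hj : i + n = j) :
    ((T.F j).map g).hom (x.1 n j hj) = ((T.F j).map g').hom (x.1 n j hj) := by
  rw [← Tower.compat x n j hj (by push_cast; omega)]
  exact hT.map_δ_eq (hullSeq_shortExact _) h j _

/-- Classifying maps depend on the choice of an extension, so they need not be natural. The two
composites come from maps of short exact sequences with the same first component, hence differ by a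
map through an injective module, and towers do not see the difference. -/
lemma IsHalfExact.shift_classifyingMap_naturality (i : ℤ) {S S' : ShortComplex (ModuleCat.{u} A)}
    (hS : S.ShortExact) (hS' : S'.ShortExact) (φ : S ⟶ S') (x : T.Tower (i + 1) S.X₃) :
    Tower.shift T i (classifyingMap S' hS') (Tower.map T (i + 1) φ.τ₃ x) =
      Tower.map T i φ.τ₁ (Tower.shift T i (classifyingMap S hS) x) := by
  have h : InjEquiv (φ.τ₃ ≫ classifyingMap S' hS')
      (classifyingMap S hS ≫ (cosyzygy A).map φ.τ₁) := by
    refine InjEquiv.third hS (inferInstanceAs (Injective ((injHull A).obj S'.X₁)))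
      (φ ≫ (exists_toHullSeq S' hS').choose)
      ((exists_toHullSeq S hS).choose ≫ hullSeqMap φ.τ₁) (InjEquiv.of_eq ?_)
    rw [ShortComplex.comp_τ₁, ShortComplex.comp_τ₁, (exists_toHullSeq S' hS').choose_spec,
      (exists_toHullSeq S hS).choose_spec]
    exact (Category.comp_id _).trans (Category.id_comp _).symm
  refine Tower.ext_succ fun n j hj => ?_
  refine (T.map_map_apply j _ _ _).trans (Eq.trans ?_ (T.map_map_apply j _ _ _).symm)
  rw [← raise_comp, ← raise_comp_map]
  exact hT.map_tower_eq x (raise_congr h n) j _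

/-- The inverse takes entry `n + 1` to entry `n` through `lower b' n`. The composites of `raise` and
`lower` are identities up to maps through injective modules, hence act as identities on entries of
towers. -/
lemma IsHalfExact.shift_bijective (i : ℤ) {X Y : ModuleCat.{u} A} (b : X ⟶ (cosyzygy A).obj Y)
    (b' : (cosyzygy A).obj Y ⟶ X) (h : InjEquiv (b ≫ b') (𝟙 X)) (h' : InjEquiv (b' ≫ b) (𝟙 _)) :
    Function.Bijective (Tower.shift T i b) := by
  constructor
  · rw [injective_iff_map_eq_zero]
    intro x hx
    refine Subtype.ext (funext₃ fun n j hj => ?_)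
    have e1 : ((T.F j).map (raise b n)).hom (x.1 n j hj) = 0 :=
      congrFun₃ (congrArg Subtype.val hx) (n + 1) j (by push_cast; omega)
    have e2 := congrArg ((T.F j).map (lower b' n)).hom e1
    rw [map_map_apply, map_zero, hT.map_tower_eq x (raise_lower b b' h n), map_id_apply] at e2
    exact e2
  · intro y
    refine ⟨⟨fun n j hj => ((T.F j).map (lower b' n)).hom
      (y.1 (n + 1) j (by push_cast; omega)), ?_⟩, ?_⟩
    · intro n j hj hj'
      exact (T.hullδ_naturality j (lower b' n) _).trans (congrArg ((T.F j).map (lower b' n)).hom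
        (Tower.compat y (n + 1) j (by push_cast; omega) (by push_cast; omega)))
    · refine Tower.ext_succ fun n j hj => ?_
      refine (T.map_map_apply j _ _ _).trans ?_
      rw [hT.map_tower_eq y (lower_raise b b' h' n), map_id_apply]

/-- The limits of the modules `T_{i+n}(Σⁿ N)` form a family with connecting homomorphisms. -/
def completion : ConnectedFamily k A where
  F i :=
    { obj N := ModuleCat.of k (T.Tower i N)
      map f := ModuleCat.ofHom (Tower.map T i f)
      map_id N := by
        refine ModuleCat.hom_ext (LinearMap.ext fun x => ?_)
        refine Subtype.ext (funext₃ fun n j h => ?_)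
        refine Eq.trans ?_ (T.map_id_apply j _ (x.1 n j h))
        exact congrArg (fun g => ((T.F j).map g).hom (x.1 n j h))
          ((cosyzygyIter A n).map_id N)
      map_comp f g := by
        refine ModuleCat.hom_ext (LinearMap.ext fun x => ?_)
        refine Subtype.ext (funext₃ fun n j h => ?_)
        refine Eq.trans ?_ (T.map_map_apply j _ _ (x.1 n j h)).symm
        exact congrArg (fun g => ((T.F j).map g).hom (x.1 n j h))
          ((cosyzygyIter A n).map_comp f g) }
  δ i S hS := ModuleCat.ofHom (Tower.shift T i (classifyingMap S hS))
  δ_naturality i S S' hS hS' φ := by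
    refine ModuleCat.hom_ext (LinearMap.ext fun x => ?_)
    exact hT.shift_classifyingMap_naturality i hS hS' φ x

/-- The canonical map from the completion. -/
def completionπ : (completion hT).Hom T where
  app i :=
    { app N := ModuleCat.ofHom (Tower.fst T i N)
      naturality _ _ _ := rfl }
  comm i S hS := by
    refine ModuleCat.hom_ext (LinearMap.ext fun x => ?_)
    exact T.hullδ_classifyingMap i S hS _

lemma completion_isInjectiveAcyclic : (completion hT).IsInjectiveAcyclic where
  isZero i J hJ := by
    refine @ModuleCat.isZero_of_subsingleton _ _ (ModuleCat.of k (T.Tower i J)) ⟨fun x y => ?_⟩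
    -- The identity of each Σⁿ J factors through an injective module, so by additivity it acts as
    -- zero on the entries of a tower.
    have key : ∀ n, InjEquiv (𝟙 ((cosyzygyIter A n).obj J)) 0 := by
      intro n
      induction n with
      | zero => exact InjEquiv.to_zero hJ _ _
      | succ n ih =>
        have h1 := ih.cosyzygy
        have h2 := InjEquiv.third (hullSeq_shortExact ((cosyzygyIter A n).obj J))
          (inferInstanceAs (Injective ((injHull A).obj ((cosyzygyIter A n).obj J))))
          (𝟙 (hullSeq ((cosyzygyIter A n).obj J))) 0 ih
        exact h2
    refine Subtype.ext (funext₃ fun n j h => ?_)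
    have e (z : T.Tower i J) : z.1 n j h = 0 := by
      rw [← T.map_id_apply j _ (z.1 n j h), hT.map_tower_eq z (key n)]
      have h0 := hT.map_add j (0 : (cosyzygyIter A n).obj J ⟶ (cosyzygyIter A n).obj J) 0
      rw [add_zero, left_eq_add] at h0
      rw [h0]; rfl
    exact (e x).trans (e y).symm
  isIso_δ i S hS hJ := by
    -- As `S.X₂` is injective, there are maps in both directions between `S` and the functorial
    -- sequence that are the identity on the first term. On the third terms they are inverse to each
    -- other up to maps through injective modules.
    obtain ⟨ψ, hψ⟩ := exists_map_of_injective (hullSeq_shortExact S.X₁) hJ (𝟙 S.X₁)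
    have hφ := (exists_toHullSeq S hS).choose_spec
    refine (ConcreteCategory.isIso_iff_bijective _).2
      (hT.shift_bijective i (classifyingMap S hS) ψ.τ₃ ?_ ?_)
    · refine InjEquiv.third hS hJ ((exists_toHullSeq S hS).choose ≫ ψ) (𝟙 S) (InjEquiv.of_eq ?_)
      rw [ShortComplex.comp_τ₁, hφ, hψ]
      exact Category.id_comp _
    · refine InjEquiv.third (hullSeq_shortExact S.X₁)
        (inferInstanceAs (Injective ((injHull A).obj S.X₁)))
        (ψ ≫ (exists_toHullSeq S hS).choose) (𝟙 (hullSeq S.X₁)) (InjEquiv.of_eq ?_)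
      rw [ShortComplex.comp_τ₁, hφ, hψ]
      exact Category.id_comp _

/-- The lift of a map from an acyclic family to the completion. -/
def completionLift {U : ConnectedFamily k A} (hU : U.IsInjectiveAcyclic) (υ : U.Hom T) :
    U.Hom (completion hT) where
  app i :=
    { app N := ModuleCat.ofHom (Tower.mapHom υ i N ∘ₗ (liftTower hU i N).toLinearMap)
      naturality N N' f := by
        refine ModuleCat.hom_ext (LinearMap.ext fun x => ?_)
        refine (congrArg (Tower.mapHom υ i N') (liftTower_map hU i f x)).trans ?_
        exact Subtype.ext (funext₃ fun n j h =>
          ConcreteCategory.congr_hom ((υ.app j).naturality ((cosyzygyIter A n).map f)) _) }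
  comm i S hS := by
    refine ModuleCat.hom_ext (LinearMap.ext fun x => ?_)
    exact (congrArg (Tower.mapHom υ i S.X₁) (liftTower_δ hU i S hS x)).trans
      (Tower.mapHom_shift υ i _ _)

/-- The limit construction is a J-completion. -/
theorem completionπ_isJCompletion : (completionπ hT).IsJCompletion where
  acyclic := completion_isInjectiveAcyclic hT
  existsUnique_lift U hU υ := by
    refine ⟨completionLift hT hU υ, ?_, ?_⟩
    · ext i N x
      exact congrArg ((υ.app i).app N).hom (fst_liftTower hU i N x)
    · intro σ hσ
      -- The factorization of `υ` fixes entry `0` of `σ x`. For entry `n + 1`, write `x` as a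
      -- connecting image of some `x'`. As `σ` commutes with connecting homomorphisms, this entry is
      -- obtained from entry `n` of `σ x'`, so the induction has to run over all `i` and `N`.
      have key : ∀ (n : ℕ) (i : ℤ) (N : ModuleCat.{u} A) (x : (U.F i).obj N) (j : ℤ)
          (h : i + n = j), (((σ.app i).app N).hom x : T.Tower i N).1 n j h =
            ((υ.app j).app _).hom ((liftTower hU i N x).1 n j h) := by
        intro n
        induction n with
        | zero =>
          intro i N x j h
          obtain rfl : i = j := by simpa using h
          have e1 : (((σ.app i).app N).hom x : T.Tower i N).1 0 i h =
            ((υ.app i).app N).hom x := by rw [← hσ]; rfl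
          exact e1.trans (congrArg ((υ.app i).app N).hom (fst_liftTower hU i N x).symm)
        | succ n ih =>
          intro i N x j h
          obtain ⟨x', rfl⟩ := (hU.hullδ_bijective i N).2 x
          have e1 := ConcreteCategory.congr_hom (σ.comm i (hullSeq N) (hullSeq_shortExact N)) x'
          have e2 := liftTower_δ hU i (hullSeq N) (hullSeq_shortExact N) x'
          have e3 := congrFun₃ (congrArg Subtype.val e1) (n + 1) j h
          have e4 := congrFun₃ (congrArg Subtype.val e2) (n + 1) j h
          refine e3.trans (Eq.trans ?_ (congrArg ((υ.app j).app _).hom e4).symm)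
          refine (congrArg ((T.F j).map (raise _ n)).hom
            (ih (i + 1) ((cosyzygy A).obj N) x' j (by push_cast at h; omega))).trans ?_
          exact (ConcreteCategory.congr_hom ((υ.app j).naturality (raise _ n)) _).symm
      ext i N x
      exact Subtype.ext (funext₃ fun n j h => key n i N x j h)

end HalfExact

end ConnectedFamily

end Completion

/-! ### Properties of the family Tor -/

section TorProperties

variable (k : Type u) [CommRing k] {A : Type u} [Ring A] [Algebra k A]

lemma complexTensor_map_add (P : ChainComplex (ModuleCat.{u} Aᵐᵒᵖ) ℕ) {N N' : ModuleCat.{u} A}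
    (f g : N ⟶ N') :
    (complexTensor k P).map (f + g) = (complexTensor k P).map f + (complexTensor k P).map g := by
  ext n : 1
  simp only [complexTensor_map, NatTrans.mapHomologicalComplex_app_f, tensorWithMap_app,
    bmap_add_right]
  rfl

lemma torFamily_isHalfExact {M : ModuleCat.{u} Aᵐᵒᵖ} (P : ProjectiveResolution M) :
    (torFamily k P).IsHalfExact where
  map_add i N N' f g := by
    cases i with
    | ofNat n =>
      change HomologicalComplex.homologyMap _ n = HomologicalComplex.homologyMap _ n +
        HomologicalComplex.homologyMap _ n
      rw [complexTensor_map_add, HomologicalComplex.homologyMap_add]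
      rfl
    | negSucc n =>
      refine ModuleCat.hom_ext (LinearMap.ext fun x => ?_)
      exact Subsingleton.elim (α := PUnit) _ _
  δ_map i S hS := by
    cases i with
    | ofNat n => exact (shortExact_complexTensor k P.complex P.projective S hS).δ_comp (n + 1) n rfl
    | negSucc n => exact Limits.zero_comp

/-- The natural transformation `P ⊗ - ⟶ P' ⊗ -` induced by a chain map. -/
def complexTensorMapLeft {P P' : ChainComplex (ModuleCat.{u} Aᵐᵒᵖ) ℕ} (f : P ⟶ P') :
    complexTensor k P ⟶ complexTensor k P' where
  app N := ((tensorWith k N).mapHomologicalComplex _).map f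
  naturality N N' g := by
    ext n : 1
    exact congrArg ModuleCat.ofHom
      (show bmap k (f.f n) (𝟙 N') ∘ₗ bmap k (𝟙 (P.X n)) g =
        bmap k (𝟙 (P'.X n)) g ∘ₗ bmap k (f.f n) (𝟙 N) by
      rw [← bmap_comp, ← bmap_comp]; simp)

/-- The map of Tor families induced by a chain map of projective resolutions. -/
def torFamilyMap {M M' : ModuleCat.{u} Aᵐᵒᵖ} {P : ProjectiveResolution M}
    {P' : ProjectiveResolution M'} (f : P.complex ⟶ P'.complex) :
    (torFamily k P).Hom (torFamily k P') where
  app i := match i with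
    | .ofNat n => Functor.whiskerRight (complexTensorMapLeft k f)
        (HomologicalComplex.homologyFunctor _ _ n)
    | .negSucc _ => 𝟙 _
  comm i S hS := by
    cases i with
    | ofNat n =>
      exact HomologicalComplex.HomologySequence.δ_naturality
        (S₁ := S.map (complexTensor k P.complex)) (S₂ := S.map (complexTensor k P'.complex))
        (ShortComplex.homMk ((complexTensorMapLeft k f).app S.X₁)
          ((complexTensorMapLeft k f).app S.X₂) ((complexTensorMapLeft k f).app S.X₃)
          ((complexTensorMapLeft k f).naturality S.f).symm
          ((complexTensorMapLeft k f).naturality S.g).symm)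
        (shortExact_complexTensor k P.complex P.projective S hS)
        (shortExact_complexTensor k P'.complex P'.projective S hS) (n + 1) n rfl
    | negSucc n => exact Limits.zero_comp.trans Limits.comp_zero.symm

lemma torFamilyMap_comp_eq_id {M M' : ModuleCat.{u} Aᵐᵒᵖ} {P : ProjectiveResolution M}
    {P' : ProjectiveResolution M'} (f : P.complex ⟶ P'.complex) (g : P'.complex ⟶ P.complex)
    (h : Homotopy (f ≫ g) (𝟙 _)) (i : ℤ) (N : ModuleCat.{u} A) :
    ((torFamilyMap k f).app i).app N ≫ ((torFamilyMap k g).app i).app N = 𝟙 _ := by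
  cases i with
  | ofNat n =>
    change HomologicalComplex.homologyMap _ n ≫ HomologicalComplex.homologyMap _ n = 𝟙 _
    rw [← HomologicalComplex.homologyMap_comp]
    have e := ((tensorWith k N).mapHomotopy h).homologyMap_eq n
    rw [CategoryTheory.Functor.map_comp, CategoryTheory.Functor.map_id,
      HomologicalComplex.homologyMap_id] at e
    exact e
  | negSucc n => exact Category.comp_id _

end TorProperties

/-! ### The functorial injective resolution -/

section Resolution

variable {A : Type u} [Ring A]

lemma hull_d_comp_d (N : ModuleCat.{u} A) :
    (cosyzygyπ N ≫ injHullι ((cosyzygy A).obj N)) ≫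
      (cosyzygyπ ((cosyzygy A).obj N) ≫ injHullι _) = 0 := by
  rw [Category.assoc, reassoc_of% (injHullι_cosyzygyπ ((cosyzygy A).obj N))]
  simp

/-- The functorial injective resolution as a complex. -/
def hullComplex (N : ModuleCat.{u} A) : CochainComplex (ModuleCat.{u} A) ℕ :=
  CochainComplex.of (fun n => (injHull A).obj ((cosyzygyIter A n).obj N))
    (fun n => cosyzygyπ ((cosyzygyIter A n).obj N) ≫ injHullι ((cosyzygyIter A (n + 1)).obj N))
    (fun n => hull_d_comp_d ((cosyzygyIter A n).obj N))

lemma hullComplex_d (N : ModuleCat.{u} A) (n : ℕ) : (hullComplex N).d n (n + 1) =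
    cosyzygyπ ((cosyzygyIter A n).obj N) ≫ injHullι ((cosyzygyIter A (n + 1)).obj N) :=
  CochainComplex.of_d _ (fun n => cosyzygyπ ((cosyzygyIter A n).obj N) ≫
    injHullι ((cosyzygyIter A (n + 1)).obj N)) n

/-- The embedding at the end of the differential is a monomorphism and the projection at its
beginning is an epimorphism, so exactness reduces to that of one functorial sequence. -/
lemma hullComplex_exact (N : ModuleCat.{u} A) (n : ℕ) :
    (ShortComplex.mk _ _ ((hullComplex N).d_comp_d n (n + 1) (n + 1 + 1))).Exact := by
  rw [ShortComplex.moduleCat_exact_iff]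
  intro x hx
  change ((hullComplex N).d (n + 1) (n + 1 + 1)).hom x = 0 at hx
  rw [hullComplex_d] at hx
  have hx' : (cosyzygyπ ((cosyzygyIter A (n + 1)).obj N)).hom x = 0 :=
    (injective_iff_map_eq_zero _).1
      ((ModuleCat.mono_iff_injective (injHullι ((cosyzygyIter A (n + 1 + 1)).obj N))).1
        inferInstance) _ hx
  obtain ⟨y, hy⟩ := (ShortComplex.moduleCat_exact_iff _).1
    (hullSeq_shortExact ((cosyzygyIter A (n + 1)).obj N)).exact x hx'
  obtain ⟨z, rfl⟩ := (ModuleCat.epi_iff_surjective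
    (cosyzygyπ ((cosyzygyIter A n).obj N))).1 inferInstance y
  refine ⟨z, ?_⟩
  change ((hullComplex N).d n (n + 1)).hom z = x
  rw [hullComplex_d]
  exact hy

lemma hullComplex_exact_zero (N : ModuleCat.{u} A) (w : injHullι N ≫ (hullComplex N).d 0 1 = 0) :
    (ShortComplex.mk _ _ w).Exact := by
  rw [ShortComplex.moduleCat_exact_iff]
  intro x hx
  change ((hullComplex N).d 0 1).hom x = 0 at hx
  rw [hullComplex_d] at hx
  have hx' : (cosyzygyπ N).hom x = 0 :=
    (injective_iff_map_eq_zero _).1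
      ((ModuleCat.mono_iff_injective (injHullι ((cosyzygyIter A 1).obj N))).1
        inferInstance) _ hx
  exact (ShortComplex.moduleCat_exact_iff _).1 (hullSeq_shortExact N).exact x hx'

lemma injHullι_hullComplex_d (N : ModuleCat.{u} A) : injHullι N ≫ (hullComplex N).d 0 1 = 0 := by
  rw [hullComplex_d]
  exact (Category.assoc _ _ _).symm.trans
    ((congrArg (· ≫ _) (injHullι_cosyzygyπ N)).trans Limits.zero_comp)

/-- The augmentation of the functorial injective resolution. -/
def hullι (N : ModuleCat.{u} A) :
    (CochainComplex.single₀ (ModuleCat.{u} A)).obj N ⟶ hullComplex N :=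
  (CochainComplex.fromSingle₀Equiv _ _).symm ⟨injHullι N, injHullι_hullComplex_d N⟩

lemma hullι_f_zero (N : ModuleCat.{u} A) : (hullι N).f 0 = injHullι N :=
  CochainComplex.fromSingle₀Equiv_symm_apply_f_zero _ _

/-- The functorial injective resolution. -/
def hullResolution (N : ModuleCat.{u} A) : InjectiveResolution N where
  cocomplex := hullComplex N
  injective n := inferInstanceAs (Injective ((injHull A).obj ((cosyzygyIter A n).obj N)))
  ι := hullι N
  quasiIso := ⟨fun n => by
    cases n
    · rw [CochainComplex.quasiIsoAt₀_iff, ShortComplex.quasiIso_iff_of_zeros]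
      · refine (ShortComplex.exact_and_mono_f_iff_of_iso ?_).2
          ⟨hullComplex_exact_zero N (injHullι_hullComplex_d N),
            inferInstanceAs (Mono (injHullι N))⟩
        exact ShortComplex.isoMk (Iso.refl _) (Iso.refl _) (Iso.refl _)
          ((Category.id_comp _).trans
            (Eq.trans (hullι_f_zero N).symm (Category.comp_id _).symm))
          ((Category.id_comp _).trans (Category.comp_id _).symm)
      all_goals rfl
    · rw [quasiIsoAt_iff_exactAt]
      · rw [HomologicalComplex.exactAt_iff' _ _ _ _ (by simp; rfl) (by simp; rfl)]
        exact hullComplex_exact N _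
      · apply CochainComplex.exactAt_succ_single_obj⟩

/-- The map of functorial injective resolutions. -/
def hullComplexMap {N N' : ModuleCat.{u} A} (f : N ⟶ N') : hullComplex N ⟶ hullComplex N' where
  f n := (injHull A).map ((cosyzygyIter A n).map f)
  comm' i j hij := by
    obtain rfl : i + 1 = j := hij
    rw [hullComplex_d, hullComplex_d]
    refine (Category.assoc _ _ _).symm.trans (Eq.trans ?_ (Category.assoc _ _ _).symm)
    refine (congrArg (· ≫ _) (cosyzygyπ_naturality ((cosyzygyIter A i).map f)).symm).trans ?_
    refine (Category.assoc _ _ _).trans (congrArg (_ ≫ ·) ?_)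
    exact (injHullι_naturality ((cosyzygyIter A (i + 1)).map f)).symm

lemma hullι_hullComplexMap {N N' : ModuleCat.{u} A} (f : N ⟶ N') :
    hullι N ≫ hullComplexMap f = (CochainComplex.single₀ (ModuleCat.{u} A)).map f ≫ hullι N' := by
  ext : 1
  rw [HomologicalComplex.comp_f, HomologicalComplex.comp_f, hullι_f_zero, hullι_f_zero]
  exact injHullι_naturality f

/-- Stable homology computed with the functorial injective resolution. -/
def hullStableTor (k : Type u) [CommRing k] [Algebra k A]
    (P : ChainComplex (ModuleCat.{u} Aᵐᵒᵖ) ℕ) (i : ℤ) :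
    ModuleCat.{u} A ⥤ ModuleCat.{u} k where
  obj N := (stableTensor k P (hullComplex N)).homology (i + 1)
  map f := HomologicalComplex.homologyMap (stableTensorMap k P (hullComplexMap f)) (i + 1)
  map_id N := by
    have : hullComplexMap (𝟙 N) = 𝟙 _ := by
      ext n : 1
      exact (congrArg (injHull A).map ((cosyzygyIter A n).map_id N)).trans ((injHull A).map_id _)
    rw [this, stableTensorMap_id, HomologicalComplex.homologyMap_id]
  map_comp f g := by
    have : hullComplexMap (f ≫ g) = hullComplexMap f ≫ hullComplexMap g := by
      ext n : 1
      exact (congrArg (injHull A).map ((cosyzygyIter A n).map_comp f g)).trans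
        ((injHull A).map_comp _ _)
    rw [this, stableTensorMap_comp, HomologicalComplex.homologyMap_comp]

/-- Lifts of one map of modules to injective resolutions are homotopic, and homotopies pass to the
stable tensor product. Hence induced maps depend only on the maps of modules. This gives both the
inverse and the naturality of `stableTorIso`. -/
lemma homologyMap_stableTensorMap_comp (k : Type u) [CommRing k] [Algebra k A]
    (P : ChainComplex (ModuleCat.{u} Aᵐᵒᵖ) ℕ) {N N' N'' : ModuleCat.{u} A} {f : N ⟶ N'}
    {g : N' ⟶ N''} {I : InjectiveResolution N} {J : InjectiveResolution N'}
    {K : InjectiveResolution N''} {φ : I.cocomplex ⟶ J.cocomplex} {ψ : J.cocomplex ⟶ K.cocomplex}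
    {χ : I.cocomplex ⟶ K.cocomplex}
    (hφ : I.ι ≫ φ = (CochainComplex.single₀ _).map f ≫ J.ι)
    (hψ : J.ι ≫ ψ = (CochainComplex.single₀ _).map g ≫ K.ι)
    (hχ : I.ι ≫ χ = (CochainComplex.single₀ _).map (f ≫ g) ≫ K.ι) (n : ℤ) :
    HomologicalComplex.homologyMap (stableTensorMap k P φ) n ≫
      HomologicalComplex.homologyMap (stableTensorMap k P ψ) n =
      HomologicalComplex.homologyMap (stableTensorMap k P χ) n := by
  rw [← HomologicalComplex.homologyMap_comp, ← stableTensorMap_comp]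
  refine (stableTensorHomotopy k P (InjectiveResolution.descHomotopy (f ≫ g) _ _ ?_ hχ)
    ).homologyMap_eq n
  rw [reassoc_of% hφ, hψ, Functor.map_comp, Category.assoc]

lemma homologyMap_stableTensorMap_id (k : Type u) [CommRing k] [Algebra k A]
    (P : ChainComplex (ModuleCat.{u} Aᵐᵒᵖ) ℕ) (I : CochainComplex (ModuleCat.{u} A) ℕ) (n : ℤ) :
    HomologicalComplex.homologyMap (stableTensorMap k P (𝟙 I)) n = 𝟙 _ := by
  rw [stableTensorMap_id, HomologicalComplex.homologyMap_id]

/-- Stable homology can be computed with the functorial injective resolution. -/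
def stableTorIso (k : Type u) [CommRing k] [Algebra k A] {M : ModuleCat.{u} Aᵐᵒᵖ}
    (P : ProjectiveResolution M) (i : ℤ) :
    stableTor k P i ≅ hullStableTor k P.complex i :=
  NatIso.ofComponents
    (fun N =>
      { hom := HomologicalComplex.homologyMap (stableTensorMap k P.complex
          (InjectiveResolution.desc (𝟙 N) (hullResolution N) (injectiveResolution N))) (i + 1)
        inv := HomologicalComplex.homologyMap (stableTensorMap k P.complex
          (InjectiveResolution.desc (𝟙 N) (injectiveResolution N) (hullResolution N))) (i + 1)
        hom_inv_id := (homologyMap_stableTensorMap_comp k P.complex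
          (InjectiveResolution.desc_commutes (𝟙 N) _ _)
          (InjectiveResolution.desc_commutes (𝟙 N) _ _)
          (χ := 𝟙 _) (by simp) (i + 1)).trans (homologyMap_stableTensorMap_id k _ _ _)
        inv_hom_id := (homologyMap_stableTensorMap_comp k P.complex
          (I := hullResolution N) (K := hullResolution N)
          (InjectiveResolution.desc_commutes (𝟙 N) _ _)
          (InjectiveResolution.desc_commutes (𝟙 N) _ _)
          (χ := 𝟙 _) (by simp) (i + 1)).trans (homologyMap_stableTensorMap_id k _ _ _) })
    (fun {N N'} f => (homologyMap_stableTensorMap_comp k P.complex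
      (InjectiveResolution.desc_commutes f _ _) (InjectiveResolution.desc_commutes (𝟙 N') _ _)
      (χ := InjectiveResolution.desc f (hullResolution N') (injectiveResolution N))
      (by simp) (i + 1)).trans (homologyMap_stableTensorMap_comp k P.complex
      (InjectiveResolution.desc_commutes (𝟙 N) (hullResolution N) _)
      (K := hullResolution N') (hullι_hullComplexMap f) (by simp) (i + 1)).symm)

end Resolution

/-! ### Signs and families supported on a diagonal -/

section Signs

variable (k : Type u) [CommRing k]

/-- The sign `(-1)^{p(p+1)/2}`. -/
def triSign : ℕ → k
  | 0 => 1
  | p + 1 => (-1) ^ (p + 1) * triSign p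

lemma triSign_mul_self (p : ℕ) : triSign k p * triSign k p = 1 := by
  induction p with
  | zero => simp [triSign]
  | succ p ih =>
    rw [triSign, mul_mul_mul_comm, ih, ← mul_pow]
    simp

/-- Transport of a member of a sequence along equalities of indices. -/
def transport (X : ℕ → ℕ → Type u) {s t : ℕ → ℕ} (e : ∀ r, X (s r) (t r)) {r p n : ℕ}
    (h : s r = p ∧ t r = n) : X p n :=
  h.1 ▸ h.2 ▸ e r

/-- Consecutive values of `triSign` differ by the factor (-1)^(p+1). Rescaling by `triSign`
therefore absorbs the alternating sign of the total differential into an overall unit and leaves a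
difference. -/
lemma sign_identity {X : Type u} [AddCommGroup X] [Module k X] (p : ℕ) (x y : X) :
    x + (-1 : k) ^ p • y =
      ((-1) ^ (p + 1) * triSign k p) • (triSign k (p + 1) • x - triSign k p • y) := by
  have hs := triSign_mul_self k p
  have hp : ((-1 : k) ^ (p + 1)) * (-1) ^ (p + 1) = 1 := by rw [← mul_pow]; simp
  have c1 : (-1) ^ (p + 1) * triSign k p * triSign k (p + 1) = 1 := by
    rw [triSign, mul_mul_mul_comm, hp, hs, one_mul]
  have c2 : (-1) ^ (p + 1) * triSign k p * triSign k p = -(-1) ^ p := by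
    rw [mul_assoc, hs, mul_one, pow_succ, mul_neg, mul_one]
  rw [smul_sub, smul_smul, smul_smul, c1, c2, one_smul, neg_smul, sub_neg_eq_add]

/-- A sequence of elements extends by zero to a doubly indexed family. -/
lemma exists_extension {X : ℕ → ℕ → Type u} [∀ p n, Zero (X p n)] (s t : ℕ → ℕ)
    (hs : Function.Injective s) (e : ∀ r, X (s r) (t r)) :
    ∃ E : ∀ p n, X p n, (∀ r, E (s r) (t r) = e r) ∧
      ∀ p n, (∀ r, ¬ (s r = p ∧ t r = n)) → E p n = 0 := by
  classical
  refine ⟨fun p n => if h : ∃ r, s r = p ∧ t r = n then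
    transport X e h.choose_spec else 0, ?_, ?_⟩
  · intro r
    have h : ∃ r', s r' = s r ∧ t r' = t r := ⟨r, rfl, rfl⟩
    refine (dif_pos h).trans ?_
    have key : ∀ (r' : ℕ) (h : s r' = s r ∧ t r' = t r), transport X e h = e r := by
      intro r' h
      obtain rfl := hs h.1
      rfl
    exact key _ _
  · intro p n h
    exact dif_neg (by push Not; intro r h1 h2; exact h r ⟨h1, h2⟩)

end Signs

/-! ### Stable homology in terms of families up to finitely many columns -/

section Finite

variable {k : Type u} [CommRing k] {A : Type u} [Ring A] [Algebra k A]
  {P : ChainComplex (ModuleCat.{u} Aᵐᵒᵖ) ℕ} {I : CochainComplex (ModuleCat.{u} A) ℕ}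

/-- A family on one diagonal has at most one nonzero member for each `n`, so finite support means
that the members vanish for large `n`. All conditions in the quotient complex become conditions for
large `n`. -/
lemma mem_finiteFamilies_iff {m : ℤ} {z : Bigraded k P I} (hz : z ∈ barComponent k P I m) :
    z ∈ finiteFamilies k P I ↔ ∃ Q, ∀ n, Q ≤ n → ∀ p, z p n = 0 := by
  constructor
  · intro h
    have h' : {x : ℕ × ℕ | z x.1 x.2 ≠ 0}.Finite := h
    obtain ⟨Q, hQ⟩ := (h'.image Prod.snd).bddAbove
    refine ⟨Q + 1, fun n hn p => ?_⟩
    by_contra h0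
    have := hQ ⟨(p, n), h0, rfl⟩
    simp only at this
    omega
  · rintro ⟨Q, hQ⟩
    refine ((Set.finite_Iio Q).image fun n : ℕ => ((n + m).toNat, n)).subset ?_
    rintro ⟨p, n⟩ hx
    have hn : n < Q := by
      by_contra h0
      exact hx (hQ n (by omega) p)
    have hp : (p : ℤ) - n = m := by
      by_contra h0
      exact hx (hz p n h0)
    refine ⟨n, hn, ?_⟩
    simp only [Prod.mk.injEq, and_true]
    omega

/-- The class of a family in the quotient complex. -/
def stableMk {m : ℤ} (z : Bigraded k P I) (hz : z ∈ barComponent k P I m) :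
    (stableTensor k P I).X m :=
  Submodule.Quotient.mk (p := tensorComponent k P I m) ⟨z, hz⟩

lemma stableMk_eq_iff {m : ℤ} {z z' : Bigraded k P I} (hz : z ∈ barComponent k P I m)
    (hz' : z' ∈ barComponent k P I m) :
    stableMk z hz = stableMk z' hz' ↔ ∃ Q, ∀ n, Q ≤ n → ∀ p, z p n = z' p n := by
  refine (Submodule.Quotient.eq (tensorComponent k P I m)).trans ?_
  refine (mem_finiteFamilies_iff (sub_mem hz hz')).trans ?_
  simp only [Pi.sub_apply, sub_eq_zero]

lemma exists_stableMk {m : ℤ} (w : (stableTensor k P I).X m) :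
    ∃ z hz, stableMk (m := m) z hz = w := by
  obtain ⟨z, rfl⟩ := Submodule.Quotient.mk_surjective (tensorComponent k P I m) w
  exact ⟨z.1, z.2, rfl⟩

lemma stableTensor_d_stableMk {m n : ℤ} (h : n + 1 = m) (z : Bigraded k P I)
    (hz : z ∈ barComponent k P I m) :
    ((stableTensor k P I).d m n).hom (stableMk z hz) =
      stableMk (totalD k P I z) (totalD_mem_bar k P I h z hz) := by
  rw [stableTensor_d k P I h]
  rfl

/-- A cycle of the quotient complex is a family whose total differential has finite support. -/
lemma exists_isClass_stableMk_iff {i : ℤ} (z : Bigraded k P I)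
    (hz : z ∈ barComponent k P I (i + 1)) :
    (∃ h, IsClass (stableTensor k P I) (i + 1) (stableMk z hz) h) ↔
      ∃ Q, ∀ n, Q ≤ n → ∀ p, totalD k P I z p n = 0 := by
  have hnext : (ComplexShape.down ℤ).next (i + 1) = i :=
    (ComplexShape.down ℤ).next_eq' rfl
  have key : ((stableTensor k P I).d (i + 1) i).hom (stableMk z hz) = 0 ↔
      ∃ Q, ∀ n, Q ≤ n → ∀ p, totalD k P I z p n = 0 := by
    rw [stableTensor_d_stableMk rfl]
    exact stableMk_eq_iff _ (zero_mem _)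
  rw [← key]
  exact ⟨fun ⟨h, H⟩ => H.d_eq_zero i, fun H => IsClass.exists_of_d_eq_zero hnext H⟩

lemma isClass_stableMk_zero_iff {i : ℤ} (z : Bigraded k P I)
    (hz : z ∈ barComponent k P I (i + 1)) :
    IsClass (stableTensor k P I) (i + 1) (stableMk z hz) 0 ↔
      ∃ v ∈ barComponent k P I (i + 1 + 1), ∃ Q, ∀ n, Q ≤ n → ∀ p,
        totalD k P I v p n = z p n := by
  have hprev : (ComplexShape.down ℤ).prev (i + 1) = i + 1 + 1 :=
    (ComplexShape.down ℤ).prev_eq' rfl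
  constructor
  · intro H
    obtain ⟨w, hw⟩ := H.exists_of_zero hprev
    obtain ⟨v, hv, rfl⟩ := exists_stableMk w
    rw [stableTensor_d_stableMk rfl] at hw
    exact ⟨v, hv, (stableMk_eq_iff _ _).1 hw⟩
  · rintro ⟨v, hv, H⟩
    have := (stableMk_eq_iff (totalD_mem_bar k P I rfl v hv) hz).2 H
    rw [← this, ← stableTensor_d_stableMk rfl v hv]
    exact IsClass.of_d _

end Finite

/-! ### Comparison of stable homology with the limit construction -/

section Comparison

variable {k : Type u} [CommRing k] {A : Type u} [Ring A] [Algebra k A]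
  {M : ModuleCat.{u} Aᵐᵒᵖ} (P : ProjectiveResolution M) (N : ModuleCat.{u} A)

/-- The map `P ⊗ J(Σⁿ N) ⟶ P ⊗ Σⁿ⁺¹ N`. -/
abbrev tensorπ (n : ℕ) :
    (complexTensor k P.complex).obj ((injHull A).obj ((cosyzygyIter A n).obj N)) ⟶
    (complexTensor k P.complex).obj ((cosyzygyIter A (n + 1)).obj N) :=
  (complexTensor k P.complex).map (cosyzygyπ ((cosyzygyIter A n).obj N))

/-- The map `P ⊗ Σⁿ N ⟶ P ⊗ J(Σⁿ N)`. -/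
abbrev tensorι (n : ℕ) : (complexTensor k P.complex).obj ((cosyzygyIter A n).obj N) ⟶
    (complexTensor k P.complex).obj ((injHull A).obj ((cosyzygyIter A n).obj N)) :=
  (complexTensor k P.complex).map (injHullι ((cosyzygyIter A n).obj N))

lemma tensorι_tensorπ (n : ℕ) : tensorι (k := k) P N n ≫ tensorπ P N n = 0 :=
  ((complexTensor k P.complex).map_comp _ _).symm.trans
    ((congrArg _ (injHullι_cosyzygyπ _)).trans (Functor.map_zero _ _ _))

lemma tensorHull_shortExact (n : ℕ) :
    (ShortComplex.mk _ _ (tensorι_tensorπ (k := k) P N n)).ShortExact :=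
  shortExact_complexTensor k P.complex P.projective (hullSeq ((cosyzygyIter A n).obj N))
    (hullSeq_shortExact _)

/-- The connecting homomorphism `Tor_{p+1}(M, Σⁿ⁺¹ N) ⟶ Tor_p(M, Σⁿ N)`. -/
def tensorδ (n p : ℕ) :
    ((complexTensor k P.complex).obj ((cosyzygyIter A (n + 1)).obj N)).homology (p + 1) →ₗ[k]
    ((complexTensor k P.complex).obj ((cosyzygyIter A n).obj N)).homology p :=
  ((tensorHull_shortExact (k := k) P N n).δ (p + 1) p rfl).hom

variable {P N}

/-- The component of a tower in nonnegative degree. -/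
def entry {i : ℤ} (x : (torFamily k P).PreTower i N) (n p : ℕ) (h : i + n = p) :
    ((complexTensor k P.complex).obj ((cosyzygyIter A n).obj N)).homology p := x n p h

lemma tensorδ_entry {i : ℤ} (x : (torFamily k P).Tower i N) (n p : ℕ) (h : i + n = p)
    (h' : i + (n + 1 : ℕ) = (p + 1 : ℕ)) :
    tensorδ P N n p (entry x.1 (n + 1) (p + 1) h') = entry x.1 n p h :=
  ConnectedFamily.Tower.compat x n p h h'

/-- The family with given components in nonnegative degrees. -/
def ofEntries (i : ℤ) (E : ∀ n p : ℕ,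
    ((complexTensor k P.complex).obj ((cosyzygyIter A n).obj N)).homology p) :
    (torFamily k P).PreTower i N := fun n j _ => match j with
  | .ofNat p => E n p
  | .negSucc _ => PUnit.unit

/-- In negative degrees Tor is zero, so compatibility is automatic there. Small indices are filled
in by `Tower.exists_of_eventually`. -/
lemma exists_tower_of_entries (i : ℤ) (m : ℕ) (E : ∀ n p : ℕ,
    ((complexTensor k P.complex).obj ((cosyzygyIter A n).obj N)).homology p)
    (hE : ∀ n, m ≤ n → ∀ p : ℕ, i + n = p → tensorδ P N n p (E (n + 1) (p + 1)) = E n p) :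
    ∃ x : (torFamily k P).Tower i N,
      ∀ (n p : ℕ) (h : i + n = p), m ≤ n → entry x.1 n p h = E n p := by
  obtain ⟨y, hy⟩ := ConnectedFamily.Tower.exists_of_eventually m (ofEntries i E) (by
    intro n hn j h h'
    cases j with
    | ofNat p => exact hE n hn p h
    | negSucc p => exact Subsingleton.elim (α := PUnit) _ _)
  exact ⟨y, fun n p h hn => hy n hn p h⟩

lemma tower_eq_zero_of_entries {i : ℤ} (x : (torFamily k P).Tower i N) (m : ℕ)
    (hx : ∀ (n p : ℕ) (h : i + n = p), m ≤ n → entry x.1 n p h = 0) : x = 0 := by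
  refine ConnectedFamily.Tower.ext_of_le m fun n hn j h => ?_
  cases j with
  | ofNat p => exact hx n p h hn
  | negSucc p => exact Subsingleton.elim (α := PUnit) _ _

/-- The element `± z p n` of `P ⊗ J(Σⁿ N)`. -/
def signed (z : Bigraded k P.complex (hullComplex N)) (p n : ℕ) :
    ((complexTensor k P.complex).obj ((injHull A).obj ((cosyzygyIter A n).obj N))).X p :=
  (triSign k p • z p n : BalTensor k (P.complex.X p) ((hullComplex N).X n))

/-- The total differential after a change of signs. -/
lemma totalD_succ_eq (z : Bigraded k P.complex (hullComplex N)) (p n : ℕ) :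
    totalD k P.complex (hullComplex N) z p (n + 1) = ((-1) ^ (p + 1) * triSign k p) •
      ((((complexTensor k P.complex).obj ((injHull A).obj ((cosyzygyIter A (n + 1)).obj N))).d
        (p + 1) p).hom (signed z (p + 1) (n + 1)) -
      ((tensorι P N (n + 1)).f p).hom (((tensorπ P N n).f p).hom (signed z p n)) :
        BalTensor k (P.complex.X p) ((hullComplex N).X (n + 1))) := by
  have e1 : (((complexTensor k P.complex).obj ((injHull A).obj ((cosyzygyIter A (n + 1)).obj N))).d
        (p + 1) p).hom (signed z (p + 1) (n + 1)) =
      triSign k (p + 1) • bmap k (P.complex.d (p + 1) p) (𝟙 _) (z (p + 1) (n + 1)) :=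
    map_smul (bmap k (P.complex.d (p + 1) p) (𝟙 ((hullComplex N).X (n + 1)))) _ _
  have e2 : ((tensorι P N (n + 1)).f p).hom (((tensorπ P N n).f p).hom (signed z p n)) =
      triSign k p • bmap k (𝟙 _) ((hullComplex N).d n (n + 1)) (z p n) := by
    rw [hullComplex_d]
    refine Eq.trans ?_ (map_smul (bmap k (𝟙 (P.complex.X p)) (cosyzygyπ ((cosyzygyIter A n).obj N) ≫
      injHullι ((cosyzygyIter A (n + 1)).obj N))) _ _)
    refine (bmap_bmap k (𝟙 (P.complex.X p)) (𝟙 (P.complex.X p))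
      (cosyzygyπ ((cosyzygyIter A n).obj N)) (injHullι ((cosyzygyIter A (n + 1)).obj N)) _).trans ?_
    rw [Category.comp_id]
    rfl
  exact (sign_identity k p _ _).trans (congrArg₂ (fun a b : BalTensor k (P.complex.X p)
    ((hullComplex N).X (n + 1)) => ((-1) ^ (p + 1) * triSign k p) • (a - b)) e1.symm e2.symm)

end Comparison

/-! ### The relation between stable classes and towers is bijective -/

section ComparisonIso

variable {k : Type u} [CommRing k] {A : Type u} [Ring A] [Algebra k A]
  {M : ModuleCat.{u} Aᵐᵒᵖ} (P : ProjectiveResolution M) (N : ModuleCat.{u} A)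

/-- The family `z` represents the tower `x`: up to signs, the images of its members in the modules
`P ⊗ Σⁿ⁺¹ N` are eventually cycles with the classes given by `x`. -/
def Represents {i : ℤ} (z : Bigraded k P.complex (hullComplex N))
    (x : (torFamily k P).PreTower i N) : Prop :=
  -- The member in P_p ⊗ J(Σⁿ N) has p - n = i + 1, and its image in P_p ⊗ Σⁿ⁺¹N belongs to entry `n
  -- + 1`, as p = i + (n + 1). This is the origin of the degree shift by one in stable homology.
  ∃ Q : ℕ, ∀ n p : ℕ, Q ≤ n → ∀ h : i + (n + 1 : ℕ) = p,
    IsClass _ p (((tensorπ (k := k) P N n).f p).hom (signed z p n)) (entry x (n + 1) p h)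

/-- The relation between classes in stable homology and towers. -/
def stableTowerRel (i : ℤ) :
    Submodule k ((stableTensor k P.complex (hullComplex N)).homology (i + 1) ×
      (torFamily k P).Tower i N) where
  carrier := {c | ∃ (z : Bigraded k P.complex (hullComplex N))
    (hz : z ∈ barComponent k P.complex (hullComplex N) (i + 1)),
    IsClass _ (i + 1) (stableMk z hz) c.1 ∧ Represents P N z c.2.1}
  add_mem' := by
    rintro c c' ⟨z, hz, h, Q, hQ⟩ ⟨z', hz', h', Q', hQ'⟩
    refine ⟨z + z', add_mem hz hz', h.add h', max Q Q', fun n p hn hp => ?_⟩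
    have := (hQ n p (by omega) hp).add (hQ' n p (by omega) hp)
    refine Eq.subst (motive := fun y => IsClass _ p y _) ?_ this
    refine (map_add _ _ _).symm.trans (congrArg _ ?_)
    exact (smul_add (triSign k p) (z p n) (z' p n)).symm
  zero_mem' := by
    refine ⟨0, zero_mem _, IsClass.zero, 0, fun n p _ hp => ?_⟩
    refine Eq.subst (motive := fun y => IsClass _ p y _) ?_ IsClass.zero
    refine (map_zero _).symm.trans (congrArg _ ?_)
    exact (smul_zero (triSign k p)).symm
  smul_mem' := by
    rintro a c ⟨z, hz, h, Q, hQ⟩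
    refine ⟨a • z, Submodule.smul_mem _ a hz, h.smul a, Q, fun n p hn hp => ?_⟩
    have := (hQ n p hn hp).smul a
    refine Eq.subst (motive := fun y => IsClass _ p y _) ?_ this
    refine (map_smul _ _ _).symm.trans (congrArg _ ?_)
    exact smul_comm a (triSign k p) (z p n)

variable {P N}

lemma tensorι_injective (n p : ℕ) : Function.Injective ((tensorι (k := k) P N n).f p).hom :=
  f_injective (tensorHull_shortExact P N n) p

lemma tensorπ_tensorι_apply (n p : ℕ)
    (x : ((complexTensor k P.complex).obj ((cosyzygyIter A n).obj N)).X p) :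
    ((tensorπ P N n).f p).hom (((tensorι P N n).f p).hom x) = 0 :=
  g_f_apply (S := ShortComplex.mk _ _ (tensorι_tensorπ P N n)) p x

/-- A column of the total differential vanishes if and only if the signed members are
compatible. -/
lemma totalD_succ_eq_zero_iff (z : Bigraded k P.complex (hullComplex N)) (p n : ℕ) :
    totalD k P.complex (hullComplex N) z p (n + 1) = 0 ↔
      (((complexTensor k P.complex).obj ((injHull A).obj ((cosyzygyIter A (n + 1)).obj N))).d
        (p + 1) p).hom (signed z (p + 1) (n + 1)) =
      ((tensorι P N (n + 1)).f p).hom (((tensorπ P N n).f p).hom (signed z p n)) := by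
  rw [totalD_succ_eq]
  have hu : IsUnit ((-1) ^ (p + 1) * triSign k p) :=
    ((isUnit_one.neg).pow _).mul (IsUnit.of_mul_eq_one _ (triSign_mul_self k p))
  refine (hu.smul_eq_zero).trans ?_
  exact sub_eq_zero

/-- For large `n` the differential of the signed member at `(p + 1, n + 1)` is the image of the one
at `(p, n)`. As the embedding is injective, the images in the cosyzygies are cycles. The same
equation is the description of the connecting homomorphism by representatives, so their classes are
compatible. -/
lemma exists_tower {i : ℤ} (h : (stableTensor k P.complex (hullComplex N)).homology (i + 1)) :
    ∃ x, (h, x) ∈ stableTowerRel P N i := by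
  classical
  obtain ⟨w, hw⟩ := IsClass.exists_rep h
  obtain ⟨z, hz, rfl⟩ := exists_stableMk w
  obtain ⟨Q, hQ⟩ := (exists_isClass_stableMk_iff z hz).1 ⟨h, hw⟩
  have hcomp : ∀ n, Q ≤ n → ∀ p, _ := fun n hn p =>
    (totalD_succ_eq_zero_iff z p n).1 (hQ (n + 1) (by omega) p)
  have hcl : ∀ n, Q ≤ n → ∀ p,
      ∃ c, IsClass _ p (((tensorπ (k := k) P N n).f p).hom (signed z p n)) c := by
    intro n hn p
    refine IsClass.exists_of_d_eq_zero rfl (tensorι_injective (n + 1) _ ?_)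
    rw [hom_d_apply, map_zero, ← hcomp n hn p, d_d_apply]
  -- The default value zero is used for index `0` and for elements that are not cycles. Neither case
  -- occurs for indices above `Q`.
  let E : ∀ n p : ℕ, ((complexTensor k P.complex).obj ((cosyzygyIter A n).obj N)).homology p :=
    fun n p => match n with
    | 0 => 0
    | n + 1 => if H : ∃ c, IsClass _ p (((tensorπ (k := k) P N n).f p).hom (signed z p n)) c
      then H.choose else 0
  have hE : ∀ n, Q ≤ n → ∀ p,
      IsClass _ p (((tensorπ (k := k) P N n).f p).hom (signed z p n)) (E (n + 1) p) := by
    intro n hn p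
    have H := hcl n hn p
    have e : E (n + 1) p = H.choose := dif_pos H
    rw [e]
    exact H.choose_spec
  obtain ⟨x, hx⟩ := exists_tower_of_entries i (Q + 1) E (by
    intro n hn p _
    obtain ⟨n, rfl⟩ : ∃ m, n = m + 1 := ⟨n - 1, by omega⟩
    have := IsClass.δ (tensorHull_shortExact P N (n + 1)) (i := p + 1) (j := p) rfl
      (hE (n + 1) (by omega) (p + 1)) rfl (hcomp n (by omega) p).symm
    exact this.unique (hE n (by omega) p))
  refine ⟨x, z, hz, hw, Q, fun n p hn hp => ?_⟩
  rw [hx (n + 1) p hp (by omega)]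
  exact hE n hn p

lemma sign_identity' (k : Type u) [CommRing k] {X : Type u} [AddCommGroup X] [Module k X] (p : ℕ)
    (x y : X) : ((-1 : k) ^ (p + 1) * triSign k p) • ((-1 : k) ^ (p + 1) • x - (-1 : k) ^ p • y) =
      triSign k p • (x + y) := by
  have hp : (-1 : k) ^ p * (-1) ^ p = 1 := by rw [← mul_pow]; simp
  have e : (-1 : k) ^ (p + 1) • x - (-1 : k) ^ p • y = (-1 : k) ^ (p + 1) • (x + y) := by
    rw [pow_succ, mul_neg, mul_one, neg_smul, neg_smul, smul_add, neg_add, sub_eq_add_neg]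
  rw [e, smul_smul]
  congr 1
  rw [pow_succ]
  linear_combination triSign k p * hp

/-- The starting point of the diagonal of degree `m`. -/
lemma exists_diagonal (m : ℤ) : ∃ a b : ℕ, (a : ℤ) - b = m ∧
    ∀ p n : ℕ, (p : ℤ) - n = m → ∃ r, a + r = p ∧ b + r = n := by
  refine ⟨m.toNat, (-m).toNat, by omega, fun p n h => ?_⟩
  exact ⟨p - m.toNat, by omega, by omega⟩

lemma signed_signed (E : ∀ p n : ℕ,
    ((complexTensor k P.complex).obj ((injHull A).obj ((cosyzygyIter A n).obj N))).X p) (p n : ℕ) :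
    signed (P := P) (N := N) (fun p n => (triSign k p • E p n :)) p n = E p n := by
  refine (smul_smul (triSign k p) (triSign k p) (E p n)).trans ?_
  rw [triSign_mul_self, one_smul]

/-- Surjectivity onto the limit needs no lim¹ condition: representatives can be corrected one after
the other along the diagonal by `exists_compatible_elements`. -/
lemma exists_stable {i : ℤ} (x : (torFamily k P).Tower i N) :
    ∃ h, (h, x) ∈ stableTowerRel P N i := by
  obtain ⟨a, b, hab, hdiag⟩ := exists_diagonal (i + 1)
  obtain ⟨z, hz⟩ := exists_compatible_elements
    (K := fun r => (complexTensor k P.complex).obj ((cosyzygyIter A (b + r)).obj N))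
    (L := fun r => (complexTensor k P.complex).obj
      ((injHull A).obj ((cosyzygyIter A (b + r)).obj N)))
    (f := fun r => tensorι P N (b + r)) (g := fun r => tensorπ P N (b + r))
    (fun r => tensorι_tensorπ (k := k) P N (b + r))
    (fun r => tensorHull_shortExact P N (b + r)) a
    (fun r => entry x.1 (b + r + 1) (a + r) (by push_cast; omega))
    (fun r => tensorδ_entry x (b + (r + 1)) (a + r) (by push_cast; omega) (by push_cast; omega))
  obtain ⟨E, hE, hE0⟩ := exists_extension (X := fun p n =>
    ((complexTensor k P.complex).obj ((injHull A).obj ((cosyzygyIter A n).obj N))).X p)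
    (fun r => a + r) (fun r => b + r) (add_right_injective a) z
  let z' : Bigraded k P.complex (hullComplex N) := fun p n => (triSign k p • E p n :)
  have hs : ∀ p n, signed z' p n = E p n := signed_signed E
  have hz' : z' ∈ barComponent k P.complex (hullComplex N) (i + 1) := by
    intro p n hpn
    have h0 : E p n = 0 := hE0 p n (by rintro r ⟨rfl, rfl⟩; apply hpn; push_cast; omega)
    exact (by rw [h0, smul_zero] : triSign k p • E p n = 0)
  -- The diagonal starts in column `b`. The total differential in that column is not controlled, but
  -- a single column does not matter in the quotient.
  have hD : ∀ n, b + 1 ≤ n → ∀ p, totalD k P.complex (hullComplex N) z' p n = 0 := by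
    intro n hn p
    obtain ⟨n, rfl⟩ : ∃ m, n = m + 1 := ⟨n - 1, by omega⟩
    by_cases hpn : (p : ℤ) - (n + 1 : ℕ) = i
    · rw [totalD_succ_eq_zero_iff, hs, hs]
      obtain ⟨r, rfl, rfl⟩ := hdiag p n (by push_cast at hpn; omega)
      have e1 := hE r
      have e2 := hE (r + 1)
      have e3 := (hz r).2
      rw [e1]
      refine Eq.trans (congrArg _ ?_) e3
      exact e2
    · exact totalD_mem_bar k P.complex (hullComplex N) rfl z' hz' p (n + 1) hpn
  obtain ⟨h, hh⟩ := (exists_isClass_stableMk_iff z' hz').2 ⟨b + 1, hD⟩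
  refine ⟨h, z', hz', hh, 0, fun n p _ hp => ?_⟩
  obtain ⟨r, rfl, rfl⟩ := hdiag p n (by push_cast at hp; omega)
  have e1 := hE r
  rw [hs, e1]
  exact (hz r).1

/-- If `z` is eventually the total differential of `v`, then up to sign a member of `z` is a
boundary plus an element coming from a cosyzygy. The projection to the next cosyzygy kills the
latter and leaves a boundary, so the entries of the tower vanish for large indices. -/
lemma eq_zero_of_stable_zero {i : ℤ} {x : (torFamily k P).Tower i N}
    (h : (0, x) ∈ stableTowerRel P N i) : x = 0 := by
  obtain ⟨z, hz, h0, Q, hQ⟩ := h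
  obtain ⟨v, hv, Q', hQ'⟩ := (isClass_stableMk_zero_iff z hz).1 h0
  refine tower_eq_zero_of_entries x (Q + Q' + 2) fun n p h hn => ?_
  obtain ⟨n, rfl⟩ : ∃ m, n = m + 2 := ⟨n - 2, by omega⟩
  have hc := hQ (n + 1) p (by omega) h
  refine hc.unique ?_
  have e : signed z p (n + 1) = ((-1) ^ (p + 1) : k) •
      ((((complexTensor k P.complex).obj ((injHull A).obj ((cosyzygyIter A (n + 1)).obj N))).d
        (p + 1) p).hom (signed v (p + 1) (n + 1)) -
      ((tensorι P N (n + 1)).f p).hom (((tensorπ P N n).f p).hom (signed v p n))) := by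
    refine (congrArg (triSign k p • ·) ((hQ' (n + 1) (by omega) p).symm.trans
      (totalD_succ_eq v p n))).trans ?_
    refine (smul_smul _ _ _).trans ?_
    rw [mul_comm, mul_assoc, triSign_mul_self, mul_one]
  rw [e, map_smul, map_sub, tensorπ_tensorι_apply, sub_zero, hom_d_apply, ← map_smul]
  exact IsClass.of_d _

/-- The operator `1 - δ` is surjective on families of elements of `Tor_p(M, Σⁿ N)`. -/
def OneSubδSurjective (P : ProjectiveResolution M) (N : ModuleCat.{u} A) : Prop :=
  ∀ e : ∀ n p : ℕ, ((complexTensor k P.complex).obj ((cosyzygyIter A n).obj N)).homology p,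
    ∃ e' : ∀ n p : ℕ, ((complexTensor k P.complex).obj ((cosyzygyIter A n).obj N)).homology p,
      ∀ n p, e' n p - tensorδ P N n p (e' (n + 1) (p + 1)) = e n p

/-- Primitives of the cycles in the individual columns exist but need not fit together. The
obstruction to a common primitive is of lim¹ type and is removed by `exists_primitive`. -/
lemma eq_zero_of_tower_zero {i : ℤ}
    {h : (stableTensor k P.complex (hullComplex N)).homology (i + 1)}
    (hlim : OneSubδSurjective (k := k) P N) (hh : (h, 0) ∈ stableTowerRel P N i) : h = 0 := by
  obtain ⟨z, hz, hc, Q, hQ⟩ := hh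
  obtain ⟨Q', hQ'⟩ := (exists_isClass_stableMk_iff z hz).1 ⟨h, hc⟩
  obtain ⟨a, b, hab, hdiag⟩ := exists_diagonal (i + 1)
  obtain ⟨q, hq, hq'⟩ : ∃ q, Q ≤ q ∧ Q' ≤ q := ⟨max Q Q', by omega, by omega⟩
  obtain ⟨v, hv⟩ := exists_primitive
    (K := fun r => (complexTensor k P.complex).obj ((cosyzygyIter A (b + q + r)).obj N))
    (L := fun r => (complexTensor k P.complex).obj
      ((injHull A).obj ((cosyzygyIter A (b + q + r)).obj N)))
    (f := fun r => tensorι P N (b + q + r)) (g := fun r => tensorπ P N (b + q + r))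
    (fun r => tensorι_tensorπ (k := k) P N (b + q + r))
    (fun r => tensorHull_shortExact P N (b + q + r)) (a + q)
    (fun r => signed z (a + q + r) (b + q + r))
    (fun r => (totalD_succ_eq_zero_iff z (a + q + r) (b + q + r)).1 (hQ' _ (by omega) _))
    (fun r => hQ (b + q + r) (a + q + r) (by omega) (by push_cast; omega))
    -- Surjectivity of 1 - δ is given for doubly indexed families, so a sequence along the diagonal
    -- is extended by zero and the solution is restricted back.
    (fun e => by
      obtain ⟨E, hE, -⟩ := exists_extension (X := fun p n =>
        ((complexTensor k P.complex).obj ((cosyzygyIter A n).obj N)).homology p)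
        (fun r => a + q + r + 1) (fun r => b + q + (r + 1))
        (fun r r' h => by simp only at h; omega) e
      obtain ⟨E', hE'⟩ := hlim (fun n p => E p n)
      exact ⟨fun r => E' (b + q + (r + 1)) (a + q + r + 1),
        fun r => (hE' (b + q + (r + 1)) (a + q + r + 1)).trans (hE r)⟩)
  obtain ⟨E, hE, hE0⟩ := exists_extension (X := fun p n =>
    ((complexTensor k P.complex).obj ((injHull A).obj ((cosyzygyIter A n).obj N))).X p)
    (fun r => a + q + r + 1) (fun r => b + q + r)
    (fun r r' h => by simp only at h; omega) v
  -- The factor `triSign` undoes the signs in `signed`. The additional factor (-1)^p turns the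
  -- difference in `totalD_succ_eq` into the sum produced by `exists_primitive`.
  let v' : Bigraded k P.complex (hullComplex N) := fun p n =>
    (triSign k p • ((-1 : k) ^ p • E p n) :)
  have hs : ∀ p n, signed v' p n = (-1 : k) ^ p • E p n := signed_signed _
  have hv' : v' ∈ barComponent k P.complex (hullComplex N) (i + 1 + 1) := by
    intro p n hpn
    have h0 : E p n = 0 := hE0 p n (by rintro r ⟨rfl, rfl⟩; apply hpn; push_cast; omega)
    exact (by rw [h0, smul_zero, smul_zero] : triSign k p • ((-1 : k) ^ p • E p n) = 0)
  refine hc.unique ((isClass_stableMk_zero_iff z hz).2 ⟨v', hv', b + q + 1, fun n hn p => ?_⟩)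
  by_cases hpn : (p : ℤ) - n = i + 1
  · obtain ⟨r, rfl, rfl⟩ : ∃ r, p = a + q + r + 1 ∧ n = b + q + r + 1 :=
      ⟨n - b - q - 1, by omega, by omega⟩
    have e1 : E (a + q + r + 1) (b + q + r) = v r := hE r
    have e2 : E (a + q + r + 1 + 1) (b + q + r + 1) = v (r + 1) := hE (r + 1)
    have e3 : signed z (a + q + r + 1) (b + q + r + 1) = _ := hv r
    have e4 := totalD_succ_eq v' (a + q + r + 1) (b + q + r)
    rw [hs, hs, e1, e2, map_smul, map_smul, map_smul] at e4
    refine e4.trans ?_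
    have e5 := congrArg (triSign k (a + q + r + 1) • ·) e3
    refine Eq.trans ?_ (e5.symm.trans ((smul_smul _ _ _).trans ?_))
    · exact sign_identity' k (a + q + r + 1) _ _
    · rw [triSign_mul_self]
      exact one_smul k (z (a + q + r + 1) (b + q + r + 1))
  · rw [hz p n hpn]
    exact totalD_mem_bar k P.complex (hullComplex N) rfl v' hv' p n hpn

variable (P)

lemma stableTowerRel_naturality {N N' : ModuleCat.{u} A} (f : N ⟶ N') {i : ℤ}
    {h : (stableTensor k P.complex (hullComplex N)).homology (i + 1)}
    {x : (torFamily k P).Tower i N} (hx : (h, x) ∈ stableTowerRel P N i) :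
    (((hullStableTor k P.complex i).map f).hom h,
      ConnectedFamily.Tower.map (torFamily k P) i f x) ∈ stableTowerRel P N' i := by
  obtain ⟨z, hz, hc, Q, hQ⟩ := hx
  refine ⟨totalMap k P.complex (hullComplexMap f).f z,
    totalMap_mem_bar k P.complex (hullComplexMap f).f _ z hz,
    hc.map (stableTensorMap k P.complex (hullComplexMap f)), Q, fun n p hn hp => ?_⟩
  have := (hQ n p hn hp).map ((complexTensor k P.complex).map ((cosyzygyIter A (n + 1)).map f))
  refine Eq.subst (motive := fun y => IsClass _ p y _) ?_ this
  have e1 : ((complexTensor k P.complex).map ((cosyzygyIter A (n + 1)).map f)).f p =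
      ModuleCat.ofHom (bmap k (𝟙 (P.complex.X p)) ((cosyzygyIter A (n + 1)).map f)) := rfl
  have e2 : signed (P := P) (totalMap k P.complex (hullComplexMap f).f z) p n =
      bmap k (𝟙 (P.complex.X p)) ((injHull A).map ((cosyzygyIter A n).map f)) (signed z p n) :=
    (map_smul (bmap k (𝟙 (P.complex.X p)) ((injHull A).map ((cosyzygyIter A n).map f))) _ _).symm
  rw [e2]
  refine (bmap_bmap k (𝟙 (P.complex.X p)) (𝟙 (P.complex.X p)) _ _ _).trans
    (Eq.trans ?_ (bmap_bmap k (𝟙 (P.complex.X p)) (𝟙 (P.complex.X p)) _ _ _).symm)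
  exact congrArg (fun g => bmap k (𝟙 (P.complex.X p) ≫ 𝟙 (P.complex.X p)) g (signed z p n))
    (cosyzygyπ_naturality ((cosyzygyIter A n).map f))

/-- A relation between modules that is bijective comes from an isomorphism. -/
lemma exists_equiv_of_relation {X Y : Type u} [AddCommGroup X] [AddCommGroup Y] [Module k X]
    [Module k Y] (Γ : Submodule k (X × Y)) (h1 : ∀ x, ∃ y, (x, y) ∈ Γ) (h2 : ∀ y, ∃ x, (x, y) ∈ Γ)
    (h3 : ∀ y, (0, y) ∈ Γ → y = 0) (h4 : ∀ x, (x, 0) ∈ Γ → x = 0) :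
    ∃ e : X ≃ₗ[k] Y, ∀ x y, (x, y) ∈ Γ ↔ e x = y := by
  have b1 : Function.Bijective (LinearMap.fst k X Y ∘ₗ Γ.subtype) := by
    constructor
    · rw [injective_iff_map_eq_zero]
      rintro ⟨⟨x, y⟩, h⟩ hx
      obtain rfl : x = 0 := hx
      obtain rfl := h3 y h
      rfl
    · intro x
      obtain ⟨y, hy⟩ := h1 x
      exact ⟨⟨(x, y), hy⟩, rfl⟩
  have b2 : Function.Bijective (LinearMap.snd k X Y ∘ₗ Γ.subtype) := by
    constructor
    · rw [injective_iff_map_eq_zero]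
      rintro ⟨⟨x, y⟩, h⟩ hy
      obtain rfl : y = 0 := hy
      obtain rfl := h4 x h
      rfl
    · intro y
      obtain ⟨x, hx⟩ := h2 y
      exact ⟨⟨(x, y), hx⟩, rfl⟩
  have key : ∀ g : Γ, (LinearEquiv.ofBijective _ b2)
      ((LinearEquiv.ofBijective _ b1).symm g.1.1) = g.1.2 := by
    intro g
    have : (LinearEquiv.ofBijective _ b1).symm g.1.1 = g :=
      (LinearEquiv.ofBijective _ b1).symm_apply_apply g
    rw [this]
    rfl
  refine ⟨(LinearEquiv.ofBijective _ b1).symm.trans (LinearEquiv.ofBijective _ b2),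
    fun x y => ⟨fun h => key ⟨(x, y), h⟩, ?_⟩⟩
  rintro rfl
  obtain ⟨y, hy⟩ := h1 x
  have := key ⟨(x, y), hy⟩
  change (x, (LinearEquiv.ofBijective _ b2) ((LinearEquiv.ofBijective _ b1).symm x)) ∈ Γ
  rw [this]
  exact hy

lemma exists_stableTowerEquiv {N : ModuleCat.{u} A} (hlim : OneSubδSurjective (k := k) P N)
    (i : ℤ) : ∃ e : (torFamily k P).Tower i N ≃ₗ[k]
      (stableTensor k P.complex (hullComplex N)).homology (i + 1),
      ∀ h x, (h, x) ∈ stableTowerRel P N i ↔ e x = h := by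
  obtain ⟨e, he⟩ := exists_equiv_of_relation (stableTowerRel (k := k) P N i) exists_tower
    exists_stable (fun _ => eq_zero_of_stable_zero) (fun _ => eq_zero_of_tower_zero hlim)
  exact ⟨e.symm, fun h x => by rw [he, LinearEquiv.symm_apply_eq, eq_comm]⟩

/-- The completion of Tor is isomorphic to stable homology on modules for which `1 - δ` is
surjective. -/
theorem completion_iso_stableTor {C : Type*} [Category C] (G : C ⥤ ModuleCat.{u} A)
    (hG : ∀ X, OneSubδSurjective (k := k) P (G.obj X)) (i : ℤ) :
    Nonempty (G ⋙ (ConnectedFamily.completion (torFamily_isHalfExact k P)).F i ≅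
      G ⋙ stableTor k P i) := by
  choose e he using fun X => exists_stableTowerEquiv P (hG X) i
  have i1 : G ⋙ (ConnectedFamily.completion (torFamily_isHalfExact k P)).F i ≅
      G ⋙ hullStableTor k P.complex i :=
    NatIso.ofComponents (fun X =>
      (show (G ⋙ (ConnectedFamily.completion (torFamily_isHalfExact k P)).F i).obj X ≅
        (G ⋙ hullStableTor k P.complex i).obj X from (e X).toModuleIso))
      fun {X Y} f => ModuleCat.hom_ext (LinearMap.ext fun x =>
        (he Y _ _).1 (stableTowerRel_naturality P (G.map f) ((he X _ x).2 rfl)))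
  exact ⟨i1 ≪≫ Functor.isoWhiskerLeft G (stableTorIso k P i).symm⟩

end ComparisonIso

/-! ### Functionals with values in an injective module -/

section InjectiveFunctionals

variable {k : Type u} [CommRing k] {E : ModuleCat.{u} k}

/-- A map to an injective module that vanishes on the kernel of `f` factors through `f`. -/
lemma exists_extension_of_ker_le (hE : Injective E) {X Y : Type u} [AddCommGroup X] [Module k X]
    [AddCommGroup Y] [Module k Y] (f : X →ₗ[k] Y) (φ : X →ₗ[k] E)
    (h : ∀ x, f x = 0 → φ x = 0) : ∃ ψ : Y →ₗ[k] E, ∀ x, ψ (f x) = φ x := by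
  let j : ModuleCat.of k (X ⧸ LinearMap.ker f) ⟶ ModuleCat.of k Y :=
    ModuleCat.ofHom ((LinearMap.ker f).liftQ f le_rfl)
  have hj : Mono j := by
    rw [ModuleCat.mono_iff_injective]
    exact LinearMap.ker_eq_bot.1 (Submodule.ker_liftQ_eq_bot _ _ _ le_rfl)
  let φ' : ModuleCat.of k (X ⧸ LinearMap.ker f) ⟶ E :=
    ModuleCat.ofHom ((LinearMap.ker f).liftQ φ h)
  refine ⟨(Injective.factorThru φ' j).hom, fun x => ?_⟩
  exact LinearMap.congr_fun (congrArg ModuleCat.Hom.hom (Injective.comp_factorThru φ' j))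
    ((LinearMap.ker f).mkQ x)

/-- Dual form of the vanishing of `lim¹` for a sequence of relations `K_{n,p} ← L_{n,p} →
K_{n+1,p+1}` modulo submodules `B_{n,p}`. -/
lemma exists_compatible_functionals (hE : Injective E) {K L : ℕ × ℕ → Type u}
    [∀ x, AddCommGroup (K x)] [∀ x, Module k (K x)] [∀ x, AddCommGroup (L x)]
    [∀ x, Module k (L x)] (B : ∀ x, Submodule k (K x)) (s : ∀ x, L x →ₗ[k] K x)
    (t : ∀ n p, L (n, p) →ₗ[k] K (n + 1, p + 1))
    (hst : ∀ n p l, s (n, p) l ∈ B (n, p) → t n p l ∈ B (n + 1, p + 1))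
    (φ : ∀ x, K x →ₗ[k] E) (hφ : ∀ x, ∀ b ∈ B x, φ x b = 0) :
    ∃ ψ : ∀ x, K x →ₗ[k] E, (∀ x, ∀ b ∈ B x, ψ x b = 0) ∧
      ∀ n p l, ψ (n, p) (s (n, p) l) - ψ (n + 1, p + 1) (t n p l) = φ (n, p) (s (n, p) l) := by
  classical
  -- Modulo `B`, the relation between `s l` and `t l` is a partially defined shift along the
  -- diagonals, and `f` is 1 minus this shift. The required functionals are the coordinates of an
  -- extension of `φ'` along `f`. Finite support gives the sum `φ'` a meaning.
  let f : (Π₀ x, L x) →ₗ[k] (∀ x, K x ⧸ B x) := LinearMap.pi fun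
    | (0, p) => (B (0, p)).mkQ ∘ₗ s (0, p) ∘ₗ DFinsupp.lapply (0, p)
    | (n + 1, 0) => (B (n + 1, 0)).mkQ ∘ₗ s (n + 1, 0) ∘ₗ DFinsupp.lapply (n + 1, 0)
    | (n + 1, p + 1) => (B (n + 1, p + 1)).mkQ ∘ₗ
        (s (n + 1, p + 1) ∘ₗ DFinsupp.lapply (n + 1, p + 1) - t n p ∘ₗ DFinsupp.lapply (n, p))
  let φ' : (Π₀ x, L x) →ₗ[k] E := DFinsupp.lsum ℕ fun x => φ x ∘ₗ s x
  obtain ⟨ψ, hψ⟩ := exists_extension_of_ker_le hE f φ' (by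
    intro l hl
    -- This is the injectivity of 1 minus a shift. At the edge of the quadrant the shift contributes
    -- nothing, so `s l` lies in `B`. By `hst` so does `t l`, and the next equation on the diagonal
    -- passes this on.
    have key : ∀ n p, s (n, p) (l (n, p)) ∈ B (n, p) := by
      intro n
      induction n with
      | zero => exact fun p => (Submodule.Quotient.mk_eq_zero _).1 (congrFun hl (0, p))
      | succ n ih =>
        intro p
        cases p with
        | zero => exact (Submodule.Quotient.mk_eq_zero _).1 (congrFun hl (n + 1, 0))
        | succ p =>
          have h1 : s (n + 1, p + 1) (l (n + 1, p + 1)) - t n p (l (n, p)) ∈ B (n + 1, p + 1) :=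
            (Submodule.Quotient.mk_eq_zero _).1 (congrFun hl (n + 1, p + 1))
          exact (Submodule.sub_mem_iff_left _ (hst n p _ (ih p))).1 h1
    have : φ' l = l.sum fun x y => φ x (s x y) := 
      (DFinsupp.lsum_apply_apply ..).trans (DFinsupp.sumAddHom_apply ..)
    rw [this]
    exact Finset.sum_eq_zero fun x _ => hφ x _ (key x.1 x.2))
  have hf : ∀ n p l, f (DFinsupp.single (n, p) l) = Pi.single (n, p) ((B (n, p)).mkQ (s (n, p) l)) -
      Pi.single (n + 1, p + 1) ((B (n + 1, p + 1)).mkQ (t n p l)) := by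
    intro n p l
    funext ⟨m, q⟩
    rw [Pi.sub_apply]
    by_cases h1 : (m, q) = (n, p)
    · obtain ⟨rfl, rfl⟩ := Prod.mk.inj h1
      rw [Pi.single_eq_same, Pi.single_eq_of_ne (by simp), sub_zero]
      rcases m with _ | m
      · simp [f]
      rcases q with _ | q
      · simp [f]
      · have : (DFinsupp.single (m + 1, q + 1) l : Π₀ x, L x) (m, q) = 0 :=
          DFinsupp.single_eq_of_ne (by simp)
        simp [f, this]
    · rw [Pi.single_eq_of_ne h1]
      have e1 : (DFinsupp.single (n, p) l : Π₀ x, L x) (m, q) = 0 :=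
        DFinsupp.single_eq_of_ne h1
      by_cases h2 : (m, q) = (n + 1, p + 1)
      · obtain ⟨rfl, rfl⟩ := Prod.mk.inj h2
        rw [Pi.single_eq_same]
        simp [f, e1]
      · rw [Pi.single_eq_of_ne h2]
        rcases m with _ | m
        · simp [f, e1]
        rcases q with _ | q
        · simp [f, e1]
        · have : (DFinsupp.single (n, p) l : Π₀ x, L x) (m, q) = 0 :=
            DFinsupp.single_eq_of_ne (by
              rintro h
              obtain ⟨rfl, rfl⟩ := Prod.mk.inj h
              exact h2 rfl)
          simp [f, e1, this]
  refine ⟨fun x => ψ ∘ₗ LinearMap.single k _ x ∘ₗ (B x).mkQ, fun x b hb => ?_, fun n p l => ?_⟩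
  · simp [(Submodule.Quotient.mk_eq_zero _).2 hb]
  · have h := hψ (DFinsupp.single (n, p) l)
    rw [hf, map_sub] at h
    have h' : φ' (DFinsupp.single (n, p) l) = φ (n, p) (s (n, p) l) := by simp [φ']
    rw [← h', ← h]
    rfl

end InjectiveFunctionals

/-! ### Modules of homomorphisms to an injective module -/

section DualModules

variable {k : Type u} [CommRing k] {A : Type u} [Ring A] [Algebra k A] (E : ModuleCat.{u} k)

/-- The left module `Hom_k(C, E)`. -/
abbrev dualObj (C : ModuleCat.{u} Aᵐᵒᵖ) : ModuleCat.{u} A := (homDual A E).obj (Opposite.op C)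

/-- The map `Hom_k(C', E) ⟶ Hom_k(C, E)` induced by `g : C ⟶ C'`. -/
abbrev dualMap {C C' : ModuleCat.{u} Aᵐᵒᵖ} (g : C ⟶ C') : dualObj E C' ⟶ dualObj E C :=
  (homDual A E).map g.op

variable {E}

lemma dualObj_smul_lin {C : ModuleCat.{u} Aᵐᵒᵖ} (c : k) (f : dualObj E C) (x : C) :
    HomDual.lin (c • f : dualObj E C) x = c • HomDual.lin f x := by
  have h : (c • f : dualObj E C) = algebraMap k A c • f := (algebraMap_smul A c f).symm
  rw [h]
  refine (HomDual.smul_lin A C E (algebraMap k A c) f x).trans ?_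
  rw [← map_smul]
  exact congrArg _ (algebraMap_smul Aᵐᵒᵖ c x)

/-- The map `P ⊗ Hom_k(C, E) → Hom_k(Hom(P, C), E)` that sends `p ⊗ f` to `α ↦ f (α p)`. -/
def tensorEval (P C : ModuleCat.{u} Aᵐᵒᵖ) :
    BalTensor k P (dualObj E C) →ₗ[k] (P →ₗ[Aᵐᵒᵖ] C) →ₗ[k] E :=
  bdesc (TensorProduct.lift (LinearMap.mk₂ k
    (fun p (f : dualObj E C) => (HomDual.lin f) ∘ₗ
      ({ toFun α := α p, map_add' _ _ := rfl, map_smul' _ _ := rfl } : (P →ₗ[Aᵐᵒᵖ] C) →ₗ[k] C))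
    (fun p p' f => LinearMap.ext fun α =>
      (congrArg (HomDual.lin f) (map_add α p p')).trans (map_add _ _ _))
    (fun c p f => LinearMap.ext fun α =>
      (congrArg (HomDual.lin f) ((α.restrictScalars k).map_smul c p)).trans (map_smul _ _ _))
    (fun p f f' => rfl)
    (fun c p f => LinearMap.ext fun α => dualObj_smul_lin c f (α p)))) (by
    intro p a f
    refine LinearMap.ext fun α => ?_
    exact congrArg (HomDual.lin f) (map_smul α (MulOpposite.op a) p))

lemma tensorEval_naturality {P P' C C' : ModuleCat.{u} Aᵐᵒᵖ} (d : P ⟶ P') (g : C' ⟶ C)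
    (w : BalTensor k P (dualObj E C)) (α : P' →ₗ[Aᵐᵒᵖ] C') :
    tensorEval P' C' (bmap k d (dualMap E g) w) α =
      tensorEval P C w (g.hom ∘ₗ α ∘ₗ d.hom) := by
  let pre : ((P →ₗ[Aᵐᵒᵖ] C) →ₗ[k] E) →ₗ[k] E :=
    LinearMap.applyₗ (g.hom ∘ₗ α ∘ₗ d.hom)
  have : LinearMap.applyₗ α ∘ₗ tensorEval P' C' ∘ₗ bmap k d (dualMap E g) =
      pre ∘ₗ tensorEval P C := by
    refine bal_hom_ext fun p f => rfl
  exact LinearMap.congr_fun this w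

/-- Finitely generated projective modules have finite dual bases. -/
lemma exists_dualBasis (P : ModuleCat.{u} Aᵐᵒᵖ) [Projective P] [Module.Finite Aᵐᵒᵖ P] :
    ∃ (m : ℕ) (b : Fin m → P) (c : Fin m → (P →ₗ[Aᵐᵒᵖ] Aᵐᵒᵖ)), ∀ p, ∑ i, c i p • b i = p := by
  have hP : Module.Projective Aᵐᵒᵖ P := (IsProjective.iff_projective P).2 inferInstance
  obtain ⟨m, f, hf⟩ := Module.Finite.exists_fin' Aᵐᵒᵖ P
  obtain ⟨s, hs⟩ := Module.projective_lifting_property f LinearMap.id hf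
  refine ⟨m, fun i => f (Pi.single i 1), fun i => LinearMap.proj i ∘ₗ s, fun p => ?_⟩
  refine Eq.trans ?_ (LinearMap.congr_fun hs p)
  rw [LinearMap.comp_apply, LinearMap.pi_apply_eq_sum_univ f (s p)]
  refine Finset.sum_congr rfl fun i _ => ?_
  refine congrArg (_ • f ·) (funext fun j => ?_)
  simp [Pi.single_apply, eq_comm]

/-- For a finite dual basis (b_i, c_i) of `P`, the inverse sends Φ to the sum of the tensors b_i ⊗
(x ↦ Φ(p ↦ c_i(p) · x)). -/
lemma tensorEval_bijective (P C : ModuleCat.{u} Aᵐᵒᵖ) [Projective P] [Module.Finite Aᵐᵒᵖ P] :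
    Function.Bijective (tensorEval (E := E) P C) := by
  obtain ⟨m, b, c, hbc⟩ := exists_dualBasis P
  let inv : ((P →ₗ[Aᵐᵒᵖ] C) →ₗ[k] E) → Fin m → (C →ₗ[k] E) := fun Φ i =>
    { toFun x := Φ ((c i).smulRight x)
      map_add' x y := by
        rw [← map_add]
        congr 1
        ext p
        simp
      map_smul' r x := by
        rw [RingHom.id_apply, ← map_smul]
        congr 1
        ext p
        exact smul_comm (c i p) r x }
  let toDual : (C →ₗ[k] E) → dualObj E C := fun f => f
  constructor
  · rw [injective_iff_map_eq_zero]
    have key : ∀ w, w = ∑ i, btmul k (b i) (toDual (inv (tensorEval P C w) i)) := by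
      let g : ∀ i, BalTensor k P (dualObj E C) →ₗ[k] dualObj E C := fun i =>
        { toFun w := toDual (inv (tensorEval P C w) i)
          map_add' w w' := LinearMap.ext fun x => by
            change tensorEval P C (w + w') _ = _
            rw [map_add]
            rfl
          map_smul' r w := LinearMap.ext fun x => by
            change tensorEval P C (r • w) _ = _
            rw [map_smul]
            exact (dualObj_smul_lin r (toDual (inv (tensorEval P C w) i)) x).symm }
      have : LinearMap.id = ∑ i, bmk k P (dualObj E C) ∘ₗ
          TensorProduct.mk k P (dualObj E C) (b i) ∘ₗ g i := by
        refine bal_hom_ext fun p f => ?_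
        rw [LinearMap.sum_apply]
        have h1 : ∀ i, (bmk k P (dualObj E C) ∘ₗ TensorProduct.mk k P (dualObj E C) (b i) ∘ₗ g i)
            (btmul k p f) = btmul k (c i p • b i) f := fun i =>
          (smul_btmul k (c i p).unop (b i) f).symm
        rw [Finset.sum_congr rfl fun i _ => h1 i]
        have h2 := map_sum ((bmk k P (dualObj E C)) ∘ₗ (TensorProduct.mk k P (dualObj E C)).flip f)
          (fun i => c i p • b i) Finset.univ
        rw [hbc] at h2
        exact h2
      intro w
      have h3 := LinearMap.congr_fun this w
      rw [LinearMap.sum_apply] at h3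
      exact h3
    intro w hw
    rw [key w, hw]
    exact Finset.sum_eq_zero fun i _ => btmul_zero k (b i)
  · intro Φ
    refine ⟨∑ i, btmul k (b i) (toDual (inv Φ i)), LinearMap.ext fun α => ?_⟩
    rw [map_sum, LinearMap.sum_apply]
    change ∑ i, Φ ((c i).smulRight (α (b i))) = Φ α
    rw [← map_sum]
    congr 1
    ext p
    rw [LinearMap.sum_apply]
    conv_rhs => rw [← hbc p, map_sum]
    exact Finset.sum_congr rfl fun i _ => (map_smul α _ _).symm

/-- By adjunction, maps from `X` to Hom_k(Q, E) are k-linear maps from Q ⊗ X to `E`. Tensoring with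
the projective module `Q` preserves monomorphisms, and maps to `E` extend along them. -/
lemma injective_dualObj (hE : Injective E) (Q : ModuleCat.{u} Aᵐᵒᵖ) [Projective Q] :
    Injective (dualObj E Q) where
  factors {X Y} g f hf := by
    have hS : (ShortComplex.mk f (Limits.cokernel.π f) (Limits.cokernel.condition f)).ShortExact :=
      { exact := ShortComplex.exact_cokernel f }
    have hm := (shortExact_tensor k Q _ hS).mono_f
    let φ : BalTensor k Q X →ₗ[k] E := bdesc (TensorProduct.lift (LinearMap.mk₂ k
      (fun q x => HomDual.lin (g.hom x) q)
      (fun q q' x => map_add _ _ _)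
      (fun c q x => map_smul _ _ _)
      (fun q x x' => by rw [map_add]; rfl)
      (fun c q x => by
        have : g.hom (c • x) = c • g.hom x := (g.hom.restrictScalars k).map_smul c x
        rw [this]
        exact dualObj_smul_lin c (g.hom x) q))) (by
      intro q a x
      have h : g.hom (a • x) = a • g.hom x := map_smul g.hom a x
      change HomDual.lin (g.hom x) _ = HomDual.lin (g.hom (a • x)) q
      rw [h]
      rfl)
    let ψ := Injective.factorThru (ModuleCat.ofHom φ) (ModuleCat.ofHom (bmap k (𝟙 Q) f))
    have hψ : ∀ w, ψ.hom (bmap k (𝟙 Q) f w) = φ w := fun w =>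
      LinearMap.congr_fun (congrArg ModuleCat.Hom.hom
        (Injective.comp_factorThru (ModuleCat.ofHom φ) (ModuleCat.ofHom (bmap k (𝟙 Q) f)))) w
    let h : Y →ₗ[A] HomDual A Q E :=
      { toFun y := ψ.hom ∘ₗ bmk k Q Y ∘ₗ (TensorProduct.mk k Q Y).flip y
        map_add' y y' := LinearMap.ext fun q =>
          (congrArg ψ.hom (btmul_add k q y y')).trans (map_add _ _ _)
        map_smul' a y := LinearMap.ext fun q =>
          congrArg ψ.hom (smul_btmul k a q y).symm }
    refine ⟨ModuleCat.ofHom h, ?_⟩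
    refine ModuleCat.hom_ext (LinearMap.ext fun x => LinearMap.ext fun q => ?_)
    exact hψ (btmul k q x)

lemma dualMap_comp_dualMap {C C' C'' : ModuleCat.{u} Aᵐᵒᵖ} {f : C ⟶ C'} {g : C' ⟶ C''}
    (h : f ≫ g = 0) : dualMap E g ≫ dualMap E f = 0 := by
  rw [← CategoryTheory.Functor.map_comp, ← op_comp, h]
  exact ModuleCat.hom_ext (LinearMap.ext fun f => LinearMap.ext fun _ => map_zero (HomDual.lin f))

/-- The sequence of modules of homomorphisms of a short exact sequence. -/
lemma dual_shortExact (hE : Injective E) (S : ShortComplex (ModuleCat.{u} Aᵐᵒᵖ))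
    (hS : S.ShortExact) : (ShortComplex.mk (dualMap E S.g) (dualMap E S.f)
      (dualMap_comp_dualMap S.zero)).ShortExact := by
  have hinj : Function.Injective S.f.hom := (ModuleCat.mono_iff_injective _).1 hS.mono_f
  have hsurj : Function.Surjective S.g.hom := (ModuleCat.epi_iff_surjective _).1 hS.epi_g
  have hex : ∀ x, S.g.hom x = 0 → ∃ y, S.f.hom y = x :=
    (ShortComplex.moduleCat_exact_iff S).1 hS.exact
  have hzero : ∀ y, S.g.hom (S.f.hom y) = 0 := fun y =>
    LinearMap.congr_fun (congrArg ModuleCat.Hom.hom S.zero) y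
  refine ModuleCat.shortComplex_shortExact _ ?_ ?_ ?_
  · intro f
    constructor
    · intro hf
      have hf' : ∀ y, HomDual.lin f (S.f.hom y) = 0 := fun y => LinearMap.congr_fun hf y
      obtain ⟨ψ, hψ⟩ := exists_extension_of_ker_le hE (S.g.hom.restrictScalars k)
        (HomDual.lin f) (fun x hx => by
          obtain ⟨y, rfl⟩ := hex x hx
          exact hf' y)
      exact ⟨ψ, LinearMap.ext hψ⟩
    · rintro ⟨f, rfl⟩
      refine LinearMap.ext fun y => ?_
      exact (congrArg (HomDual.lin f) (hzero y)).trans (map_zero (HomDual.lin f))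
  · intro f f' hff
    refine LinearMap.ext fun x => ?_
    obtain ⟨x, rfl⟩ := hsurj x
    exact LinearMap.congr_fun hff x
  · intro f
    obtain ⟨ψ, hψ⟩ := exists_extension_of_ker_le hE (S.f.hom.restrictScalars k) (HomDual.lin f)
      (fun x hx => by
        obtain rfl : x = 0 := hinj (hx.trans (map_zero _).symm)
        exact map_zero _)
    exact ⟨ψ, LinearMap.ext hψ⟩

end DualModules

/-! ### Sequences of cosyzygies and the operator `1 - δ` -/

/-- Short exact sequences `0 ⟶ Zₙ ⟶ Jₙ ⟶ Zₙ₊₁ ⟶ 0` with injective middle terms. -/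
structure CosyzygySequence (A : Type u) [Ring A] where
  Z : ℕ → ModuleCat.{u} A
  seq : ℕ → ModuleCat.{u} A
  ι (n : ℕ) : Z n ⟶ seq n
  π (n : ℕ) : seq n ⟶ Z (n + 1)
  zero (n : ℕ) : ι n ≫ π n = 0
  shortExact (n : ℕ) : (ShortComplex.mk (ι n) (π n) (zero n)).ShortExact
  injective (n : ℕ) : Injective (seq n)

/-- Short exact sequences `0 ⟶ Cₙ₊₁ ⟶ Qₙ ⟶ Cₙ ⟶ 0` with projective middle terms. -/
structure SyzygySequence (A : Type u) [Ring A] where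
  C : ℕ → ModuleCat.{u} A
  Q : ℕ → ModuleCat.{u} A
  κ (n : ℕ) : C (n + 1) ⟶ Q n
  ρ (n : ℕ) : Q n ⟶ C n
  zero (n : ℕ) : κ n ≫ ρ n = 0
  shortExact (n : ℕ) : (ShortComplex.mk (κ n) (ρ n) (zero n)).ShortExact
  projective (n : ℕ) : Projective (Q n)

section Sequences

variable {A : Type u} [Ring A]

/-- The sequence of functorial cosyzygies. -/
def hullCosyzygies (N : ModuleCat.{u} A) : CosyzygySequence A where
  Z n := (cosyzygyIter A n).obj N
  seq n := (injHull A).obj ((cosyzygyIter A n).obj N)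
  ι _ := injHullι _
  π _ := cosyzygyπ _
  zero _ := injHullι_cosyzygyπ _
  shortExact _ := hullSeq_shortExact _
  injective _ := inferInstance

/-- The modules in a projective resolution by kernels. -/
def syzygyIter (B : ModuleCat.{u} A) : ℕ → ModuleCat.{u} A
  | 0 => B
  | n + 1 => Limits.kernel (Projective.π (syzygyIter B n))

/-- A sequence of syzygies of `B`. -/
def syzygies (B : ModuleCat.{u} A) : SyzygySequence A where
  C := syzygyIter B
  Q n := Projective.over (syzygyIter B n)
  κ n := Limits.kernel.ι (Projective.π (syzygyIter B n))
  ρ n := Projective.π (syzygyIter B n)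
  zero _ := Limits.kernel.condition _
  shortExact n :=
    { exact := ShortComplex.exact_kernel (Projective.π (syzygyIter B n))
      mono_f := inferInstanceAs (Mono (Limits.kernel.ι (Projective.π (syzygyIter B n))))
      epi_g := inferInstanceAs (Epi (Projective.π (syzygyIter B n))) }
  projective _ := inferInstance

variable {k : Type u} [CommRing k]

/-- The connecting homomorphisms of a sequence of cosyzygies. -/
def CosyzygySequence.δ (c : CosyzygySequence A) (T : ConnectedFamily k A) (n p : ℕ) :
    (T.F (Int.ofNat (p + 1))).obj (c.Z (n + 1)) →ₗ[k] (T.F (Int.ofNat p)).obj (c.Z n) :=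
  (T.δ (Int.ofNat p) _ (c.shortExact n)).hom

/-- The operator `1 - δ` is surjective on families of elements of `T_p (Z_n)`. -/
def CosyzygySequence.OneSubδSurjective (c : CosyzygySequence A) (T : ConnectedFamily k A) : Prop :=
  ∀ e : ∀ n p : ℕ, (T.F (Int.ofNat p)).obj (c.Z n),
    ∃ e' : ∀ n p : ℕ, (T.F (Int.ofNat p)).obj (c.Z n),
      ∀ n p, e' n p - c.δ T n p (e' (n + 1) (p + 1)) = e n p

/-- Surjectivity of `1 - δ` passes to retracts up to elements killed by `δ`. -/
lemma CosyzygySequence.OneSubδSurjective.of_retract {c c' : CosyzygySequence A}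
    {T T' : ConnectedFamily k A} (h : c.OneSubδSurjective T)
    (α : ∀ n p, (T.F (Int.ofNat p)).obj (c.Z n) →ₗ[k] (T'.F (Int.ofNat p)).obj (c'.Z n))
    (β : ∀ n p, (T'.F (Int.ofNat p)).obj (c'.Z n) →ₗ[k] (T.F (Int.ofNat p)).obj (c.Z n))
    (hα : ∀ n p x, c'.δ T' n p (α (n + 1) (p + 1) x) = α n p (c.δ T n p x))
    (hβα : ∀ n p y, c'.δ T' n p (α (n + 1) (p + 1) (β (n + 1) (p + 1) y)) = c'.δ T' n p y) :
    c'.OneSubδSurjective T' := by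
  intro y
  obtain ⟨x, hx⟩ := h fun n p => β n p (y n p)
  -- The image of the solution `x` under α solves the equation with right side α(β y). The summand y
  -- - α(β y) is killed by δ, so 1 - δ fixes it and it supplies the rest of `y`.
  refine ⟨fun n p => α n p (x n p) + (y n p - α n p (β n p (y n p))), fun n p => ?_⟩
  dsimp only
  rw [map_add, map_sub, hα, hβα, sub_self, add_zero, ← hx n p, map_sub]
  abel

lemma exists_cosyzygySequence_map (c c' : CosyzygySequence A) (f : c.Z 0 ⟶ c'.Z 0) :
    ∃ g : ∀ n, c.Z n ⟶ c'.Z n, g 0 = f ∧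
      ∀ n, ∃ φ : ShortComplex.mk (c.ι n) (c.π n) (c.zero n) ⟶
        ShortComplex.mk (c'.ι n) (c'.π n) (c'.zero n), φ.τ₁ = g n ∧ φ.τ₃ = g (n + 1) := by
  choose φ hφ using fun n (f : c.Z n ⟶ c'.Z n) =>
    exists_map_of_injective (S' := ShortComplex.mk (c'.ι n) (c'.π n) (c'.zero n))
      (c.shortExact n) (c'.injective n) f
  let g : ∀ n, c.Z n ⟶ c'.Z n := fun n => Nat.rec f (fun n g => (φ n g).τ₃) n
  exact ⟨g, rfl, fun n => ⟨φ n (g n), hφ n (g n), rfl⟩⟩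

/-- Surjectivity of `1 - δ` does not depend on the choice of the sequence of cosyzygies. -/
lemma CosyzygySequence.OneSubδSurjective.of_iso {c c' : CosyzygySequence A}
    {T : ConnectedFamily k A} (hT : T.IsHalfExact) (h : c.OneSubδSurjective T)
    (i : c.Z 0 ≅ c'.Z 0) : c'.OneSubδSurjective T := by
  obtain ⟨g, hg0, hg⟩ := exists_cosyzygySequence_map c c' i.hom
  obtain ⟨g', hg0', hg'⟩ := exists_cosyzygySequence_map c' c i.inv
  -- The composite of the comparison maps is the identity only up to maps through injective modules.
  -- It therefore acts as the identity only on images of δ, which is what `of_retract` requires.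
  have hgg : ∀ n, InjEquiv (g' n ≫ g n) (𝟙 _) := by
    intro n
    induction n with
    | zero => exact .of_eq (by rw [hg0, hg0', Iso.inv_hom_id])
    | succ n ih =>
      obtain ⟨φ, h1, h3⟩ := hg n
      obtain ⟨φ', h1', h3'⟩ := hg' n
      rw [← h3, ← h3']
      refine InjEquiv.third (c'.shortExact n) (c'.injective n) (φ' ≫ φ) (𝟙 _) ?_
      rw [ShortComplex.comp_τ₁, h1, h1']
      exact ih
  have key : ∀ n p x, c'.δ T n p (((T.F (Int.ofNat (p + 1))).map (g (n + 1))).hom x) =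
      ((T.F (Int.ofNat p)).map (g n)).hom (c.δ T n p x) := by
    intro n p x
    obtain ⟨φ, h1, h3⟩ := hg n
    rw [← h1, ← h3]
    exact T.δ_naturality_apply (Int.ofNat p) (c.shortExact n) (c'.shortExact n) φ x
  have key' : ∀ n p x, c.δ T n p (((T.F (Int.ofNat (p + 1))).map (g' (n + 1))).hom x) =
      ((T.F (Int.ofNat p)).map (g' n)).hom (c'.δ T n p x) := by
    intro n p x
    obtain ⟨φ, h1, h3⟩ := hg' n
    rw [← h1, ← h3]
    exact T.δ_naturality_apply (Int.ofNat p) (c'.shortExact n) (c.shortExact n) φ x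
  refine h.of_retract (fun n p => ((T.F (Int.ofNat p)).map (g n)).hom)
    (fun n p => ((T.F (Int.ofNat p)).map (g' n)).hom) key fun n p y => ?_
  rw [key, key', T.map_map_apply]
  refine (hT.map_δ_eq (c'.shortExact n) (hgg n) (Int.ofNat p) y).trans ?_
  exact T.map_id_apply _ _ _

/-- Surjectivity of `1 - δ` passes to retracts of families. -/
lemma CosyzygySequence.OneSubδSurjective.of_hom {c : CosyzygySequence A}
    {T T' : ConnectedFamily k A} (h : c.OneSubδSurjective T) (σ : T.Hom T') (τ : T'.Hom T)
    (hτσ : ∀ i N, (τ.app i).app N ≫ (σ.app i).app N = 𝟙 _) : c.OneSubδSurjective T' := by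
  refine h.of_retract (fun n p => ((σ.app (Int.ofNat p)).app (c.Z n)).hom)
    (fun n p => ((τ.app (Int.ofNat p)).app (c.Z n)).hom) (fun n p x => ?_) fun n p y => ?_
  · exact (ConcreteCategory.congr_hom (σ.comm (Int.ofNat p) _ (c.shortExact n)) x).symm
  · exact congrArg _ (ConcreteCategory.congr_hom (hτσ (Int.ofNat (p + 1)) (c.Z (n + 1))) y)

end Sequences

/-! ### The operator `1 - δ` for modules of homomorphisms -/

section DualSequence

variable {k : Type u} [CommRing k] {A : Type u} [Ring A] [Algebra k A] {E : ModuleCat.{u} k}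
  (hE : Injective E)

/-- The modules of homomorphisms from a sequence of syzygies are a sequence of cosyzygies. -/
def SyzygySequence.dual (s : SyzygySequence Aᵐᵒᵖ) : CosyzygySequence A where
  Z n := dualObj E (s.C n)
  seq n := dualObj E (s.Q n)
  ι n := dualMap E (s.ρ n)
  π n := dualMap E (s.κ n)
  zero n := dualMap_comp_dualMap (s.zero n)
  shortExact n := dual_shortExact hE _ (s.shortExact n)
  injective n :=
    haveI := s.projective n
    injective_dualObj hE (s.Q n)

end DualSequence

/-! ### Surjectivity of `1 - δ` for modules of homomorphisms -/

section DualSurjective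

variable (k : Type u) [CommRing k] {A : Type u} [Ring A] [Algebra k A]

/-- Composition with `f` on the right. -/
def precomp {P P' : ModuleCat.{u} Aᵐᵒᵖ} (f : P ⟶ P') (C : ModuleCat.{u} Aᵐᵒᵖ) :
    (P' →ₗ[Aᵐᵒᵖ] C) →ₗ[k] (P →ₗ[Aᵐᵒᵖ] C) where
  toFun α := α ∘ₗ f.hom
  map_add' _ _ := rfl
  map_smul' _ _ := rfl

/-- Composition with `g` on the left. -/
def postcomp (P : ModuleCat.{u} Aᵐᵒᵖ) {C C' : ModuleCat.{u} Aᵐᵒᵖ} (g : C ⟶ C') :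
    (P →ₗ[Aᵐᵒᵖ] C) →ₗ[k] (P →ₗ[Aᵐᵒᵖ] C') where
  toFun α := g.hom ∘ₗ α
  map_add' α β := LinearMap.ext fun x => map_add g.hom (α x) (β x)
  map_smul' c α := LinearMap.ext fun x => (g.hom.restrictScalars k).map_smul c (α x)

lemma exists_lift {P : ModuleCat.{u} Aᵐᵒᵖ} [Projective P] {S : ShortComplex (ModuleCat.{u} Aᵐᵒᵖ)}
    (hS : S.ShortExact) (β : P →ₗ[Aᵐᵒᵖ] S.X₃) : ∃ γ : P →ₗ[Aᵐᵒᵖ] S.X₂, S.g.hom ∘ₗ γ = β := by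
  have := hS.epi_g
  exact ⟨(Projective.factorThru (ModuleCat.ofHom β) S.g).hom,
    congrArg ModuleCat.Hom.hom (Projective.factorThru_comp (ModuleCat.ofHom β) S.g)⟩

lemma exists_factor {P : ModuleCat.{u} Aᵐᵒᵖ} {S : ShortComplex (ModuleCat.{u} Aᵐᵒᵖ)}
    (hS : S.ShortExact) (β : P →ₗ[Aᵐᵒᵖ] S.X₂) (hβ : S.g.hom ∘ₗ β = 0) :
    ∃ γ : P →ₗ[Aᵐᵒᵖ] S.X₁, S.f.hom ∘ₗ γ = β := by
  have := hS.mono_f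
  have h : ModuleCat.ofHom β ≫ S.g = 0 := ModuleCat.hom_ext hβ
  exact ⟨(hS.exact.lift (ModuleCat.ofHom β) h).hom,
    congrArg ModuleCat.Hom.hom (hS.exact.lift_f (ModuleCat.ofHom β) h)⟩

variable (P : ChainComplex (ModuleCat.{u} Aᵐᵒᵖ) ℕ) (s : SyzygySequence Aᵐᵒᵖ)

/-- The coboundaries in `Hom(P_p, C)`. -/
def coboundaries (C : ModuleCat.{u} Aᵐᵒᵖ) (p : ℕ) : Submodule k (P.X p →ₗ[Aᵐᵒᵖ] C) :=
  -- For `p = 0` the next index is `0` itself and the differential is zero, so there are no nonzero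
  -- coboundaries in degree zero.
  LinearMap.range (precomp k (P.d p ((ComplexShape.down ℕ).next p)) C)

lemma comp_d_mem_coboundaries {C : ModuleCat.{u} Aᵐᵒᵖ} {p m : ℕ} (β : P.X m →ₗ[Aᵐᵒᵖ] C) :
    β ∘ₗ (P.d p m).hom ∈ coboundaries k P C p := by
  by_cases h : (ComplexShape.down ℕ).Rel p m
  · obtain rfl := (ComplexShape.down ℕ).next_eq' h
    exact ⟨β, rfl⟩
  · have h0 : β ∘ₗ (P.d p m).hom = 0 := by
      rw [P.shape p m h]
      exact LinearMap.comp_zero β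
    rw [h0]
    exact zero_mem _

/-- The pairs of `α : P_p → Q_n` and `γ : P_{p+1} → C_{n+1}` that agree on `P_{p+1} → Q_n`. -/
def compatiblePairs (x : ℕ × ℕ) :
    Submodule k ((P.X x.2 →ₗ[Aᵐᵒᵖ] s.Q x.1) × (P.X (x.2 + 1) →ₗ[Aᵐᵒᵖ] s.C (x.1 + 1))) :=
  LinearMap.ker (precomp k (P.d (x.2 + 1) x.2) (s.Q x.1) ∘ₗ LinearMap.fst k _ _ -
    postcomp k (P.X (x.2 + 1)) (s.κ x.1) ∘ₗ LinearMap.snd k _ _)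

variable {P s}

lemma mem_compatiblePairs {x : ℕ × ℕ} (α : P.X x.2 →ₗ[Aᵐᵒᵖ] s.Q x.1)
    (γ : P.X (x.2 + 1) →ₗ[Aᵐᵒᵖ] s.C (x.1 + 1)) :
    (α, γ) ∈ compatiblePairs k P s x ↔
      α ∘ₗ (P.d (x.2 + 1) x.2).hom = (s.κ x.1).hom ∘ₗ γ :=
  sub_eq_zero

/-- A compatible pair (α, γ) is a computation of the connecting map Ext^p(M, C_n) → Ext^{p+1}(M,
C_{n+1}): it sends the class of ρα to that of γ. This is its well-definedness. If ρα is a coboundary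
βd, lift β to `Q n`. The difference between α and the lifted coboundary is κμ for some μ, and then γ
= μd. -/
lemma comp_mem_coboundaries_of_compatiblePairs (hP : ∀ n, Projective (P.X n)) {n p : ℕ}
    {α : P.X p →ₗ[Aᵐᵒᵖ] s.Q n} {γ : P.X (p + 1) →ₗ[Aᵐᵒᵖ] s.C (n + 1)}
    (h : α ∘ₗ (P.d (p + 1) p).hom = (s.κ n).hom ∘ₗ γ)
    (hα : (s.ρ n).hom ∘ₗ α ∈ coboundaries k P (s.C n) p) :
    γ ∈ coboundaries k P (s.C (n + 1)) (p + 1) := by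
  obtain ⟨β, hβ⟩ := hα
  obtain ⟨β', rfl⟩ := exists_lift (s.shortExact n) β
  obtain ⟨μ, hμ⟩ := exists_factor (s.shortExact n)
    (α - β' ∘ₗ (P.d p ((ComplexShape.down ℕ).next p)).hom)
    ((LinearMap.comp_sub _ _ _).trans (sub_eq_zero.2 hβ.symm))
  have hμγ : γ = μ ∘ₗ (P.d (p + 1) p).hom := by
    have := (s.shortExact n).mono_f
    have hinj : Function.Injective (s.κ n).hom := (ModuleCat.mono_iff_injective (s.κ n)).1 this
    refine LinearMap.ext fun x => hinj ?_
    have h1 := LinearMap.congr_fun h x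
    have h2 := LinearMap.congr_fun hμ ((P.d (p + 1) p).hom x)
    have h3 : (P.d p ((ComplexShape.down ℕ).next p)).hom ((P.d (p + 1) p).hom x) = 0 :=
      ConcreteCategory.congr_hom (P.d_comp_d _ _ _) x
    refine h1.symm.trans (Eq.trans ?_ h2.symm)
    rw [LinearMap.sub_apply, LinearMap.comp_apply, LinearMap.comp_apply, h3, map_zero, sub_zero]
  rw [hμγ]
  exact comp_d_mem_coboundaries k P μ

variable {k}
variable {E : ModuleCat.{u} k} (hE : Injective E)

lemma tensorEval_d {C : ModuleCat.{u} Aᵐᵒᵖ} {p m : ℕ}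
    (w : ((complexTensor k P).obj (dualObj E C)).X p) (β : P.X m →ₗ[Aᵐᵒᵖ] C) :
    tensorEval (P.X m) C ((((complexTensor k P).obj (dualObj E C)).d p m).hom w) β =
      tensorEval (P.X p) C w (β ∘ₗ (P.d p m).hom) :=
  tensorEval_naturality (P.d p m) (𝟙 C) w β

include hE in
/-- An element whose functional kills the cocycles is a boundary. -/
lemma exists_d_eq_of_tensorEval (hP : ∀ n, Projective (P.X n))
    (hfin : ∀ n, Module.Finite Aᵐᵒᵖ (P.X n)) {C : ModuleCat.{u} Aᵐᵒᵖ} {p : ℕ}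
    (w : ((complexTensor k P).obj (dualObj E C)).X p)
    (hw : ∀ α : P.X p →ₗ[Aᵐᵒᵖ] C, α ∘ₗ (P.d (p + 1) p).hom = 0 →
      tensorEval (P.X p) C w α = 0) :
    ∃ v, (((complexTensor k P).obj (dualObj E C)).d (p + 1) p).hom v = w := by
  obtain ⟨χ, hχ⟩ := exists_extension_of_ker_le hE (precomp k (P.d (p + 1) p) C)
    (tensorEval (P.X p) C w) hw
  obtain ⟨v, rfl⟩ := (tensorEval_bijective (E := E) (P.X (p + 1)) C).2 χ
  refine ⟨v, (tensorEval_bijective (E := E) (P.X p) C).1 (LinearMap.ext fun α => ?_)⟩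
  exact (tensorEval_d v α).trans (hχ α)

/-- Under `tensorEval` cycles are functionals that kill coboundaries, boundaries are functionals
that kill cocycles, and δ is dual to the connecting map on cocycles. The equation for classes thus
becomes the one for functionals in `exists_compatible_functionals`. -/
theorem oneSubδSurjective_dual {M : ModuleCat.{u} Aᵐᵒᵖ} (P : ProjectiveResolution M)
    (hfin : ∀ n, Module.Finite Aᵐᵒᵖ (P.complex.X n)) (s : SyzygySequence Aᵐᵒᵖ) :
    (s.dual hE).OneSubδSurjective (torFamily k P) := by
  intro e
  have hP := P.projective
  let K : ℕ → ChainComplex (ModuleCat.{u} k) ℕ := fun n =>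
    (complexTensor k P.complex).obj (dualObj E (s.C n))
  have hS := fun n => shortExact_complexTensor k P.complex P.projective _
    ((s.dual hE).shortExact n)
  choose w hw using fun n p => IsClass.exists_rep (K := K n) (n := p) (e n p)
  have hbij := fun n p => tensorEval_bijective (E := E) (P.complex.X p) (s.C n)
  obtain ⟨ψ, hψB, hψ⟩ := exists_compatible_functionals hE
    (K := fun x => P.complex.X x.2 →ₗ[Aᵐᵒᵖ] s.C x.1)
    (L := fun x => compatiblePairs k P.complex s x)
    (fun x => coboundaries k P.complex (s.C x.1) x.2)
    (fun x => postcomp k (P.complex.X x.2) (s.ρ x.1) ∘ₗ LinearMap.fst k _ _ ∘ₗ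
      (compatiblePairs k P.complex s x).subtype)
    (fun n p => LinearMap.snd k _ _ ∘ₗ (compatiblePairs k P.complex s (n, p)).subtype)
    (fun n p l hl => comp_mem_coboundaries_of_compatiblePairs k hP
      ((mem_compatiblePairs k l.1.1 l.1.2).1 l.2) hl)
    (fun x => tensorEval (P.complex.X x.2) (s.C x.1) (w x.1 x.2)) (by
      rintro ⟨n, p⟩ _ ⟨β, rfl⟩
      refine (tensorEval_d (w n p) β).symm.trans ?_
      have h0 : ((K n).d p ((ComplexShape.down ℕ).next p)).hom (w n p) = 0 := (hw n p).d_eq_zero _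
      exact (congrArg (fun y => tensorEval _ (s.C n) y β) h0).trans
        (LinearMap.congr_fun (map_zero (tensorEval _ _)) β))
  let θ : ∀ n p, (K n).X p →ₗ[k] (P.complex.X p →ₗ[Aᵐᵒᵖ] s.C n) →ₗ[k] E := fun n p =>
    tensorEval (P.complex.X p) (s.C n)
  choose w' hw' using fun n p => (show ∃ v, θ n p v = ψ (n, p) from (hbij n p).2 (ψ (n, p)))
  -- The differential of `w'` evaluates at β to the value of ψ at the coboundary βd, which is zero.
  have hcyc : ∀ n p m, ((K n).d p m).hom (w' n p) = 0 := by
    intro n p m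
    refine (hbij n m).1 (LinearMap.ext fun β => ?_)
    refine (tensorEval_d (w' n p) β).trans ?_
    exact ((LinearMap.congr_fun (hw' n p) _).trans
      (hψB (n, p) _ (comp_d_mem_coboundaries k P.complex β))).trans
      (LinearMap.congr_fun (map_zero (tensorEval _ _)) β).symm
  choose e' he' using fun n p => IsClass.exists_of_d_eq_zero (K := K n) (n := p) rfl (hcyc n p _)
  refine ⟨e', fun n p => ?_⟩
  obtain ⟨y, hy⟩ := g_surjective (hS n) (p + 1) (w' (n + 1) (p + 1))
  obtain ⟨(z : (K n).X p), hz⟩ := exists_f_eq (hS n) p (x := (((complexTensor k P.complex).obj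
      (dualObj E (s.Q n))).d (p + 1) p).hom y) (by
    refine (hom_d_apply _ (p + 1) p y).trans ?_
    exact (congrArg _ hy).trans (hcyc (n + 1) (p + 1) p))
  have hzc : IsClass (K n) p z ((s.dual hE).δ (torFamily k P) n p (e' (n + 1) (p + 1))) :=
    IsClass.δ (hS n) rfl (he' (n + 1) (p + 1)) hy hz
  have hcl := ((he' n p).sub hzc).sub (hw n p)
  -- Here `z` represents δ of the class of `w'`. A cocycle α has a lift α' to `Q n` with α'd = κγ,
  -- and evaluating `z` at α gives ψ(γ), as `y` lifts `w'` and its differential is the image of `z`.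
  -- The defining equation of ψ for the pair (α', γ) then shows that w' - z - w vanishes at α.
  obtain ⟨v, hv⟩ := exists_d_eq_of_tensorEval hE hP hfin (w' n p - z - w n p) (by
    intro α hα
    obtain ⟨α', rfl⟩ := exists_lift (s.shortExact n) α
    obtain ⟨γ, hγ⟩ := exists_factor (s.shortExact n) (α' ∘ₗ (P.complex.d (p + 1) p).hom) hα
    have h1 := hψ n p ⟨(α', γ), (mem_compatiblePairs k (x := (n, p)) α' γ).2 hγ.symm⟩
    have h2 : θ n p z ((s.ρ n).hom ∘ₗ α') =
        ψ (n + 1, p + 1) γ := by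
      have e1 := tensorEval_naturality (𝟙 (P.complex.X p)) (s.ρ n) z α'
      have e2 := tensorEval_naturality (𝟙 (P.complex.X (p + 1))) (s.κ n) y γ
      have e3 := tensorEval_d y α'
      rw [← hw', ← hy]
      refine e1.symm.trans (Eq.trans ?_ (e3.trans (Eq.trans ?_ e2.symm)))
      · exact congrArg (fun y => tensorEval _ _ y α') hz
      · exact congrArg (tensorEval _ _ y) hγ.symm
    change θ n p (w' n p - z - w n p) _ = 0
    rw [map_sub, map_sub, LinearMap.sub_apply, LinearMap.sub_apply, sub_eq_zero]
    refine Eq.trans ?_ h1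
    exact congrArg₂ (· - ·) (LinearMap.congr_fun (hw' n p) _) h2)
  rw [← sub_eq_zero]
  refine hcl.unique ?_
  rw [← hv]
  exact IsClass.of_d v

end DualSurjective

/-! ### Independence of choices, uniqueness of J-completions and the main theorem -/

section Main

variable {k : Type u} [CommRing k] {A : Type u} [Ring A]

/-- Surjectivity is known for the finitely generated resolution and the duals of syzygies. It passes
to the functorial cosyzygies, as both sequences start with the same module, and then to `P`, as the
two resolutions are homotopy equivalent. -/
theorem oneSubδSurjective_homDual [Algebra k A] {M : ModuleCat.{u} Aᵐᵒᵖ}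
    (hM : ∃ P₀ : ProjectiveResolution M, ∀ n, Module.Finite Aᵐᵒᵖ (P₀.complex.X n))
    {E : ModuleCat.{u} k} (hE : Injective E) (P : ProjectiveResolution M)
    (B : (ModuleCat.{u} Aᵐᵒᵖ)ᵒᵖ) : OneSubδSurjective (k := k) P ((homDual A E).obj B) := by
  obtain ⟨P₀, hfin⟩ := hM
  have h1 := oneSubδSurjective_dual hE P₀ hfin (syzygies B.unop)
  have h2 : (hullCosyzygies ((homDual A E).obj B)).OneSubδSurjective (torFamily k P₀) :=
    h1.of_iso (torFamily_isHalfExact k P₀) (Iso.refl _)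
  exact h2.of_hom (torFamilyMap k (ProjectiveResolution.homotopyEquiv P₀ P).hom)
    (torFamilyMap k (ProjectiveResolution.homotopyEquiv P₀ P).inv)
    (torFamilyMap_comp_eq_id k _ _ (ProjectiveResolution.homotopyEquiv P₀ P).homotopyInvHomId)

namespace ConnectedFamily

variable {T : ConnectedFamily k A}

/-- J-completions are unique. -/
lemma Hom.IsJCompletion.nonempty_iso {C D : ConnectedFamily k A} {τ : C.Hom T} {τ' : D.Hom T}
    (h : τ.IsJCompletion) (h' : τ'.IsJCompletion) (i : ℤ) : Nonempty (C.F i ≅ D.F i) := by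
  obtain ⟨σ, hσ, -⟩ := h'.existsUnique_lift C h.acyclic τ
  obtain ⟨σ', hσ', -⟩ := h.existsUnique_lift D h'.acyclic τ'
  let idHom (U : ConnectedFamily k A) : U.Hom U := ⟨fun _ => 𝟙 _, fun i S hS => by simp⟩
  have key : ∀ {U : ConnectedFamily k A} {υ : U.Hom T} (_ : υ.IsJCompletion) (ρ : U.Hom U),
      ρ.comp υ = υ → ρ = idHom U := fun {U υ} hυ ρ hρ =>
    (hυ.existsUnique_lift U hυ.acyclic υ).unique hρ
      (Hom.ext (funext fun i => Category.id_comp _))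
  have assoc : ∀ {U V W : ConnectedFamily k A} (a : U.Hom V) (b : V.Hom W) (c : W.Hom T),
      (a.comp b).comp c = a.comp (b.comp c) := fun a b c =>
    Hom.ext (funext fun i => Category.assoc _ _ _)
  have e1 := key h (σ.comp σ') (by rw [assoc, hσ', hσ])
  have e2 := key h' (σ'.comp σ) (by rw [assoc, hσ, hσ'])
  exact ⟨⟨σ.app i, σ'.app i, congrFun (congrArg Hom.app e1) i, congrFun (congrArg Hom.app e2) i⟩⟩

end ConnectedFamily

end Main

end CompleteHomology

end

open CategoryTheory CompleteHomology in
theorem mainTheorem3 {k : Type u} [CommRing k] {R : Type u} [Ring R] [Algebra k R]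
    (M : ModuleCat.{u} Rᵐᵒᵖ)
    (hM : ∃ P₀ : ProjectiveResolution M, ∀ n, Module.Finite Rᵐᵒᵖ (P₀.complex.X n))
    (E : ModuleCat.{u} k) (hE : Injective E) (P : ProjectiveResolution M) :
    (∃ (C : ConnectedFamily k R) (τ : C.Hom (torFamily k P)), τ.IsJCompletion) ∧
    ∀ (C : ConnectedFamily k R) (τ : C.Hom (torFamily k P)), τ.IsJCompletion →
      ∀ i : ℤ, Nonempty (homDual R E ⋙ C.F i ≅ homDual R E ⋙ stableTor k P i) := by
  have hT := torFamily_isHalfExact k P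
  refine ⟨⟨_, _, ConnectedFamily.completionπ_isJCompletion hT⟩, fun C τ hτ i => ?_⟩
  obtain ⟨e⟩ := hτ.nonempty_iso (ConnectedFamily.completionπ_isJCompletion hT) i
  obtain ⟨e'⟩ := completion_iso_stableTor P (homDual R E) (oneSubδSurjective_homDual hM hE P) i
  exact ⟨Functor.isoWhiskerLeft (homDual R E) e ≪≫ e'⟩
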